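/- **Conventions.** Digraphs are finite. For a digraph $H$, $|H|$ is its number of vertices. An *oriented tree* (respectively *oriented forest*) is a digraph without loops, with at most one edge between any two vertices, whose underlying graph is a tree (respectively has no cycle); its *leaves* are the vertices of degree $1$ in the underlying graph. A *tournament* is a loopless digraph with exactly one of the edges $uv$, $vu$ for all distinct vertices $u,v$. A *directed path* $v_0\to v_1\to\dots\to v_\ell$ (with $\ell\ge 0$ and distinct $v_i$) has length $\ell$, first vertex $v_0$ and last vertex $v_\ell$. A sequence $P_1\dots P_s$ of directed paths is a *path partition* of a directed path $P$ if $P=\bigcup_i P_i$, the last vertex of $P_i$ is the first vertex of $P_{i+1}$ for each $i<s$, and the paths are otherwise pairwise vertex-disjoint (whenever $i<j$, a vertex on both $P_i$ and $P_j$ is the last vertex of $P_i$ and the first vertex of $P_j$). An *out-arborescence* (respectively *in-arborescence*) with root $t$ is an oriented tree containing $t$ in which, for every vertex $v$, the path between $t$ and $v$ is directed from $t$ to $v$ (respectively from $v$ to $t$). An *in-leaf* is a vertex with in-degree $0$ and out-degree $1$, an *out-leaf* one with out-degree $0$ and in-degree $1$. For $\diamond\in\{+,-\}$, $+$-neighbours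 are out-neighbours and $-$-neighbours are in-neighbours. $[s]=\{1,\dots,s\}$. **Definition.** Let $r\ge 1$ be an integer and $m$ a real number. A digraph $D$ is an *$(r,m)$-good decomposition* of an oriented tree $T$ if $V(D)=V(T)$ and there are distinct $x,y\in V(D)$; a directed path $P$ from $x$ to $y$ with a path partition $P=P_1S_2P_2S_3\dots P_{r-1}S_rP_r$ into directed paths; an in-arborescence $S_1$ with root $x$; an out-arborescence $S_{r+1}$ with root $y$; oriented forests $F_i^+,F_i^-$ for $i\in[r+1]$; and, for some $0\le \ell\le 2r$, vertices $s_j,t_j$ and directed paths $Q_j$ from $s_j$ to $t_j$ for $j\in[\ell]$, such that, writing $F_i=F_i^-\cup F_i^+$: 1. $T\subseteq S_1\cup P\cup S_{r+1}\cup\bigcup_{i\in[r+1]}F_i\cup\bigcup_{j\in[\ell]}Q_j=D$. 2. The following sets (some possibly empty), over $i\in[r+1]$ and $j\in[\ell]$, are pairwise disjoint with union $V(T)$: $V(P)$, $V(F_i^+)\setminus V(S_i)$, $V(F_i^-)\setminus V(S_i)$, $V(S_1)\setminus\{x\}$, $V(S_{r+1})\setminus\{y\}$, $V(Q_j)\setminus\{s_j,t_j\}$.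 3. Each $P_i$, $i\in[r]$, has length at least $2000m$. 4. For each $i\in[r+1]$ and $\diamond\in\{+,-\}$: $V(S_i)\subseteq V(F_i^\diamond)$, $|F_i^\diamond|\le m$, and each component of $F_i^\diamond$ has exactly one vertex in $V(S_i)$, which furthermore has only $\diamond$-neighbours in $F_i^\diamond$. 5. $F_1^-$ and $F_{r+1}^+$ have no edges, and $|S_1|,|S_{r+1}|\ge 2$. 6. The number of in-leaves of $S_1$ plus the number of out-leaves of $S_{r+1}$ is at most the number of leaves of $T$. 7. For each $a\in[\ell]$, either (i) for some $1\le j<j'\le r+1$, $s_a\in V(F_j)$, $t_a\in V(F_{j'})$ and $Q_a$ has length $3(j'-j)+1$; or (ii) for some $2\le j\le r$, $s_a\in V(F_j^-)\setminus V(S_j)$, $t_a$ is the last vertex of $S_j$, and $Q_a$ has length $3$. **Lemma 4.4.** For every real $\mu>0$ and all integers $r,k\ge 1$ there is an $n_0$ such that the following holds for every $n\ge n_0$ and every real $m\ge\mu n$. Every tournament with $n+k-2$ vertices contains a copy of every $n$-vertex oriented tree with exactly $k$ leaves that has an $(r,m)$-good decomposition. -/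

import Mathlib

namespace TreesInTournaments

/-- An oriented graph: a digraph with at most one edge between any two vertices (and no loops). -/
def IsOriented {V : Type*} (D : Digraph V) : Prop :=
  ∀ u v, D.Adj u v → ¬ D.Adj v u

/-- A tournament: no loops, and exactly one of `uv`, `vu` is an edge whenever `u ≠ v`. -/
def IsTournament {V : Type*} (G : Digraph V) : Prop :=
  (∀ v, ¬ G.Adj v v) ∧ ∀ u v, u ≠ v → Xor (G.Adj u v) (G.Adj v u)

/-- An oriented tree: an oriented graph whose underlying graph is a tree. -/
def IsOrientedTree {V : Type*} (T : Digraph V) : Prop :=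
  IsOriented T ∧ T.toSimpleGraphInclusive.IsTree

/-- An oriented forest: an oriented graph whose underlying graph has no cycle. -/
def IsOrientedForest {V : Type*} (T : Digraph V) : Prop :=
  IsOriented T ∧ T.toSimpleGraphInclusive.IsAcyclic

/-- The leaves: the vertices of degree one in the underlying graph. -/
def leaves {V : Type*} (T : Digraph V) : Set V :=
  {v | (T.toSimpleGraphInclusive.neighborSet v).ncard = 1}

/-- `G` contains a copy of `T`. -/
def ContainsCopy {V W : Type*} (G : Digraph W) (T : Digraph V) : Prop :=
  ∃ f : V ↪ W, ∀ u v, T.Adj u v → G.Adj (f u) (f v)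

/-- The symbol `◇ ∈ {+, -}`; `+` stands for "out" and `-` for "in". -/
inductive Sign : Type
  | plus : Sign
  | minus : Sign

/-- A digraph whose vertex set is a subset of `V`. -/
@[ext]
structure SubDigraph (V : Type*) where
  verts : Set V
  Adj : V → V → Prop
  left_mem : ∀ {u v}, Adj u v → u ∈ verts
  right_mem : ∀ {u v}, Adj u v → v ∈ verts

namespace SubDigraph

variable {V : Type*}

/-- The digraph on the vertex set of `H`. -/
def coe (H : SubDigraph V) : Digraph H.verts := ⟨fun u v => H.Adj u v⟩

/-- A digraph with vertex set all of `V`. -/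
def ofDigraph (D : Digraph V) : SubDigraph V where
  verts := Set.univ
  Adj := D.Adj
  left_mem _ := trivial
  right_mem _ := trivial

/-- The union of a family of digraphs: take the union of vertex sets and of edge sets. -/
def iUnion {ι : Sort*} (H : ι → SubDigraph V) : SubDigraph V where
  verts := ⋃ i, (H i).verts
  Adj u v := ∃ i, (H i).Adj u v
  left_mem := fun ⟨i, h⟩ => Set.mem_iUnion.2 ⟨i, (H i).left_mem h⟩
  right_mem := fun ⟨i, h⟩ => Set.mem_iUnion.2 ⟨i, (H i).right_mem h⟩

/-- The union of two digraphs. -/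
def union (H K : SubDigraph V) : SubDigraph V where
  verts := H.verts ∪ K.verts
  Adj u v := H.Adj u v ∨ K.Adj u v
  left_mem := fun h => h.imp H.left_mem K.left_mem
  right_mem := fun h => h.imp H.right_mem K.right_mem

instance : Union (SubDigraph V) := ⟨union⟩

/-- `H ⊆ K`: containment of vertex sets and of edge sets. -/
instance : HasSubset (SubDigraph V) :=
  ⟨fun H K => H.verts ⊆ K.verts ∧ ∀ u v, H.Adj u v → K.Adj u v⟩

/-- The number of vertices. -/
noncomputable def order (H : SubDigraph V) : ℕ := H.verts.ncard

/-- The out-neighbourhood of `v` for the sign `+`, the in-neighbourhood for the sign `-`. -/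
def nbrs (H : SubDigraph V) : Sign → V → Set V
  | .plus, v => {w | H.Adj v w}
  | .minus, v => {w | H.Adj w v}

/-- In `H`, the vertex `v` has only `◇`-neighbours. -/
def OnlyNbrs (H : SubDigraph V) : Sign → V → Prop
  | .plus, v => H.nbrs .minus v = ∅
  | .minus, v => H.nbrs .plus v = ∅

/-- The in-leaves: leaves whose only incident edge leaves them. -/
def inLeaves (H : SubDigraph V) : Set V :=
  {v ∈ H.verts | H.nbrs .minus v = ∅ ∧ (H.nbrs .plus v).ncard = 1}

/-- The out-leaves: leaves whose only incident edge enters them. -/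
def outLeaves (H : SubDigraph V) : Set V :=
  {v ∈ H.verts | H.nbrs .plus v = ∅ ∧ (H.nbrs .minus v).ncard = 1}

end SubDigraph

/-- A directed path `v₀ → v₁ → ⋯ → v_l`, given by its (non-empty, repetition-free) sequence of
vertices. -/
structure DiPath (V : Type*) where
  support : List V
  ne_nil : support ≠ []
  nodup : support.Nodup

namespace DiPath

variable {V : Type*}

def first (p : DiPath V) : V := p.support.head p.ne_nil

def last (p : DiPath V) : V := p.support.getLast p.ne_nil

/-- The number of edges. -/
def length (p : DiPath V) : ℕ := p.support.length - 1

/-- The path as a digraph: its edges are the pairs of consecutive vertices. -/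
def toSub (p : DiPath V) : SubDigraph V where
  verts := {v | v ∈ p.support}
  Adj u v := [u, v] <:+: p.support
  left_mem := fun h => h.subset (by simp)
  right_mem := fun h => h.subset (by simp)

end DiPath

/-- The sequence `L = P₁ … P_l` of directed paths is a path partition of `P`: `P` is their union,
each path ends where the next one starts, and apart from these common endvertices the paths are
pairwise vertex disjoint. -/
def IsPathPartition {V : Type*} (P : DiPath V) (L : List (DiPath V)) : Prop :=
  P.toSub = SubDigraph.iUnion (fun i : Fin L.length => (L.get i).toSub) ∧
  (∀ i j : Fin L.length, (j : ℕ) = i + 1 → (L.get i).last = (L.get j).first) ∧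
  (∀ i j : Fin L.length, i < j → ∀ v, v ∈ (L.get i).support → v ∈ (L.get j).support →
    v = (L.get i).last ∧ v = (L.get j).first)

/-- `A` is an out-arborescence with root `t`: an oriented tree in which, for every vertex `v`, the
path between `t` and `v` is directed from `t` to `v`. -/
def IsOutArborescence {V : Type*} (A : SubDigraph V) (t : V) : Prop :=
  IsOrientedTree A.coe ∧ t ∈ A.verts ∧
    ∀ v ∈ A.verts, ∃ p : DiPath V, p.first = t ∧ p.last = v ∧ p.toSub ⊆ A

/-- `A` is an in-arborescence with root `t`: an oriented tree in which, for every vertex `v`, the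
path between `t` and `v` is directed from `v` to `t`. -/
def IsInArborescence {V : Type*} (A : SubDigraph V) (t : V) : Prop :=
  IsOrientedTree A.coe ∧ t ∈ A.verts ∧
    ∀ v ∈ A.verts, ∃ p : DiPath V, p.first = v ∧ p.last = t ∧ p.toSub ⊆ A

/-- Indices of the sets in the vertex partition of a good decomposition. -/
inductive PartIndex (r l : ℕ) : Type
  | path : PartIndex r l
  | forest (d : Sign) (i : ℕ) (h : 1 ≤ i ∧ i ≤ r + 1) : PartIndex r l
  | inArb : PartIndex r l
  | outArb : PartIndex r l
  | link (j : Fin l) : PartIndex r l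

/-- `D` is an `(r, m)`-good decomposition for `T`, where `V(D) = V(T) = V`. The indices of `P_i`,
`S_i`, `F_i` are natural numbers; only the values `P_i` for `1 ≤ i ≤ r`, `S_i` for `2 ≤ i ≤ r` (the
directed paths, `segS`) and `F_i` for `1 ≤ i ≤ r + 1` play a role. -/
structure GoodDecomposition {V : Type*} (r : ℕ) (m : ℝ) (D T : Digraph V) where
  x : V
  y : V
  x_ne_y : x ≠ y
  /-- the directed `x,y`-path `P` -/
  P : DiPath V
  P_first : P.first = x
  P_last : P.last = y
  /-- the paths `P_i`, `1 ≤ i ≤ r` -/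
  segP : ℕ → DiPath V
  /-- the paths `S_i`, `2 ≤ i ≤ r` -/
  segS : ℕ → DiPath V
  /-- `P = P₁ S₂ P₂ S₃ … P_{r-1} S_r P_r` -/
  partition_P : IsPathPartition P
    (segP 1 :: (List.range' 2 (r - 1)).flatMap (fun i => [segS i, segP i]))
  /-- the in-arborescence `S₁` -/
  inArb : SubDigraph V
  isIn : IsInArborescence inArb x
  /-- the out-arborescence `S_{r+1}` -/
  outArb : SubDigraph V
  isOut : IsOutArborescence outArb y
  /-- the digraphs `S_i`, `1 ≤ i ≤ r + 1` -/
  S : ℕ → SubDigraph V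
  S_first : S 1 = inArb
  S_last : S (r + 1) = outArb
  S_mid : ∀ i, 2 ≤ i → i ≤ r → S i = (segS i).toSub
  /-- the forests `F_i^◇`, `1 ≤ i ≤ r + 1` -/
  F : Sign → ℕ → SubDigraph V
  l : ℕ
  l_le : l ≤ 2 * r
  /-- the paths `Q_i`, `i ∈ [l]`; the vertices `s_i`, `t_i` are its first and its last vertex -/
  Q : Fin l → DiPath V
  /-- `T ⊆ D` -/
  T_sub : SubDigraph.ofDigraph T ⊆ SubDigraph.ofDigraph D
  /-- `D = S₁ ∪ P ∪ S_{r+1} ∪ ⋃ F_i ∪ ⋃ Q_i` -/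
  D_eq : SubDigraph.ofDigraph D = inArb ∪ P.toSub ∪ outArb ∪
    SubDigraph.iUnion (fun i : Set.Icc 1 (r + 1) => F .minus i ∪ F .plus i) ∪
    SubDigraph.iUnion (fun j : Fin l => (Q j).toSub)
  /-- the sets which partition `V(T) = V(D)`, some of which may be empty -/
  part : PartIndex r l → Set V
  part_path : part .path = P.toSub.verts
  part_forest : ∀ d i h, part (.forest d i h) = (F d i).verts \ (S i).verts
  part_inArb : part .inArb = inArb.verts \ {x}
  part_outArb : part .outArb = outArb.verts \ {y}
  part_link : ∀ j, part (.link j) = (Q j).toSub.verts \ {(Q j).first, (Q j).last}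
  part_disjoint : Pairwise (fun a b => Disjoint (part a) (part b))
  part_cover : ⋃ a, part a = Set.univ
  length_segP : ∀ i, 1 ≤ i → i ≤ r → 2000 * m ≤ ((segP i).length : ℝ)
  S_sub_F : ∀ d i, 1 ≤ i → i ≤ r + 1 → (S i).verts ⊆ (F d i).verts
  order_F : ∀ d i, 1 ≤ i → i ≤ r + 1 → ((F d i).order : ℝ) ≤ m
  forest_F : ∀ d i, 1 ≤ i → i ≤ r + 1 → IsOrientedForest (F d i).coe
  /-- each component of `F_i^◇` has exactly one vertex in `S_i` -/
  component_F : ∀ d i, 1 ≤ i → i ≤ r + 1 →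
    ∀ c : (F d i).coe.toSimpleGraphInclusive.ConnectedComponent,
      ∃! v : (F d i).verts, v ∈ c.supp ∧ (v : V) ∈ (S i).verts
  /-- and this vertex has only `◇`-neighbours in `F_i^◇` -/
  nbrs_F : ∀ d i, 1 ≤ i → i ≤ r + 1 → ∀ v ∈ (S i).verts, (F d i).OnlyNbrs d v
  F_first : ∀ u v, ¬ (F .minus 1).Adj u v
  F_last : ∀ u v, ¬ (F .plus (r + 1)).Adj u v
  two_le_inArb : 2 ≤ inArb.order
  two_le_outArb : 2 ≤ outArb.order
  leaves_le : inArb.inLeaves.ncard + outArb.outLeaves.ncard ≤ (leaves T).ncard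
  link_Q : ∀ a : Fin l,
    (∃ j j', 1 ≤ j ∧ j < j' ∧ j' ≤ r + 1 ∧
      (Q a).first ∈ (F .minus j ∪ F .plus j).verts ∧
      (Q a).last ∈ (F .minus j' ∪ F .plus j').verts ∧
      (Q a).length = 3 * (j' - j) + 1) ∨
    (∃ j, 2 ≤ j ∧ j ≤ r ∧
      (Q a).first ∈ (F .minus j).verts \ (S j).verts ∧
      (Q a).last = (segS j).last ∧
      (Q a).length = 3)

/-- `T` has an `(r, m)`-good decomposition. -/
def HasGoodDecomposition {V : Type*} (r : ℕ) (m : ℝ) (T : Digraph V) : Prop :=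
  ∃ D : Digraph V, Nonempty (GoodDecomposition r m D T)

end TreesInTournaments

namespace TreesInTournaments

open Finset

/-! The vertices of the tournament are numbered along a median order, an order with as many forward
edges as possible. In such an order every vertex sends edges to at least half of each interval that
starts right behind it, and receives edges from at least half of each interval that ends right
before it (`IsMedian.out_half`, `IsMedian.in_half`). These properties pass to subintervals, so
different pieces of the tree can be embedded in different stretches of one order.

Let `p` and `q` be the numbers of in-leaves of `S₁` and of out-leaves of `S_{r+1}`. Since `p + q ≤
k`, there are at least `n + p + q - 2` positions. The first `|S₁| + p - 1` of those used are
reserved for `S₁`, the last `|S_{r+1}| + q - 1` for `S_{r+1}`. The greedy embedding of Dross and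
Havet (`IsMedian.exists_arborescence_embedding`) fits each arborescence there, with its root at the
end facing the rest. This spends all the spare positions, so the part in between must be filled
without waste. Each path `S_i` is a spanning path of an interval of exactly `|S_i|` positions, and
the region between two consecutive cores has exactly as many positions as there are vertices to be
put into it.

Inside a region, the forests attached to the two neighbouring cores are embedded crudely in zones
near those cores, where every core vertex has many neighbours of the right kind
(`exists_forest_extension`). The links cross the regions with three inner vertices in each, or two
for a short link, by `IsMedian.exists_three_path`. All this occupies few positions compared with the
length at least `2000 m` of `P_i`, so what is left of the region still has a spanning path from the
end of one core to the start of the next (`IsMedian.exists_spanning_path`). By the choice of the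
lengths, this path has as many vertices as `P_i` and serves as its image. -/

open scoped Classical in
/-- The integers in `[lo, hi]`, in their natural order, form a median order of the tournament `R`:
moving a set `Y` to the front does not increase the number of forward edges. -/
structure IsMedian (R : ℤ → ℤ → Prop) (lo hi : ℤ) : Prop where
  tour : ∀ i j, lo ≤ i → i ≤ hi → lo ≤ j → j ≤ hi → i ≠ j → (R i j ↔ ¬ R j i)
  shift : ∀ Y : Finset ℤ, Y ⊆ Icc lo hi →
    #{p ∈ (Icc lo hi \ Y) ×ˢ Y | p.1 < p.2 ∧ R p.2 p.1} ≤
      #{p ∈ (Icc lo hi \ Y) ×ˢ Y | p.1 < p.2 ∧ R p.1 p.2}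

/-! ### Existence of median orders -/

section Existence

open scoped Classical

/-- An order is encoded as an injection into `ℤ`, which leaves room to move sets of vertices by
translation. The counts are bounded by the number of all pairs, so a maximum is attained. -/
theorem exists_injective_maximizing_forward {α : Type*} [Fintype α] (r : α → α → Prop) :
    ∃ f : α → ℤ, Function.Injective f ∧ ∀ f' : α → ℤ, Function.Injective f' →
      #{p : α × α | f' p.1 < f' p.2 ∧ r p.1 p.2} ≤ #{p : α × α | f p.1 < f p.2 ∧ r p.1 p.2} := by
  set s : Set ℕ := {n | ∃ f : α → ℤ, Function.Injective f ∧
    #{p : α × α | f p.1 < f p.2 ∧ r p.1 p.2} = n} with hs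
  have hne : s.Nonempty := by
    refine ⟨_, fun a => ((Fintype.equivFin α a : ℕ) : ℤ), ?_, rfl⟩
    intro a b hab
    exact (Fintype.equivFin α).injective (Fin.ext (by simpa using hab))
  have hbd : BddAbove s := by
    refine ⟨Fintype.card (α × α), ?_⟩
    rintro n ⟨f, -, rfl⟩
    exact card_le_univ _
  obtain ⟨f, hf, hn⟩ := Nat.sSup_mem hne hbd
  exact ⟨f, hf, fun f' hf' => hn ▸ le_csSup hbd ⟨f', hf', rfl⟩⟩

theorem shift_of_maximizing_forward {α : Type*} [Fintype α] (r : α → α → Prop) (f : α → ℤ)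
    (hf : Function.Injective f)
    (hmax : ∀ f' : α → ℤ, Function.Injective f' →
      #{p : α × α | f' p.1 < f' p.2 ∧ r p.1 p.2} ≤ #{p : α × α | f p.1 < f p.2 ∧ r p.1 p.2})
    (Y : Finset α) :
    #{p ∈ Yᶜ ×ˢ Y | f p.1 < f p.2 ∧ r p.2 p.1} ≤ #{p ∈ Yᶜ ×ˢ Y | f p.1 < f p.2 ∧ r p.1 p.2} := by
  -- Lowering `f` by such a `K` on `Y` puts `Y` in front of its complement and changes no order
  -- inside either set.
  obtain ⟨K, hK⟩ : ∃ K : ℤ, ∀ a b, f a - f b < K := by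
    refine ⟨∑ a, ∑ b, |f a - f b| + 1, fun a b => ?_⟩
    have h1 : |f a - f b| ≤ ∑ b, |f a - f b| :=
      single_le_sum (f := fun b => |f a - f b|) (fun _ _ => abs_nonneg _) (mem_univ b)
    have h2 : ∑ b, |f a - f b| ≤ ∑ a, ∑ b, |f a - f b| :=
      single_le_sum (f := fun a => ∑ b, |f a - f b|)
        (fun _ _ => sum_nonneg fun _ _ => abs_nonneg _) (mem_univ a)
    have := le_abs_self (f a - f b)
    omega
  set f' : α → ℤ := fun a => if a ∈ Y then f a - K else f a with hf'
  have hinj : Function.Injective f' := by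
    intro a b hab
    have h1 := hK a b
    have h2 := hK b a
    simp only [hf'] at hab
    split_ifs at hab
    · exact hf (by omega)
    · omega
    · omega
    · exact hf hab
  have hle := hmax f' hinj
  set A := ({p : α × α | f p.1 < f p.2 ∧ r p.1 p.2} : Finset (α × α)) with hA
  set A' := ({p : α × α | f' p.1 < f' p.2 ∧ r p.1 p.2} : Finset (α × α)) with hA'
  set B := {p ∈ Yᶜ ×ˢ Y | f p.1 < f p.2 ∧ r p.1 p.2} with hB
  set C := {p ∈ Yᶜ ×ˢ Y | f p.1 < f p.2 ∧ r p.2 p.1} with hC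
  have hBA : B ⊆ A := by
    intro p hp
    simp only [hB, hA, mem_filter, mem_univ, true_and] at hp ⊢
    exact hp.2
  have hCc : #(C.image Prod.swap) = #C := card_image_of_injective _ Prod.swap_injective
  -- The move loses no forward pairs except those in `B`, and it makes the pairs in `C` forward;
  -- maximality then yields `#C ≤ #B`.
  have hsub : (A \ B) ∪ C.image Prod.swap ⊆ A' := by
    rintro ⟨u, v⟩ hp
    simp only [mem_union, mem_sdiff, hA, hB, hC, mem_filter, mem_univ, true_and, mem_product,
      mem_compl, mem_image, Prod.exists, Prod.swap_prod_mk, Prod.mk.injEq] at hp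
    simp only [hA', mem_filter, mem_univ, true_and, hf']
    have h1 := hK u v
    rcases hp with ⟨⟨h2, h3⟩, h4⟩ | ⟨a, b, ⟨⟨h2, h3⟩, h4, h5⟩, rfl, rfl⟩
    · refine ⟨?_, h3⟩
      split_ifs
      · omega
      · omega
      · exact absurd ⟨⟨‹_›, ‹_›⟩, h2, h3⟩ h4
      · omega
    · refine ⟨?_, h5⟩
      simp only [h3, h2, if_true, if_false]
      omega
  have hdis : Disjoint (A \ B) (C.image Prod.swap) := by
    rw [disjoint_left]
    rintro ⟨u, v⟩ hp hq
    simp only [mem_sdiff, hA, hC, mem_filter, mem_univ, true_and, mem_product,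
      mem_compl, mem_image, Prod.exists, Prod.swap_prod_mk, Prod.mk.injEq] at hp hq
    obtain ⟨a, b, ⟨-, h4, -⟩, rfl, rfl⟩ := hq
    have := hp.1.1
    omega
  have h1 := card_le_card hsub
  rw [card_union_of_disjoint hdis, hCc, card_sdiff_of_subset hBA] at h1
  have h2 := card_le_card hBA
  omega

/-- The ranks of the vertices under a maximizing injection are the integers `0, …, |α| - 1`. The
enumeration is the inverse of the rank function, and the shift property is carried over along it. -/
theorem exists_median_order {α : Type*} [Fintype α] [Nonempty α] (r : α → α → Prop)
    (ht : ∀ a b, a ≠ b → (r a b ↔ ¬ r b a)) :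
    ∃ e : ℤ → α, Set.InjOn e (Set.Icc 0 (Fintype.card α - 1)) ∧
      IsMedian (fun i j => r (e i) (e j)) 0 (Fintype.card α - 1) := by
  obtain ⟨f, hf, hmax⟩ := exists_injective_maximizing_forward r
  set g : α → ℤ := fun a => (#{b | f b < f a} : ℕ) with hg
  have hmono : ∀ a b, f a < f b → g a < g b := by
    intro a b hab
    simp only [hg, Nat.cast_lt]
    refine card_lt_card ⟨fun c hc => ?_, fun hc => ?_⟩
    · simp only [mem_filter, mem_univ, true_and] at hc ⊢
      omega
    · have : a ∈ ({b | f b < f a} : Finset α) := hc (by simpa using hab)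
      simp at this
  have hiff : ∀ a b, f a < f b ↔ g a < g b := by
    intro a b
    refine ⟨hmono a b, fun h => ?_⟩
    by_contra hlt
    rcases (not_lt.1 hlt).lt_or_eq with h1 | h1
    · exact absurd (hmono _ _ h1) (by omega)
    · rw [hf h1] at h
      omega
  have hginj : Function.Injective g := by
    intro a b hab
    by_contra hne
    rcases lt_or_gt_of_ne (fun h => hne (hf h)) with h1 | h1
    · exact absurd (hmono _ _ h1) (by omega)
    · exact absurd (hmono _ _ h1) (by omega)
  have hmem : ∀ a, g a ∈ Icc (0 : ℤ) (Fintype.card α - 1) := by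
    intro a
    have : #{b | f b < f a} < Fintype.card α := by
      refine card_lt_univ_of_notMem (x := a) ?_
      simp
    simp only [mem_Icc, hg]
    omega
  have himg : univ.image g = Icc (0 : ℤ) (Fintype.card α - 1) := by
    refine eq_of_subset_of_card_le ?_ ?_
    · intro z hz
      obtain ⟨a, -, rfl⟩ := mem_image.1 hz
      exact hmem a
    · rw [card_image_of_injective _ hginj, Int.card_Icc, card_univ]
      omega
  have hge : ∀ z ∈ Icc (0 : ℤ) (Fintype.card α - 1), g (Function.invFun g z) = z := by
    intro z hz
    rw [← himg] at hz
    obtain ⟨a, -, rfl⟩ := mem_image.1 hz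
    exact Function.invFun_eq ⟨a, rfl⟩
  have heg : ∀ a, Function.invFun g (g a) = a := Function.leftInverse_invFun hginj
  set e := Function.invFun g with he
  refine ⟨e, ?_, ?_, ?_⟩
  · intro i hi j hj hij
    rw [← hge i (by simpa using hi), ← hge j (by simpa using hj), hij]
  · intro i j h1 h2 h3 h4 hij
    refine ht _ _ fun h => hij ?_
    rw [← hge i (by simp [h1, h2]), ← hge j (by simp [h3, h4]), h]
  · intro Y hY
    have key : ∀ q : α → α → Prop,
        #{p ∈ (Icc (0 : ℤ) (Fintype.card α - 1) \ Y) ×ˢ Y | p.1 < p.2 ∧ q (e p.1) (e p.2)} =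
          #{p ∈ (Y.image e)ᶜ ×ˢ Y.image e | f p.1 < f p.2 ∧ q p.1 p.2} := by
      intro q
      refine card_nbij' (fun p => (e p.1, e p.2)) (fun p => (g p.1, g p.2)) ?_ ?_ ?_ ?_
      · rintro ⟨i, j⟩ hp
        simp only [coe_filter, mem_product, mem_sdiff, Set.mem_ofPred_eq, mem_compl] at hp ⊢
        obtain ⟨⟨⟨hi, hiY⟩, hjY⟩, hij, hq⟩ := hp
        have hj := hY hjY
        refine ⟨⟨?_, mem_image_of_mem _ hjY⟩, ?_, hq⟩
        · intro h
          obtain ⟨k, hk, hke⟩ := mem_image.1 h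
          apply hiY
          rw [← hge i hi, ← hke, hge k (hY hk)]
          exact hk
        · rw [hiff, hge i hi, hge j hj]
          exact hij
      · rintro ⟨a, b⟩ hp
        simp only [coe_filter, mem_product, mem_sdiff, Set.mem_ofPred_eq, mem_compl] at hp ⊢
        obtain ⟨⟨ha, hb⟩, hab, hq⟩ := hp
        rw [heg, heg]
        refine ⟨⟨⟨hmem a, fun h => ha ?_⟩, ?_⟩, (hiff _ _).1 hab, hq⟩
        · rw [← heg a]
          exact mem_image_of_mem _ h
        · obtain ⟨k, hk, rfl⟩ := mem_image.1 hb
          rw [hge k (hY hk)]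
          exact hk
      · rintro ⟨i, j⟩ hp
        simp only [coe_filter, mem_product, mem_sdiff, Set.mem_ofPred_eq] at hp
        simp only [Prod.mk.injEq]
        exact ⟨hge i hp.1.1.1, hge j (hY hp.1.2)⟩
      · rintro ⟨a, b⟩ -
        simp only [heg]
    rw [key (fun a b => r b a), key r]
    exact shift_of_maximizing_forward r f hf hmax _

end Existence

/-! ### Degrees and short connections in median orders -/

section MedianBasics

open scoped Classical

variable {R : ℤ → ℤ → Prop} {lo hi : ℤ}

/-- Moving `Y` together with everything in front of `lo'` changes the same pairs as moving `Y`
inside the subinterval: vertices behind `hi'` precede nothing that is moved. -/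
theorem IsMedian.mono (h : IsMedian R lo hi) {lo' hi' : ℤ} (hlo : lo ≤ lo') (hhi : hi' ≤ hi) :
    IsMedian R lo' hi' := by
  refine ⟨fun i j h1 h2 h3 h4 => h.tour i j (by omega) (by omega) (by omega) (by omega), ?_⟩
  intro Y hY
  rcases lt_or_ge hi' lo' with hlt | hle
  · have : Y = ∅ := by
      rw [Icc_eq_empty (by omega)] at hY
      exact subset_empty.1 hY
    simp [this]
  have key : ∀ q : ℤ → ℤ → Prop,
      {p ∈ (Icc lo hi \ (Y ∪ Ico lo lo')) ×ˢ (Y ∪ Ico lo lo') | p.1 < p.2 ∧ q p.1 p.2} =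
      {p ∈ (Icc lo' hi' \ Y) ×ˢ Y | p.1 < p.2 ∧ q p.1 p.2} := by
    intro q
    ext ⟨x, y⟩
    simp only [mem_filter, mem_product, mem_sdiff, mem_union, mem_Icc, mem_Ico, not_or]
    constructor
    · rintro ⟨⟨⟨⟨h1, h2⟩, h3, h4⟩, h5⟩, h6, h7⟩
      have h8 : y ∈ Y := by
        rcases h5 with h5 | h5
        · exact h5
        · omega
      have := mem_Icc.1 (hY h8)
      exact ⟨⟨⟨⟨by omega, by omega⟩, h3⟩, h8⟩, h6, h7⟩
    · rintro ⟨⟨⟨⟨h1, h2⟩, h3⟩, h5⟩, h6, h7⟩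
      exact ⟨⟨⟨⟨by omega, by omega⟩, h3, by omega⟩, Or.inl h5⟩, h6, h7⟩
  have hsub : Y ∪ Ico lo lo' ⊆ Icc lo hi := by
    intro y hy
    rcases mem_union.1 hy with hy | hy
    · have := mem_Icc.1 (hY hy)
      exact mem_Icc.2 ⟨by omega, by omega⟩
    · have := mem_Ico.1 hy
      exact mem_Icc.2 ⟨by omega, by omega⟩
  have := h.shift _ hsub
  rwa [key (fun a b => R b a), key R] at this

/-- Moving a set to the front amounts to moving its complement to the back, so the shift property is
symmetric under reversing both the order and the edges. -/
theorem IsMedian.rev (h : IsMedian R lo hi) :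
    IsMedian (fun i j => R (-j) (-i)) (-hi) (-lo) := by
  refine ⟨fun i j h1 h2 h3 h4 h5 =>
    h.tour (-j) (-i) (by omega) (by omega) (by omega) (by omega) (by omega), ?_⟩
  intro Y hY
  set Z := (Icc (-hi) (-lo) \ Y).image Neg.neg with hZ
  have hmem : ∀ z, z ∈ Z ↔ (lo ≤ z ∧ z ≤ hi) ∧ -z ∉ Y := by
    intro z
    simp only [hZ, mem_image, mem_sdiff, mem_Icc]
    constructor
    · rintro ⟨a, ⟨h1, h2⟩, rfl⟩
      exact ⟨by omega, by rwa [neg_neg]⟩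
    · rintro ⟨h1, h2⟩
      exact ⟨-z, ⟨by omega, h2⟩, neg_neg z⟩
  have key : ∀ q : ℤ → ℤ → Prop,
      #{p ∈ (Icc (-hi) (-lo) \ Y) ×ˢ Y | p.1 < p.2 ∧ q (-p.2) (-p.1)} =
      #{p ∈ (Icc lo hi \ Z) ×ˢ Z | p.1 < p.2 ∧ q p.1 p.2} := by
    intro q
    refine card_nbij' (fun p => (-p.2, -p.1)) (fun p => (-p.2, -p.1)) ?_ ?_ ?_ ?_
    · rintro ⟨x, y⟩ hp
      simp only [coe_filter, mem_product, mem_sdiff, Set.mem_ofPred_eq, mem_Icc, hmem, neg_neg]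
        at hp ⊢
      obtain ⟨⟨⟨h1, h2⟩, h3⟩, h4, h5⟩ := hp
      have := mem_Icc.1 (hY h3)
      exact ⟨⟨⟨by omega, fun h => h.2 h3⟩, by omega, h2⟩, by omega, h5⟩
    · rintro ⟨x, y⟩ hp
      simp only [coe_filter, mem_product, mem_sdiff, Set.mem_ofPred_eq, mem_Icc, hmem, neg_neg]
        at hp ⊢
      obtain ⟨⟨⟨h1, h2⟩, h3, h3'⟩, h4, h5⟩ := hp
      refine ⟨⟨⟨by omega, h3'⟩, ?_⟩, by omega, h5⟩
      by_contra h6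
      exact h2 ⟨h1, h6⟩
    · rintro ⟨x, y⟩ -
      simp
    · rintro ⟨x, y⟩ -
      simp
  have := h.shift Z (fun z hz => by simpa using ((hmem z).1 hz).1)
  rw [← key R, ← key (fun a b => R b a)] at this
  exact this

/-- Within `[i, j]`, moving all vertices but `i` to the front makes `i` the last one. As this gains
no forward edges, `i` has at least as many out-neighbours as in-neighbours in `(i, j]`. -/
theorem IsMedian.out_half (h : IsMedian R lo hi) {i j : ℤ} (hi1 : lo ≤ i) (hij : i ≤ j)
    (hj : j ≤ hi) : j - i ≤ 2 * (#{y ∈ Ioc i j | R i y} : ℤ) := by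
  have h1 := (h.mono hi1 hj).shift (Ioc i j) Ioc_subset_Icc_self
  have key : ∀ q : ℤ → ℤ → Prop,
      #{p ∈ (Icc i j \ Ioc i j) ×ˢ Ioc i j | p.1 < p.2 ∧ q p.1 p.2} = #{y ∈ Ioc i j | q i y} := by
    intro q
    have : Icc i j \ Ioc i j = {i} := by
      ext z
      simp only [mem_sdiff, mem_Icc, mem_Ioc, mem_singleton]
      omega
    rw [this, singleton_product, filter_map, card_map]
    congr 1
    ext z
    simp only [mem_filter, mem_Ioc, Function.comp, Function.Embedding.coeFn_mk]
    tauto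
  rw [key R, key (fun a b => R b a)] at h1
  have h2 : {y ∈ Ioc i j | R y i} = {y ∈ Ioc i j | ¬ R i y} := by
    refine filter_congr fun y hy => ?_
    have := mem_Ioc.1 hy
    exact h.tour y i (by omega) (by omega) (by omega) (by omega) (by omega)
  have h3 := card_filter_add_card_filter_not (s := Ioc i j) (fun y => R i y)
  rw [h2] at h1
  rw [Int.card_Ioc] at h3
  omega

theorem IsMedian.in_half (h : IsMedian R lo hi) {i j : ℤ} (hi1 : lo ≤ i) (hij : i ≤ j)
    (hj : j ≤ hi) : j - i ≤ 2 * (#{x ∈ Ico i j | R x j} : ℤ) := by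
  have h1 := h.rev.out_half (i := -j) (j := -i) (by omega) (by omega) (by omega)
  have : #{y ∈ Ioc (-j) (-i) | R (-y) (-(-j))} = #{x ∈ Ico i j | R x j} := by
    refine card_nbij' Neg.neg Neg.neg ?_ ?_ ?_ ?_ <;> intro x hx <;>
      simp only [coe_filter, mem_Ioc, mem_Ico, Set.mem_ofPred_eq, neg_neg] at hx ⊢ <;>
      exact ⟨by omega, hx.2⟩
  rw [this] at h1
  omega

/-- For a window at some distance from `i`, the skipped vertices might all be out-neighbours; they
are subtracted from the half-degree bound. -/
theorem IsMedian.out_window (h : IsMedian R lo hi) {i s t : ℤ} (hi1 : lo ≤ i) (his : i < s)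
    (hst : s ≤ t + 1) (ht : t ≤ hi) :
    t - i ≤ 2 * (#{y ∈ Icc s t | R i y} : ℤ) + 2 * (s - 1 - i) := by
  have h1 := h.out_half hi1 (by omega) ht
  have h2 : {y ∈ Ioc i t | R i y} ⊆ {y ∈ Icc s t | R i y} ∪ Ioo i s := by
    intro y hy
    simp only [mem_filter, mem_Ioc, mem_union, mem_Icc, mem_Ioo] at hy ⊢
    by_cases hys : y < s
    · right
      omega
    · left
      exact ⟨by omega, hy.2⟩
  have h3 := (card_le_card h2).trans (card_union_le _ _)
  rw [Int.card_Ioo] at h3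
  omega

theorem IsMedian.in_window (h : IsMedian R lo hi) {j s t : ℤ} (hs : lo ≤ s) (hst : s ≤ t + 1)
    (htj : t < j) (hj : j ≤ hi) :
    j - s ≤ 2 * (#{x ∈ Icc s t | R x j} : ℤ) + 2 * (j - 1 - t) := by
  have h1 := h.in_half hs (by omega) hj
  have h2 : {x ∈ Ico s j | R x j} ⊆ {x ∈ Icc s t | R x j} ∪ Ioo t j := by
    intro y hy
    simp only [mem_filter, mem_Ico, mem_union, mem_Icc, mem_Ioo] at hy ⊢
    by_cases hys : t < y
    · right
      omega
    · left
      exact ⟨by omega, hy.2⟩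
  have h3 := (card_le_card h2).trans (card_union_le _ _)
  rw [Int.card_Ioo] at h3
  omega

/-- Three-edge connections: if `u` is well before `e` and `e ≤ w` with `w` not much beyond `e`, there
is a path `u → a → b → w` with `a` and `b` strictly between `u` and `e`, outside `B`. -/
theorem IsMedian.exists_three_path (h : IsMedian R lo hi) {u e w : ℤ} (B : Finset ℤ)
    (hu : lo ≤ u) (hue : u < e) (hew : e ≤ w) (hw : w ≤ hi)
    (hlen : 42 * (#B : ℤ) + 9 * (w - e) + 60 < e - u) :
    ∃ a b, (u < a ∧ a < e ∧ a ∉ B) ∧ (u < b ∧ b < e ∧ b ∉ B) ∧ a ≠ b ∧ R u a ∧ R a b ∧ R b w := by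
  by_contra hcon
  push Not at hcon
  have hX1 := h.out_window (i := u) (s := u + 1) (t := e - 1) hu (by omega) (by omega) (by omega)
  have hY1 := h.in_window (j := w) (s := u + 1) (t := e - 1) (by omega) (by omega) (by omega) hw
  set J := Icc (u + 1) (e - 1) with hJ
  have hJc : (#J : ℤ) = e - 1 - u := by
    rw [hJ, Int.card_Icc]
    omega
  set X := {y ∈ J | R u y} \ B with hX
  set Y := {y ∈ J | R y w} \ B with hY
  have hXJ : X ⊆ J := sdiff_subset.trans (filter_subset _ _)
  have hYJ : Y ⊆ J := sdiff_subset.trans (filter_subset _ _)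
  have hXm : ∀ x ∈ X, u < x ∧ x < e ∧ x ∉ B ∧ R u x := by
    intro x hx
    simp only [hX, hJ, mem_sdiff, mem_filter, mem_Icc] at hx
    exact ⟨by omega, by omega, hx.2, hx.1.2⟩
  have hYm : ∀ x ∈ Y, u < x ∧ x < e ∧ x ∉ B ∧ R x w := by
    intro x hx
    simp only [hY, hJ, mem_sdiff, mem_filter, mem_Icc] at hx
    exact ⟨by omega, by omega, hx.2, hx.1.2⟩
  have hXc : #{y ∈ J | R u y} ≤ #X + #B := by
    have : #{y ∈ J | R u y} - #B ≤ #X := le_card_sdiff _ _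
    omega
  have hYc : #{y ∈ J | R y w} ≤ #Y + #B := by
    have : #{y ∈ J | R y w} - #B ≤ #Y := le_card_sdiff _ _
    omega
  -- Without the desired path, every edge between the out-neighbours `X` of `u` and the
  -- in-neighbours `Y` of `w` points from `Y` to `X`. The rest of the proof shows that moving `Y` to
  -- the front of `J` would then gain forward edges.
  have hback : ∀ x ∈ X, ∀ y ∈ Y, x ≠ y → R y x ∧ ¬ R x y := by
    intro x hx y hy hxy
    obtain ⟨h1, h2, h3, h4⟩ := hXm x hx
    obtain ⟨h5, h6, h7, h8⟩ := hYm y hy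
    have h9 : ¬ R x y := fun hR => hcon x y ⟨h1, h2, h3⟩ ⟨h5, h6, h7⟩ hxy h4 hR h8
    exact ⟨(h.tour y x (by omega) (by omega) (by omega) (by omega) hxy.symm).2 h9, h9⟩
  have hint : #(X ∩ Y) ≤ 1 := by
    rw [card_le_one]
    intro a ha b hb
    by_contra hab
    rw [mem_inter] at ha hb
    exact (hback b hb.1 a ha.2 (Ne.symm hab)).2 (hback a ha.1 b hb.2 hab).1
  have hunion := card_union_add_card_inter X Y
  set Z := J \ (X ∪ Y) with hZ
  have hZc : #Z + #(X ∪ Y) = #J := card_sdiff_add_card_eq_card (union_subset hXJ hYJ)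
  have hshift := (h.mono (lo' := u + 1) (hi' := e - 1) (by omega) (by omega)).shift Y hYJ
  rw [← hJ] at hshift
  -- The move loses only edges from `Z` to `Y`. The set `Z` is small, because `X` and `Y` each cover
  -- nearly half of `J` and overlap in at most one vertex.
  have hfwd : #{p ∈ (J \ Y) ×ˢ Y | p.1 < p.2 ∧ R p.1 p.2} ≤ #Z * #Y := by
    rw [← card_product]
    refine card_le_card ?_
    rintro ⟨x, y⟩ hp
    simp only [mem_filter, mem_product, mem_sdiff, hZ, mem_union] at hp ⊢
    obtain ⟨⟨⟨h1, h2⟩, h3⟩, h4, h5⟩ := hp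
    refine ⟨⟨h1, ?_⟩, h3⟩
    rintro (h6 | h6)
    · exact (hback x h6 y h3 (by omega)).2 h5
    · exact h2 h6
  set half : ℕ := #Y / 2 with hhalf
  set Yh := {y ∈ Y | u + half < y} with hYh
  have hYhc : #Y ≤ #Yh + half := by
    have h1 : Y ⊆ Yh ∪ Ioc u (u + half) := by
      intro y hy
      have := hYm y hy
      simp only [mem_union, hYh, mem_filter, mem_Ioc]
      by_cases h2 : u + half < y
      · exact Or.inl ⟨hy, h2⟩
      · right
        omega
    have h2 := (card_le_card h1).trans (card_union_le _ _)
    rw [Int.card_Ioc] at h2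
    omega
  -- At least half of `Y` lies beyond `u + half`, and each such `y` has many out-neighbours of `u`
  -- in front of it; all of these give backward edges from `y`.
  have hbackc : ∀ y ∈ Yh, (half : ℤ) ≤ 2 * (#{x ∈ X \ Y | x < y} : ℤ) + 2 * #B + 2 := by
    intro y hy
    simp only [hYh, mem_filter] at hy
    have hy1 := hYm y hy.1
    have h1 := h.out_window (i := u) (s := u + 1) (t := y - 1) hu (by omega) (by omega) (by omega)
    have h2 : {x ∈ Icc (u + 1) (y - 1) | R u x} ⊆ ({x ∈ X \ Y | x < y} ∪ B) ∪ (X ∩ Y) := by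
      intro x hx
      simp only [mem_filter, mem_Icc] at hx
      simp only [mem_union, mem_filter, mem_sdiff, mem_inter]
      by_cases hxB : x ∈ B
      · exact Or.inl (Or.inr hxB)
      · have hxX : x ∈ X := by
          simp only [hX, hJ, mem_sdiff, mem_filter, mem_Icc]
          exact ⟨⟨by omega, hx.2⟩, hxB⟩
        by_cases hxY : x ∈ Y
        · exact Or.inr ⟨hxX, hxY⟩
        · exact Or.inl (Or.inl ⟨⟨hxX, hxY⟩, by omega⟩)
    have h3 := (card_le_card h2).trans
      ((card_union_le _ _).trans (Nat.add_le_add_right (card_union_le _ _) _))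
    omega
  have hbwd : ∑ y ∈ Yh, #{x ∈ X \ Y | x < y} ≤
      #{p ∈ (J \ Y) ×ˢ Y | p.1 < p.2 ∧ R p.2 p.1} := by
    rw [← card_sigma]
    refine card_le_card_of_injOn (fun p => (p.2, p.1)) ?_ ?_
    · rintro ⟨y, x⟩ hp
      simp only [coe_sigma, Set.mem_sigma_iff, mem_coe, mem_filter, mem_sdiff, hYh] at hp
      simp only [coe_filter, Set.mem_ofPred_eq, mem_product, mem_sdiff]
      obtain ⟨⟨h1, h2⟩, ⟨h3, h4⟩, h5⟩ := hp
      exact ⟨⟨⟨hXJ h3, h4⟩, h1⟩, h5, (hback x h3 y h1 (by omega)).1⟩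
    · rintro ⟨y, x⟩ - ⟨y', x'⟩ - hp
      simp only [Prod.mk.injEq] at hp
      obtain ⟨rfl, rfl⟩ := hp
      rfl
  -- Here the constants 42, 9 and 60 are spent: `#Z` is at most about `2 * #B + (w - e) / 2`, while
  -- `half` is about a quarter of the length of `J`.
  have hcZ : ∀ y ∈ Yh, 2 * #Z + 1 ≤ #{x ∈ X \ Y | x < y} := by
    intro y hy
    have := hbackc y hy
    omega
  have hsum := sum_le_sum hcZ
  rw [sum_const, smul_eq_mul] at hsum
  have hYpos : 0 < #Y := by omega
  have hfin : #Yh * (2 * #Z + 1) ≤ #Z * #Y := hsum.trans (hbwd.trans (hshift.trans hfwd))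
  have h2Yh : #Y ≤ 2 * #Yh := by omega
  have : #Z * #Y ≤ #Z * (2 * #Yh) := Nat.mul_le_mul_left _ h2Yh
  have hYhpos : 0 < #Yh := by omega
  nlinarith

end MedianBasics

/-! ### Spanning paths of intervals with deleted vertices -/

section HamiltonianPaths

/-- Some vertex of the path sends an edge to `w` and the last one receives an edge from `w`, so
somewhere two consecutive vertices switch from the first behaviour to the second. Inserting `w`
between them keeps both ends. -/
theorem exists_insert_chain {α : Type*} {R : α → α → Prop} (w : α) (l : List α)
    (hl : l.IsChain R) (hasymm : ∀ z ∈ l, R z w → ¬ R w z) (htot : ∀ z ∈ l, R z w ∨ R w z)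
    (hex : ∃ z ∈ l, R z w) (hlast : ∀ u, l.getLast? = some u → R w u) :
    ∃ l' : List α, l'.IsChain R ∧ l'.Perm (w :: l) ∧ l'.head? = l.head? ∧
      l'.getLast? = l.getLast? := by
  induction l with
  | nil => simp at hex
  | cons x t ih =>
    cases t with
    | nil =>
      obtain ⟨z, hz, hzw⟩ := hex
      rw [List.mem_singleton] at hz
      subst hz
      exact absurd (hlast z (by simp)) (hasymm z (by simp) hzw)
    | cons y t =>
      rw [List.isChain_cons_cons] at hl
      by_cases hxy : R x w ∧ R w y
      · refine ⟨x :: w :: y :: t, ?_, List.Perm.swap _ _ _, by simp, by simp⟩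
        simp only [List.isChain_cons_cons]
        exact ⟨hxy.1, hxy.2, hl.2⟩
      · have hex' : ∃ z ∈ y :: t, R z w := by
          obtain ⟨z, hz, hzw⟩ := hex
          rcases List.mem_cons.1 hz with rfl | hz
          · refine ⟨y, by simp, ?_⟩
            rcases htot y (by simp) with h | h
            · exact h
            · exact absurd ⟨hzw, h⟩ hxy
          · exact ⟨z, hz, hzw⟩
        obtain ⟨l', h1, h2, h3, h4⟩ := ih hl.2 (fun z hz => hasymm z (List.mem_cons_of_mem _ hz))
          (fun z hz => htot z (List.mem_cons_of_mem _ hz)) hex'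
          (fun u hu => hlast u (by simpa using hu))
        cases l' with
        | nil => simp at h3
        | cons y' t' =>
          simp only [List.head?_cons, Option.some.injEq] at h3
          subst h3
          refine ⟨x :: y' :: t', ?_, ?_, by simp, ?_⟩
          · rw [List.isChain_cons_cons]
            exact ⟨hl.1, h1⟩
          · exact (h2.cons x).trans (List.Perm.swap _ _ _)
          · simpa using h4

/-- `l` is a directed path in `R` with vertex set `X`, from `p` to `q`. -/
structure IsSpanningPath (R : ℤ → ℤ → Prop) (X : Finset ℤ) (p q : ℤ) (l : List ℤ) : Prop where
  chain : l.IsChain R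
  nodup : l.Nodup
  mem_iff : ∀ z, z ∈ l ↔ z ∈ X
  head : l.head? = some p
  last : l.getLast? = some q

open scoped Classical

variable {R : ℤ → ℤ → Prop} {lo hi : ℤ}

theorem IsSpanningPath.length_eq {X : Finset ℤ} {p q : ℤ} {l : List ℤ}
    (h : IsSpanningPath R X p q l) : l.length = #X := by
  rw [← List.toFinset_card_of_nodup h.nodup]
  congr 1
  ext z
  rw [List.mem_toFinset, h.mem_iff]

theorem IsSpanningPath.append {X Y : Finset ℤ} {p q s t : ℤ} {l l' : List ℤ}
    (h : IsSpanningPath R X p q l) (h' : IsSpanningPath R Y s t l') (hqs : R q s)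
    (hXY : Disjoint X Y) : IsSpanningPath R (X ∪ Y) p t (l ++ l') := by
  refine ⟨?_, ?_, ?_, ?_, ?_⟩
  · rw [List.isChain_append]
    refine ⟨h.chain, h'.chain, ?_⟩
    intro a ha b hb
    rw [h.last, Option.mem_some_iff] at ha
    rw [h'.head, Option.mem_some_iff] at hb
    subst ha hb
    exact hqs
  · rw [List.nodup_append]
    refine ⟨h.nodup, h'.nodup, ?_⟩
    rintro a ha b hb rfl
    exact disjoint_left.1 hXY ((h.mem_iff a).1 ha) ((h'.mem_iff a).1 hb)
  · intro z
    rw [List.mem_append, mem_union, h.mem_iff, h'.mem_iff]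
  · rw [List.head?_append, h.head]
    rfl
  · rw [List.getLast?_append, h'.last]
    rfl

theorem IsSpanningPath.rev {X : Finset ℤ} {p q : ℤ} {l : List ℤ}
    (h : IsSpanningPath (fun i j => R (-j) (-i)) X p q l) :
    IsSpanningPath R (X.image Neg.neg) (-q) (-p) (l.reverse.map Neg.neg) := by
  refine ⟨?_, ?_, ?_, ?_, ?_⟩
  · rw [List.isChain_map, List.isChain_reverse]
    exact h.chain
  · exact (List.nodup_reverse.2 h.nodup).map neg_injective
  · intro z
    simp [h.mem_iff]
  · rw [List.head?_map, List.head?_reverse, h.last]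
    rfl
  · rw [List.getLast?_map, List.getLast?_reverse, h.head]
    rfl

theorem IsMedian.succ (h : IsMedian R lo hi) {i : ℤ} (h1 : lo ≤ i) (h2 : i + 1 ≤ hi) :
    R i (i + 1) := by
  have h3 := h.out_half (i := i) (j := i + 1) h1 (by omega) h2
  have h4 : 0 < #{y ∈ Ioc i (i + 1) | R i y} := by omega
  obtain ⟨y, hy⟩ := card_pos.1 h4
  simp only [mem_filter, mem_Ioc] at hy
  obtain rfl : y = i + 1 := by omega
  exact hy.2

/-- Deleting `A` from an initial part of a median order leaves a spanning path starting at the first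
vertex whose last vertex sends no edge to a later undeleted one. -/
theorem IsMedian.exists_spanning_prefix (h : IsMedian R lo hi) {p q : ℤ} (hp : lo ≤ p)
    (hq : q ≤ hi) (A : Finset ℤ) (hpA : p ∉ A)
    (hin : ∀ e, p < e → e ≤ q → e ∉ A → ∃ z, p ≤ z ∧ z < e ∧ z ∉ A ∧ R z e) (n : ℕ)
    (hn : p + n ≤ q) :
    ∃ u l, IsSpanningPath R (Icc p (p + n) \ A) p u l ∧
      ∀ z, u < z → z ≤ p + n → R u z → z ∈ A := by
  induction n with
  | zero =>
    refine ⟨p, [p], ⟨by simp, by simp, ?_, rfl, rfl⟩, ?_⟩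
    · intro z
      simp only [List.mem_singleton, Nat.cast_zero, add_zero, Icc_self, mem_sdiff, mem_singleton]
      constructor
      · rintro rfl
        exact ⟨rfl, hpA⟩
      · exact fun h => h.1
    · intro z h1 h2
      simp only [Nat.cast_zero, add_zero] at h2
      omega
  | succ n ih =>
    push_cast at hn ⊢
    obtain ⟨u, l, hl, hu⟩ := ih (by omega)
    have hul : u ∈ Icc p (p + n) \ A := (hl.mem_iff u).1 (List.mem_of_getLast? hl.last)
    have hul' := mem_Icc.1 (mem_sdiff.1 hul).1
    set w : ℤ := p + (n + 1) with hw
    by_cases hwA : w ∈ A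
    · refine ⟨u, l, ?_, ?_⟩
      · have : Icc p w \ A = Icc p (p + n) \ A := by
          ext z
          simp only [mem_sdiff, mem_Icc]
          constructor
          · rintro ⟨h1, h2⟩
            refine ⟨⟨h1.1, ?_⟩, h2⟩
            have : z ≠ w := fun h => h2 (h ▸ hwA)
            omega
          · rintro ⟨h1, h2⟩
            exact ⟨⟨h1.1, by omega⟩, h2⟩
        rwa [this]
      · intro z h1 h2 h3
        by_cases h4 : z = w
        · rwa [h4]
        · exact hu z h1 (by omega) h3
    have hset : Icc p w \ A = (Icc p (p + n) \ A) ∪ {w} := by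
      ext z
      simp only [mem_sdiff, mem_Icc, mem_union, mem_singleton]
      constructor
      · rintro ⟨h1, h2⟩
        by_cases h4 : z = w
        · exact Or.inr h4
        · exact Or.inl ⟨⟨h1.1, by omega⟩, h2⟩
      · rintro (⟨h1, h2⟩ | rfl)
        · exact ⟨⟨h1.1, by omega⟩, h2⟩
        · exact ⟨⟨by omega, le_rfl⟩, hwA⟩
    have hmem : ∀ z ∈ l, p ≤ z ∧ z < w ∧ z ∉ A := by
      intro z hz
      have := (hl.mem_iff z).1 hz
      simp only [mem_sdiff, mem_Icc] at this
      exact ⟨this.1.1, by omega, this.2⟩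
    have htour : ∀ z ∈ l, (R z w ↔ ¬ R w z) := by
      intro z hz
      have := hmem z hz
      exact h.tour z w (by omega) (by omega) (by omega) (by omega) (by omega)
    -- If `u → w`, then `w` becomes the new end. Otherwise `w → u`, so `w` is inserted inside the
    -- path; `u` remains the end, and `w` is not one of its out-neighbours.
    by_cases huw : R u w
    · refine ⟨w, l ++ [w], ?_, fun z h1 h2 => by omega⟩
      rw [hset]
      refine hl.append ⟨by simp, by simp, by simp, rfl, rfl⟩ huw ?_
      rw [disjoint_singleton_right]
      intro h1
      have := mem_Icc.1 (mem_sdiff.1 h1).1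
      omega
    · have hulm : u ∈ l := (hl.mem_iff u).2 hul
      have hwu : R w u := by
        by_contra h1
        exact huw ((htour u hulm).2 h1)
      obtain ⟨z, hz1, hz2, hz3, hz4⟩ := hin w (by omega) hn hwA
      obtain ⟨l', h1, h2, h3, h4⟩ := exists_insert_chain w l hl.chain
        (fun z hz => (htour z hz).1)
        (fun z hz => by
          by_cases h1 : R w z
          · exact Or.inr h1
          · exact Or.inl ((htour z hz).2 h1))
        ⟨z, (hl.mem_iff z).2 (mem_sdiff.2 ⟨mem_Icc.2 ⟨hz1, by omega⟩, hz3⟩), hz4⟩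
        (fun u' hu' => by
          rw [hl.last, Option.some.injEq] at hu'
          rwa [← hu'])
      refine ⟨u, l', ⟨h1, ?_, ?_, h3.trans hl.head, h4.trans hl.last⟩, ?_⟩
      · rw [h2.nodup_iff, List.nodup_cons]
        refine ⟨fun h5 => ?_, hl.nodup⟩
        have := hmem w h5
        omega
      · intro z
        rw [h2.mem_iff, hset, List.mem_cons, hl.mem_iff, mem_union, mem_singleton, or_comm]
      · intro z h5 h6 h7
        by_cases h8 : z = w
        · rw [h8] at h7
          exact absurd h7 huw
        · exact hu z h5 (by omega) h7

/-- Let `u` be the end of the spanning path of the prefix. All out-neighbours of `u` in `(u, e]` are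
deleted, so `e - u ≤ 2 * #A`. But the last `2 * #A` positions contain no deletion, so there are no
such out-neighbours and `u = e`. -/
theorem IsMedian.exists_spanning_to_free (h : IsMedian R lo hi) {p e c : ℤ} (hp : lo ≤ p)
    (hpe : p ≤ e) (hq : e ≤ hi) (A : Finset ℤ) (hc : 2 * (#A : ℤ) < c)
    (hA : ∀ z ∈ A, p + c ≤ z) (hfree : ∀ z, e - 2 * #A ≤ z → z ≤ e → z ∉ A) :
    ∃ l, IsSpanningPath R (Icc p e \ A) p e l := by
  -- If all in-neighbours of `e'` in `[p, e')` were deleted, `e'` would lie within `2 * #A < c` of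
  -- `p`, whereas deletions start only at `p + c`.
  have hin : ∀ e', p < e' → e' ≤ e → e' ∉ A → ∃ z, p ≤ z ∧ z < e' ∧ z ∉ A ∧ R z e' := by
    intro e' h1 h2 _
    by_contra hcon
    push Not at hcon
    have h3 := h.in_half (i := p) (j := e') hp h1.le (by omega)
    have h4 : {x ∈ Ico p e' | R x e'} ⊆ A := by
      intro x hx
      simp only [mem_filter, mem_Ico] at hx
      by_contra h5
      exact hcon x hx.1.1 hx.1.2 h5 hx.2
    have h5 := card_le_card h4
    have h6 : 0 < #{x ∈ Ico p e' | R x e'} := by omega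
    obtain ⟨x, hx⟩ := card_pos.1 h6
    have h7 := hA x (h4 hx)
    simp only [mem_filter, mem_Ico] at hx
    omega
  obtain ⟨n, hn⟩ := Int.eq_ofNat_of_zero_le (sub_nonneg.2 hpe)
  have hne : p + n = e := by omega
  have hpA : p ∉ A := fun h1 => by
    have := hA p h1
    omega
  obtain ⟨u, l, hl, hu⟩ := h.exists_spanning_prefix hp hq A hpA hin n (by omega)
  rw [hne] at hl hu
  have hul := (hl.mem_iff u).1 (List.mem_of_getLast? hl.last)
  simp only [mem_sdiff, mem_Icc] at hul
  have h1 := h.out_half (i := u) (j := e) (by omega) (by omega) hq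
  have h2 : {y ∈ Ioc u e | R u y} ⊆ A := by
    intro y hy
    simp only [mem_filter, mem_Ioc] at hy
    exact hu y hy.1.1 hy.1.2 hy.2
  have h3 := card_le_card h2
  have h4 : {y ∈ Ioc u e | R u y} = ∅ := by
    rw [eq_empty_iff_forall_notMem]
    intro y hy
    have h5 := h2 hy
    simp only [mem_filter, mem_Ioc] at hy
    exact hfree y (by omega) hy.1.2 h5
  rw [h4, card_empty] at h1
  obtain rfl : u = e := by omega
  exact ⟨l, hl⟩

/-- If the deleted vertices are few, not close to the ends, and there is a stretch without
deletions, then the rest of an interval of a median order has a spanning path between the ends. -/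
theorem IsMedian.exists_spanning_path (h : IsMedian R lo hi) {p q e c : ℤ} (hp : lo ≤ p)
    (hpe : p ≤ e) (heq : e < q) (hq : q ≤ hi) (A : Finset ℤ) (hc : 2 * (#A : ℤ) < c)
    (hA : ∀ z ∈ A, p + c ≤ z ∧ z ≤ q - c)
    (hfree : ∀ z, e - 2 * #A ≤ z → z ≤ e + 1 + 2 * #A → z ∉ A) :
    ∃ l, IsSpanningPath R (Icc p q \ A) p q l := by
  -- One path is built forwards from `p` to `e` and one backwards from `q` to `e + 1`, each ending
  -- in the free stretch. The edge from `e` to `e + 1` joins them.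
  obtain ⟨l₁, h₁⟩ := h.exists_spanning_to_free (p := p) (e := e) (c := c) hp hpe (by omega) A hc
    (fun z hz => (hA z hz).1) (fun z h1 h2 => hfree z h1 (by omega))
  have hcard : #(A.image Neg.neg) = #A := card_image_of_injective _ neg_injective
  obtain ⟨l₂, h₂⟩ := h.rev.exists_spanning_to_free (p := -q) (e := -(e + 1)) (c := c) (by omega)
    (by omega) (by omega) (A.image Neg.neg) (by omega)
    (fun z hz => by
      obtain ⟨y, hy, rfl⟩ := mem_image.1 hz
      have := hA y hy
      omega)
    (fun z h1 h2 h3 => by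
      obtain ⟨y, hy, rfl⟩ := mem_image.1 h3
      exact hfree y (by omega) (by omega) hy)
  have h₃ := h₂.rev
  rw [neg_neg, neg_neg] at h₃
  have h4 := h₁.append h₃ (h.succ (by omega) (by omega)) ?_
  · refine ⟨l₁ ++ l₂.reverse.map Neg.neg, ?_⟩
    convert h4 using 1
    ext z
    simp only [mem_sdiff, mem_Icc, mem_union, mem_image]
    constructor
    · rintro ⟨h5, h6⟩
      by_cases h7 : z ≤ e
      · exact Or.inl ⟨⟨h5.1, h7⟩, h6⟩
      · refine Or.inr ⟨-z, ⟨by omega, ?_⟩, neg_neg z⟩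
        rintro ⟨y, hy, hyz⟩
        rw [neg_inj.1 hyz] at hy
        exact h6 hy
    · rintro (⟨h5, h6⟩ | ⟨y, ⟨h5, h6⟩, rfl⟩)
      · exact ⟨⟨h5.1, by omega⟩, h6⟩
      · exact ⟨by omega, fun h7 => h6 ⟨-y, h7, neg_neg y⟩⟩
  · rw [disjoint_left]
    intro z h5 h6
    simp only [mem_sdiff, mem_Icc, mem_image] at h5 h6
    obtain ⟨y, ⟨h7, -⟩, rfl⟩ := h6
    omega

end HamiltonianPaths

/-! ### Oriented trees in tournaments of four times their size -/

section TreeEmbedding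

open scoped Classical

/-- `X` is obtained from one vertex by adding vertices which are adjacent, in the underlying graph
of `H`, to exactly one earlier vertex. -/
inductive IsGrown {A : Type*} (H : A → A → Prop) : Finset A → Prop
  | single (v : A) : IsGrown H {v}
  | add (X : Finset A) (u v : A) (hX : IsGrown H X) (hu : u ∈ X) (hv : v ∉ X)
      (huv : H u v ∨ H v u) (huniq : ∀ w ∈ X, H w v ∨ H v w → w = u) : IsGrown H (insert v X)

/-- It suffices to compare with the lowest occupied position above `z`, which costs one vertex; the
slack of 2 in the hypothesis pays for it. This yields the density invariant at a newly occupied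
position. -/
theorem two_mul_card_above_le {A : Type*} (X : Finset A) (f : A → ℤ) (b : ℤ)
    (hX : ∀ w ∈ X, 2 * (#{u ∈ X | f w < f u} : ℤ) ≤ b - 2 - f w) (hinj : Set.InjOn f X) (z : ℤ)
    (hz : z ≤ b) : 2 * (#{u ∈ X | z < f u} : ℤ) ≤ b - z := by
  rcases ({u ∈ X | z < f u} : Finset A).eq_empty_or_nonempty with h | h
  · rw [h, card_empty]
    omega
  · obtain ⟨w, hw, hmin⟩ := exists_min_image _ f h
    rw [mem_filter] at hw
    have h1 : {u ∈ X | z < f u} ⊆ insert w {u ∈ X | f w < f u} := by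
      intro u hu
      have h2 := hmin u hu
      rw [mem_filter] at hu
      rw [mem_insert, mem_filter]
      rcases h2.eq_or_lt with h3 | h3
      · exact Or.inl (hinj hu.1 hw.1 h3.symm)
      · exact Or.inr ⟨hu.1, h3⟩
    have h2 := (card_le_card h1).trans (card_insert_le _ _)
    have h3 := hX w hw.1
    omega

/-- The invariant is that, seen from each occupied position, at most half of the interval on either
side is occupied. For each new vertex the interval grows by two positions at both ends. The
neighbour `u` of the new vertex then has more out- and in-neighbours on the respective sides than
there are occupied positions, so a free one exists. -/
theorem IsMedian.exists_tree_embedding {A : Type*} {H : A → A → Prop} {X : Finset A}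
    (hX : IsGrown H X) (hH : ∀ u v, H u v → ¬ H v u) {R : ℤ → ℤ → Prop} :
    ∀ {lo hi : ℤ}, IsMedian R lo hi → 4 * (#X : ℤ) ≤ hi - lo + 4 →
    ∃ f : A → ℤ, Set.InjOn f X ∧ (∀ v ∈ X, lo ≤ f v ∧ f v ≤ hi) ∧
      (∀ u ∈ X, ∀ v ∈ X, H u v → R (f u) (f v)) ∧
      (∀ v ∈ X, 2 * (#{u ∈ X | f v < f u} : ℤ) ≤ hi - f v) ∧
      (∀ v ∈ X, 2 * (#{u ∈ X | f u < f v} : ℤ) ≤ f v - lo) := by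
  induction hX with
  | single v =>
    intro lo hi h hc
    rw [card_singleton] at hc
    have hHv : ¬ H v v := fun h => hH v v h h
    have e1 : ∀ a : ℤ, filter (fun _ : A => a < a) {v} = ∅ := fun a =>
      filter_false_of_mem fun _ _ => lt_irrefl a
    refine ⟨fun _ => lo, by simp, ?_, ?_, ?_, ?_⟩
    · simp only [mem_singleton, forall_eq]
      omega
    · simp [hHv]
    · intro w _
      rw [e1, card_empty]
      push_cast at hc ⊢
      omega
    · intro w _
      rw [e1, card_empty]
      simp
  | add X u v hX hu hv huv huniq ih =>
    intro lo hi h hc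
    rw [card_insert_of_notMem hv] at hc
    push_cast at hc
    obtain ⟨f, hinj, hran, hhom, hab, hbe⟩ :=
      ih (h.mono (lo' := lo + 2) (hi' := hi - 2) (by omega) (by omega)) (by omega)
    have hur := hran u hu
    obtain ⟨z, hz1, hz2, hzX, hz3, hz4⟩ : ∃ z, lo ≤ z ∧ z ≤ hi ∧ (∀ w ∈ X, f w ≠ z) ∧
        (H u v → R (f u) z) ∧ (H v u → R z (f u)) := by
      by_cases hdir : H u v
      · have h1 := h.out_half (i := f u) (j := hi) (by omega) (by omega) le_rfl
        have h2 := hab u hu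
        have h3 : #(image f {w ∈ X | f u < f w}) < #{y ∈ Ioc (f u) hi | R (f u) y} := by
          have := card_image_le (s := {w ∈ X | f u < f w}) (f := f)
          omega
        obtain ⟨z, hz, hzi⟩ := exists_mem_notMem_of_card_lt_card h3
        simp only [mem_filter, mem_Ioc] at hz
        refine ⟨z, by omega, hz.1.2, ?_, fun _ => hz.2, fun h => absurd h (hH _ _ hdir)⟩
        rintro w hw rfl
        exact hzi (mem_image_of_mem _ (by simp [hw, hz.1.1]))
      · have hdir' : H v u := huv.resolve_left hdir
        have h1 := h.in_half (i := lo) (j := f u) (by omega) (by omega) (by omega)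
        have h2 := hbe u hu
        have h3 : #(image f {w ∈ X | f w < f u}) < #{y ∈ Ico lo (f u) | R y (f u)} := by
          have := card_image_le (s := {w ∈ X | f w < f u}) (f := f)
          omega
        obtain ⟨z, hz, hzi⟩ := exists_mem_notMem_of_card_lt_card h3
        simp only [mem_filter, mem_Ico] at hz
        refine ⟨z, hz.1.1, by omega, ?_, fun h => absurd h hdir, fun _ => hz.2⟩
        rintro w hw rfl
        exact hzi (mem_image_of_mem _ (by simp [hw, hz.1.2]))
    set g := Function.update f v z with hg
    have hgv : g v = z := Function.update_self _ _ _
    have hgX : ∀ w ∈ X, g w = f w := fun w hw =>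
      Function.update_of_ne (fun h => hv (by rwa [← h])) _ _
    have habz := two_mul_card_above_le X f hi (fun w hw => by have := hab w hw; omega) hinj z hz2
    have hbez := two_mul_card_above_le X (fun a => - f a) (-lo)
      (fun w hw => by
        have := hbe w hw
        simp only [neg_lt_neg_iff]
        omega)
      (fun a ha b hb hab => hinj ha hb (neg_inj.1 hab)) (-z) (by omega)
    simp only [neg_lt_neg_iff] at hbez
    have hfilt : ∀ (q : ℤ → Prop) [DecidablePred q], ({a ∈ X | q (g a)} : Finset A) = {a ∈ X | q (f a)} := by
      intro q _
      refine filter_congr fun a ha => ?_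
      rw [hgX a ha]
    have hins : ∀ (q : ℤ → Prop) [DecidablePred q], #{a ∈ insert v X | q (g a)} ≤ #{a ∈ X | q (f a)} + 1 := by
      intro q _
      rw [filter_insert, ← hfilt q]
      split_ifs
      · exact card_insert_le _ _
      · omega
    have hins' : ∀ (q : ℤ → Prop) [DecidablePred q], ¬ q z → #{a ∈ insert v X | q (g a)} = #{a ∈ X | q (f a)} := by
      intro q _ hq
      rw [filter_insert, ← hfilt q, hgv, if_neg hq]
    refine ⟨g, ?_, ?_, ?_, ?_, ?_⟩
    · rw [coe_insert, Set.injOn_insert (by simpa using hv)]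
      refine ⟨?_, ?_⟩
      · intro a ha b hb hab
        rw [hgX a ha, hgX b hb] at hab
        exact hinj ha hb hab
      · rintro ⟨w, hw, hwz⟩
        rw [hgv, hgX w hw] at hwz
        exact hzX w hw hwz
    · intro w hw
      rcases mem_insert.1 hw with rfl | hw
      · rw [hgv]
        exact ⟨hz1, hz2⟩
      · rw [hgX w hw]
        have := hran w hw
        omega
    · intro a ha b hb hab
      rcases mem_insert.1 ha with rfl | haX <;> rcases mem_insert.1 hb with hb' | hbX
      · rw [hb'] at hab
        exact absurd hab (hH _ _ hab)
      · obtain rfl := huniq b hbX (Or.inr hab)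
        rw [hgv, hgX b hbX]
        exact hz4 hab
      · subst hb'
        obtain rfl := huniq a haX (Or.inl hab)
        rw [hgv, hgX a haX]
        exact hz3 hab
      · rw [hgX a haX, hgX b hbX]
        exact hhom a haX b hbX hab
    · intro w hw
      rcases mem_insert.1 hw with rfl | hw
      · rw [hgv, hins' (fun t => z < t) (lt_irrefl z)]
        exact habz
      · rw [hgX w hw]
        have h1 := hins (fun t => f w < t)
        have h2 := hab w hw
        omega
    · intro w hw
      rcases mem_insert.1 hw with rfl | hw
      · rw [hgv, hins' (fun t => t < z) (lt_irrefl z)]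
        omega
      · rw [hgX w hw]
        have h1 := hins (fun t => t < f w)
        have h2 := hbe w hw
        omega

/-- A tournament on at least `4c` vertices contains every oriented tree on `c` vertices. -/
theorem exists_tree_embedding {A : Type*} {H : A → A → Prop} {X : Finset A} (hX : IsGrown H X)
    (hH : ∀ u v, H u v → ¬ H v u) {R : ℤ → ℤ → Prop} (U : Finset ℤ)
    (hR : ∀ i ∈ U, ∀ j ∈ U, i ≠ j → (R i j ↔ ¬ R j i)) (hU : 4 * #X ≤ #U) :
    ∃ f : A → ℤ, Set.InjOn f X ∧ (∀ v ∈ X, f v ∈ U) ∧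
      ∀ u ∈ X, ∀ v ∈ X, H u v → R (f u) (f v) := by
  have hXpos : 0 < #X := by
    cases hX with
    | single v => simp
    | add X u v => simp
  have hne : Nonempty U := by
    obtain ⟨z, hz⟩ := card_pos.1 (show 0 < #U by omega)
    exact ⟨⟨z, hz⟩⟩
  -- `U` need not be an interval of the given order, so the subtournament on it gets a median order
  -- of its own.
  obtain ⟨e, heinj, hemed⟩ := exists_median_order (α := U) (fun a b => R a b)
    (fun a b hab => hR a a.2 b b.2 (fun h => hab (Subtype.ext h)))
  rw [Fintype.card_coe] at heinj hemed
  obtain ⟨f, hinj, hran, hhom, -, -⟩ := hemed.exists_tree_embedding hX hH (by omega)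
  refine ⟨fun a => e (f a), ?_, fun v _ => (e (f v)).2, hhom⟩
  intro a ha b hb hab
  exact hinj ha hb (heinj (hran a ha) (hran b hb) (Subtype.ext hab))

end TreeEmbedding

/-! ### Extending a placement of the cores to forests -/

section ForestExtension

open scoped Classical

variable {A : Type*} {H : A → A → Prop} {G : SimpleGraph A}

theorem IsGrown.exists_walk (hG : ∀ u v, G.Adj u v ↔ H u v ∨ H v u) {C : Finset A}
    (hC : IsGrown H C) : ∀ a ∈ C, ∀ b ∈ C, ∃ p : G.Walk a b, ∀ z ∈ p.support, z ∈ C := by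
  induction hC with
  | single v =>
    intro a ha b hb
    rw [mem_singleton] at ha hb
    subst ha hb
    exact ⟨SimpleGraph.Walk.nil, by simp⟩
  | add X u v hX hu hv huv huniq ih =>
    have hadj : G.Adj v u := (hG v u).2 huv.symm
    have hvX : ∀ b ∈ X, ∃ p : G.Walk v b, ∀ z ∈ p.support, z ∈ insert v X := by
      intro b hb
      obtain ⟨p, hp⟩ := ih u hu b hb
      refine ⟨SimpleGraph.Walk.cons hadj p, fun z hz => ?_⟩
      rw [SimpleGraph.Walk.support_cons, List.mem_cons] at hz
      rcases hz with rfl | hz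
      · exact mem_insert_self _ _
      · exact mem_insert_of_mem (hp z hz)
    intro a ha b hb
    rcases mem_insert.1 ha with rfl | haX <;> rcases mem_insert.1 hb with hb' | hbX
    · subst hb'
      exact ⟨SimpleGraph.Walk.nil, by simp⟩
    · exact hvX b hbX
    · subst hb'
      obtain ⟨p, hp⟩ := hvX a haX
      exact ⟨p.reverse, by simpa using hp⟩
    · obtain ⟨p, hp⟩ := ih a haX b hbX
      exact ⟨p, fun z hz => mem_insert_of_mem (hp z hz)⟩

/-- Otherwise the path through `w` and the path inside `C` would be two different paths from `a` to
`b`. -/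
theorem eq_of_adj_of_isAcyclic (hacyc : G.IsAcyclic) {C : Finset A} {a b w : A}
    (hab : ∃ p : G.Walk a b, ∀ z ∈ p.support, z ∈ C) (hw : w ∉ C) (haw : G.Adj a w)
    (hbw : G.Adj b w) : a = b := by
  by_contra hne
  obtain ⟨p, hp⟩ := hab
  set q : G.Walk a b := SimpleGraph.Walk.cons haw (SimpleGraph.Walk.cons hbw.symm .nil) with hq
  have hqp : q.IsPath := by
    simp only [hq, SimpleGraph.Walk.cons_isPath_iff, SimpleGraph.Walk.support_cons,
      SimpleGraph.Walk.support_nil, SimpleGraph.Walk.isPath_iff_nil, SimpleGraph.Walk.nil_nil, List.mem_cons,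
      List.not_mem_nil, or_false, not_or]
    exact ⟨⟨trivial, hbw.ne'⟩, haw.ne, hne⟩
  have h1 := (hacyc.subsingleton_path a b).elim p.toPath ⟨q, hqp⟩
  have h2 : (p.toPath : G.Walk a b) = q := congrArg Subtype.val h1
  have h3 : w ∈ (p.toPath : G.Walk a b).support := by
    rw [h2]
    simp [hq]
  exact hw (hp w (SimpleGraph.Walk.support_toPath_subset_support p h3))

/-- A forest each of whose components meets `S` in one vertex, with all edges at `S` leaving `S`,
extends a given placement of `S` provided the vertices of `S` have large out-degree into `zone`. -/
theorem exists_forest_extension [Fintype A] (hG : ∀ u v, G.Adj u v ↔ H u v ∨ H v u)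
    (hH : ∀ u v, H u v → ¬ H v u) (hacyc : G.IsAcyclic) (S : Finset A)
    (hreach : ∀ v, ∃ s ∈ S, G.Reachable v s)
    (huniq : ∀ s ∈ S, ∀ t ∈ S, G.Reachable s t → s = t) (hout : ∀ s ∈ S, ∀ v, ¬ H v s)
    {R : ℤ → ℤ → Prop} (zone : Finset ℤ)
    (hR : ∀ i ∈ zone, ∀ j ∈ zone, i ≠ j → (R i j ↔ ¬ R j i)) (f₀ : A → ℤ)
    (hdeg : ∀ s ∈ S, 5 * Fintype.card A ≤ #{z ∈ zone | R (f₀ s) z}) :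
    ∃ f : A → ℤ, (∀ s ∈ S, f s = f₀ s) ∧ Set.InjOn f (Sᶜ : Finset A) ∧
      (∀ v, v ∉ S → f v ∈ zone) ∧ ∀ u v, H u v → R (f u) (f v) := by
  -- The closure condition makes `X` a union of `S` with whole branches, so the next branch is
  -- attached to the embedded part only at a vertex of `S`.
  let P : Finset A → Prop := fun X => S ⊆ X ∧ (∀ u ∈ X, u ∉ S → ∀ v, G.Adj u v → v ∈ X) ∧
    ∃ f : A → ℤ, (∀ s ∈ S, f s = f₀ s) ∧ Set.InjOn f (X \ S : Finset A) ∧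
      (∀ v ∈ X, v ∉ S → f v ∈ zone) ∧ ∀ u ∈ X, ∀ v ∈ X, H u v → R (f u) (f v)
  have hPS : P S := by
    refine ⟨Subset.rfl, fun u h1 h2 => absurd h1 h2, f₀, fun _ _ => rfl, ?_,
      fun v h1 h2 => absurd h1 h2, fun u _ v hv huv => absurd huv (hout v hv u)⟩
    rw [sdiff_self]
    simp
  obtain ⟨X, hX, hXmax⟩ := exists_max_image (univ.filter P) card ⟨S, by simpa using hPS⟩
  obtain ⟨hSX, hclosed, f, hfS, hfinj, hfz, hfhom⟩ := (mem_filter.1 hX).2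
  by_cases hXu : X = univ
  · subst hXu
    exact ⟨f, hfS, by rwa [compl_eq_univ_sdiff], fun v => hfz v (mem_univ _),
      fun u v => hfhom u (mem_univ _) v (mem_univ _)⟩
  exfalso
  obtain ⟨v₀, hv₀⟩ : ∃ v₀, v₀ ∉ X := by
    by_contra h
    push Not at h
    exact hXu (eq_univ_of_forall h)
  obtain ⟨c, s, hcX, hsX, hcs⟩ : ∃ c s, c ∉ X ∧ s ∈ X ∧ G.Adj c s := by
    obtain ⟨s, hs, ⟨p⟩⟩ := hreach v₀
    obtain ⟨d, -, h1, h2⟩ := p.exists_boundary_dart {v | v ∉ X} hv₀ (by simpa using hSX hs)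
    exact ⟨d.fst, d.snd, h1, by simpa using h2, d.adj⟩
  have hsS : s ∈ S := by
    by_contra h
    exact hcX (hclosed s hsX h c hcs.symm)
  -- By maximality `C` is the whole branch at `s` containing `c`.
  obtain ⟨C, hC, hCmax⟩ := exists_max_image
    (univ.filter fun C : Finset A => IsGrown H C ∧ c ∈ C ∧ Disjoint C X) card
    ⟨{c}, by simpa using ⟨IsGrown.single c, hcX⟩⟩
  obtain ⟨hCg, hcC, hCX⟩ := (mem_filter.1 hC).2
  have hwalk := hCg.exists_walk hG
  have hCout : ∀ v ∈ C, ∀ w, G.Adj v w → w ∈ X ∪ C := by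
    intro v hv w hvw
    by_contra hw
    rw [mem_union, not_or] at hw
    have hgr : IsGrown H (insert w C) := IsGrown.add C v w hCg hv hw.2 ((hG v w).1 hvw)
      (fun u hu huw => eq_of_adj_of_isAcyclic hacyc (hwalk u hu v hv) hw.2 ((hG u w).2 huw) hvw)
    have := hCmax (insert w C) (by
      simp only [mem_filter, mem_univ, true_and]
      exact ⟨hgr, mem_insert_of_mem hcC, disjoint_insert_left.2 ⟨hw.1, hCX⟩⟩)
    rw [card_insert_of_notMem hw.2] at this
    omega
  have hCin : ∀ v ∈ C, ∀ x ∈ X, G.Adj v x → v = c ∧ x = s := by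
    intro v hv x hx hvx
    have hvX : v ∉ X := disjoint_left.1 hCX hv
    have hxS : x ∈ S := by
      by_contra h
      exact hvX (hclosed x hx h v hvx.symm)
    obtain ⟨p, -⟩ := hwalk v hv c hcC
    obtain rfl : x = s := huniq x hxS s hsS ⟨(SimpleGraph.Walk.cons hvx.symm p).concat hcs⟩
    exact ⟨eq_of_adj_of_isAcyclic hacyc (hwalk v hv c hcC)
      (fun h => disjoint_left.1 hCX h hx) hvx hcs, rfl⟩
  -- The branch is embedded among free out-neighbours of the image of `s`, so the edge from `s` to
  -- `c` holds wherever `c` lands. Of the `5 * |A|` out-neighbours at most `|A|` are occupied, which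
  -- leaves the `4 * #C` needed.
  set U := {z ∈ zone | R (f₀ s) z} \ image f (X \ S) with hU
  have hUc : 4 * #C ≤ #U := by
    have h1 := hdeg s hsS
    have h2 : #{z ∈ zone | R (f₀ s) z} - #(image f (X \ S)) ≤ #U := le_card_sdiff _ _
    have h3 := card_image_le (s := X \ S) (f := f)
    have h4 := card_le_univ (X \ S)
    have h5 := card_le_univ C
    omega
  obtain ⟨g, hginj, hgU, hghom⟩ := exists_tree_embedding hCg hH (R := R) U
    (fun i hi j hj => hR i (mem_filter.1 (mem_sdiff.1 hi).1).1 j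
      (mem_filter.1 (mem_sdiff.1 hj).1).1) hUc
  have hgU' : ∀ v ∈ C, g v ∈ zone ∧ R (f₀ s) (g v) ∧ ∀ w ∈ X, w ∉ S → f w ≠ g v := by
    intro v hv
    have h1 := hgU v hv
    simp only [hU, mem_sdiff, mem_filter, mem_image, not_exists, not_and] at h1
    exact ⟨h1.1.1, h1.1.2, fun w hw hwS => h1.2 w ⟨hw, hwS⟩⟩
  set k : A → ℤ := fun v => if v ∈ C then g v else f v with hk
  have hkC : ∀ v ∈ C, k v = g v := fun v hv => if_pos hv
  have hkX : ∀ v ∈ X, k v = f v := fun v hv => if_neg fun h => disjoint_left.1 hCX h hv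
  have hPXC : P (X ∪ C) := by
    refine ⟨hSX.trans subset_union_left, ?_, k, ?_, ?_, ?_, ?_⟩
    · intro u hu huS v huv
      rcases mem_union.1 hu with hu | hu
      · exact mem_union_left _ (hclosed u hu huS v huv)
      · exact hCout u hu v huv
    · intro t ht
      rw [hkX t (hSX ht), hfS t ht]
    · intro a ha b hb hab
      simp only [coe_sdiff, coe_union, Set.mem_sdiff, Set.mem_union, mem_coe] at ha hb
      rcases ha with ⟨ha | ha, haS⟩ <;> rcases hb with ⟨hb | hb, hbS⟩
      · rw [hkX a ha, hkX b hb] at hab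
        exact hfinj (by simp [ha, haS]) (by simp [hb, hbS]) hab
      · rw [hkX a ha, hkC b hb] at hab
        exact absurd hab ((hgU' b hb).2.2 a ha haS)
      · rw [hkC a ha, hkX b hb] at hab
        exact absurd hab.symm ((hgU' a ha).2.2 b hb hbS)
      · rw [hkC a ha, hkC b hb] at hab
        exact hginj ha hb hab
    · intro v hv hvS
      rcases mem_union.1 hv with hv | hv
      · rw [hkX v hv]
        exact hfz v hv hvS
      · rw [hkC v hv]
        exact (hgU' v hv).1
    · intro a ha b hb hab
      rcases mem_union.1 ha with ha | ha <;> rcases mem_union.1 hb with hb | hb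
      · rw [hkX a ha, hkX b hb]
        exact hfhom a ha b hb hab
      · obtain ⟨rfl, rfl⟩ := hCin b hb a ha ((hG b a).2 (Or.inr hab))
        rw [hkX a ha, hkC b hb, hfS a hsS]
        exact (hgU' b hb).2.1
      · obtain ⟨rfl, rfl⟩ := hCin a ha b hb ((hG a b).2 (Or.inl hab))
        exact absurd hab (hout b hsS a)
      · rw [hkC a ha, hkC b hb]
        exact hghom a ha b hb hab
  have h1 := hXmax (X ∪ C) (by simpa using hPXC)
  rw [card_union_of_disjoint hCX.symm] at h1
  have h2 : 0 < #C := card_pos.2 ⟨c, hcC⟩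
  omega

end ForestExtension

/-! ### The greedy embedding of rooted trees -/

section GreedyArborescence

open scoped Classical

/-- The state of the greedy embedding of the rooted tree with root `t` and parent function `par`
along the positions of a median order, after the pairs `(i, j)` up to `(e, z)` in the lexicographic
order have been treated: the nodes in `D` have been placed, and every child of a node has been put on
the first free out-neighbour of its parent. -/
structure IsGreedy {A : Type*} (t : A) (par : A → A) (R : ℤ → ℤ → Prop) (lo hi e z : ℤ)
    (D : Finset A) (φ : A → ℤ) : Prop where
  root_mem : t ∈ D
  root_eq : φ t = lo
  injOn : Set.InjOn φ D
  range : ∀ a ∈ D, lo ≤ φ a ∧ φ a ≤ hi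
  arc : ∀ a ∈ D, a ≠ t → par a ∈ D ∧ φ (par a) < φ a ∧ R (φ (par a)) (φ a) ∧
    (φ (par a) < e ∨ (φ (par a) = e ∧ φ a ≤ z))
  first : ∀ a ∈ D, ∀ c, c ≠ t → par c = a → ∀ j, (φ a < e ∨ (φ a = e ∧ j ≤ z)) → φ a < j →
    j ≤ hi → R (φ a) j → (c ∉ D ∨ j < φ c) → ∃ b ∈ D, b ≠ t ∧ φ b = j ∧ φ (par b) ≤ φ a

variable {A : Type*} {t : A} {par : A → A} {R : ℤ → ℤ → Prop} {lo hi : ℤ}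

/-- The pair `(e, z + 1)` is treated: if a node sits at `e`, still has an unplaced child, and `z +
1` is a free out-neighbour behind `e`, then the child goes there. Otherwise nothing changes. An
already occupied position belongs to a child of a node at or before `e`, since only such nodes have
been treated. -/
theorem IsGreedy.step {e z : ℤ} {D : Finset A} {φ : A → ℤ}
    (h : IsGreedy t par R lo hi e z D φ) : ∃ D' φ', IsGreedy t par R lo hi e (z + 1) D' φ' := by
  by_cases hex : ∃ a ∈ D, φ a = e ∧ e < z + 1 ∧ z + 1 ≤ hi ∧ R e (z + 1) ∧
      (∀ b ∈ D, φ b ≠ z + 1) ∧ ∃ c, c ≠ t ∧ par c = a ∧ c ∉ D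
  · obtain ⟨a, haD, hae, hez, hzhi, hR, hfree, c, hct, hca, hcD⟩ := hex
    have hra := h.range a haD
    refine ⟨insert c D, Function.update φ c (z + 1), ?_⟩
    have hc : Function.update φ c (z + 1) c = z + 1 := Function.update_self _ _ _
    have hD : ∀ b ∈ D, Function.update φ c (z + 1) b = φ b := fun b hb =>
      Function.update_of_ne (fun h => hcD (by rwa [← h])) _ _
    set ψ := Function.update φ c (z + 1) with hψ
    refine ⟨mem_insert_of_mem h.root_mem, (hD t h.root_mem).trans h.root_eq, ?_, ?_, ?_, ?_⟩
    · rw [coe_insert, Set.injOn_insert (by simpa using hcD)]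
      refine ⟨?_, ?_⟩
      · intro a ha b hb hab
        rw [hD a ha, hD b hb] at hab
        exact h.injOn ha hb hab
      · rintro ⟨b, hb, hbz⟩
        rw [hc, hD b hb] at hbz
        exact hfree b hb hbz
    · intro b hb
      rcases mem_insert.1 hb with rfl | hb
      · rw [hc]
        omega
      · rw [hD b hb]
        exact h.range b hb
    · intro b hb hbt
      rcases mem_insert.1 hb with rfl | hb
      · rw [hca, hc, hD a haD, hae]
        exact ⟨mem_insert_of_mem haD, hez, hR, Or.inr ⟨rfl, le_rfl⟩⟩
      · obtain ⟨h1, h2, h3, h4⟩ := h.arc b hb hbt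
        rw [hD b hb, hD _ h1]
        refine ⟨mem_insert_of_mem h1, h2, h3, h4.imp id fun h5 => ⟨h5.1, by omega⟩⟩
    · intro a' ha' c' hc't hc'a' j hj1 hj2 hj3 hj4 hj5
      rcases mem_insert.1 ha' with rfl | ha'
      · rw [hc] at hj1
        omega
      · rw [hD a' ha'] at hj1 hj2 hj4 ⊢
        by_cases hnew : φ a' = e ∧ j = z + 1
        · refine ⟨c, mem_insert_self _ _, hct, hc.trans hnew.2.symm, ?_⟩
          rw [hca, hD a haD, hae, hnew.1]
        · have hj5' : c' ∉ D ∨ j < φ c' := by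
            by_cases hc'D : c' ∈ D
            · rw [hD c' hc'D] at hj5
              exact hj5.imp (fun h1 h2 => h1 (mem_insert_of_mem h2)) id
            · exact Or.inl hc'D
          obtain ⟨b, hb1, hb2, hb3, hb4⟩ :=
            h.first a' ha' c' hc't hc'a' j (by omega) hj2 hj3 hj4 hj5'
          refine ⟨b, mem_insert_of_mem hb1, hb2, (hD b hb1).trans hb3, ?_⟩
          rw [hD _ (h.arc b hb1 hb2).1]
          exact hb4
  · refine ⟨D, φ, h.root_mem, h.root_eq, h.injOn, h.range, ?_, ?_⟩
    · intro a ha hat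
      obtain ⟨h1, h2, h3, h4⟩ := h.arc a ha hat
      exact ⟨h1, h2, h3, h4.imp id fun h5 => ⟨h5.1, by omega⟩⟩
    · intro a ha c hct hca j hj1 hj2 hj3 hj4 hj5
      by_cases hnew : φ a = e ∧ j = z + 1
      · obtain ⟨hae, rfl⟩ := hnew
        have hhit : ∃ b ∈ D, φ b = z + 1 := by
          by_contra hcon
          push Not at hcon
          have hcD : c ∈ D := by
            by_contra hcD
            exact hex ⟨a, ha, hae, by omega, hj3, hae ▸ hj4, hcon, c, hct, hca, hcD⟩
          have h1 := (h.arc c hcD hct).2.2.2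
          rw [hca, hae] at h1
          have h2 := hj5.resolve_left (not_not.2 hcD)
          omega
        obtain ⟨b, hb, hbz⟩ := hhit
        have hra := h.range a ha
        have hbt : b ≠ t := by
          rintro rfl
          rw [h.root_eq] at hbz
          omega
        refine ⟨b, hb, hbt, hbz, ?_⟩
        have := (h.arc b hb hbt).2.2.2
        omega
      · exact h.first a ha c hct hca j (by omega) hj2 hj3 hj4 hj5

theorem IsGreedy.iterate {e z : ℤ} (n : ℕ) (h : ∃ D φ, IsGreedy t par R lo hi e z D φ) :
    ∃ D φ, IsGreedy t par R lo hi e (z + n) D φ := by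
  induction n with
  | zero => simpa using h
  | succ n ih =>
    obtain ⟨D, φ, h1⟩ := ih
    have := h1.step
    push_cast
    rwa [← add_assoc]

theorem IsGreedy.next {e : ℤ} {D : Finset A} {φ : A → ℤ}
    (h : IsGreedy t par R lo hi e hi D φ) : IsGreedy t par R lo hi (e + 1) (lo - 1) D φ := by
  refine ⟨h.root_mem, h.root_eq, h.injOn, h.range, ?_, ?_⟩
  · intro a ha hat
    obtain ⟨h1, h2, h3, h4⟩ := h.arc a ha hat
    exact ⟨h1, h2, h3, Or.inl (by omega)⟩
  · intro a ha c hct hca j hj1 hj2 hj3 hj4 hj5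
    have := h.range a ha
    exact h.first a ha c hct hca j (by omega) hj2 hj3 hj4 hj5

theorem exists_isGreedy (hlo : lo ≤ hi) :
    ∃ D φ, IsGreedy t par R lo hi (hi + 1) (lo - 1) D φ := by
  have key : ∀ n : ℕ, ∃ D φ, IsGreedy t par R lo hi (lo + n) (lo - 1) D φ := by
    intro n
    induction n with
    | zero =>
      refine ⟨{t}, fun _ => lo, by simp, rfl, by simp, ?_, ?_, ?_⟩
      · intro a _
        exact ⟨le_rfl, hlo⟩
      · intro a ha hat
        exact absurd (mem_singleton.1 ha) hat
      · intro a _ c _ _ j h1 h2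
        simp only [Nat.cast_zero, add_zero] at h1
        omega
    | succ n ih =>
      obtain ⟨D, φ, h⟩ := IsGreedy.iterate (hi - lo + 1).toNat ih
      have : lo - 1 + ((hi - lo + 1).toNat : ℤ) = hi := by omega
      rw [this] at h
      refine ⟨D, φ, ?_⟩
      push_cast
      rw [← add_assoc]
      exact h.next
  have := key (hi - lo + 1).toNat
  rwa [show lo + ((hi - lo + 1).toNat : ℤ) = hi + 1 by omega] at this

/-- If the greedy embedding is not complete, at most as many positions are missed as leaves have
been placed. -/
theorem IsGreedy.card_missed_le (h : IsMedian R lo hi) {d : A → ℕ}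
    (hd : ∀ a, a ≠ t → d (par a) < d a) {D : Finset A} {φ : A → ℤ}
    (hg : IsGreedy t par R lo hi (hi + 1) (lo - 1) D φ) (hD : ∃ a, a ∉ D) (n : ℕ) :
    ∀ e : ℤ, lo - 1 ≤ e → e ≤ hi → e - lo + 1 = n →
      #{z ∈ Icc lo e | ∀ a ∈ D, φ a ≠ z} ≤ #{a ∈ D | (∀ c, c ≠ t → par c ≠ a) ∧ φ a ≤ e} := by
  induction n using Nat.strong_induction_on with
  | _ n ih =>
    intro e he1 he2 hen
    rcases Nat.eq_zero_or_pos n with rfl | hn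
    · rw [Icc_eq_empty (by omega)]
      simp
    by_cases hmiss : ∃ a ∈ D, φ a = e
    · obtain ⟨a, haD, hae⟩ := hmiss
      have h1 := ih (n - 1) (by omega) (e - 1) (by omega) (by omega) (by omega)
      refine le_trans (le_trans (card_le_card ?_) h1) (card_le_card ?_)
      · intro z hz
        simp only [mem_filter, mem_Icc] at hz ⊢
        have := hz.2 a haD
        exact ⟨⟨hz.1.1, by omega⟩, hz.2⟩
      · intro b hb
        simp only [mem_filter] at hb ⊢
        exact ⟨hb.1, hb.2.1, by omega⟩
    push Not at hmiss
    have hlo : lo < e := by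
      have h1 := hmiss t hg.root_mem
      rw [hg.root_eq] at h1
      omega
    -- A missed position leaves an open node before it: the parent of a shallowest node placed
    -- behind `e`, or, if there is none, the parent of a shallowest unplaced node.
    have hopen : ∃ a ∈ D, φ a < e ∧ ∃ c, c ≠ t ∧ par c = a ∧ (c ∉ D ∨ e < φ c) := by
      by_cases hbig : ∃ b ∈ D, e < φ b
      · obtain ⟨b₀, hb₀, hb₀e⟩ := hbig
        obtain ⟨b, hb, hbmin⟩ := exists_min_image (D.filter fun b => e < φ b) d
          ⟨b₀, by simp [hb₀, hb₀e]⟩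
        rw [mem_filter] at hb
        have hbt : b ≠ t := by
          rintro rfl
          have := hb.2
          rw [hg.root_eq] at this
          omega
        have hp := (hg.arc b hb.1 hbt).1
        refine ⟨par b, hp, ?_, b, hbt, rfl, Or.inr hb.2⟩
        by_contra hcon
        have h1 := hmiss _ hp
        have h2 := hbmin (par b) (by
          rw [mem_filter]
          exact ⟨hp, by omega⟩)
        have h3 := hd b hbt
        omega
      · push Not at hbig
        obtain ⟨c₀, hc₀⟩ := hD
        obtain ⟨m, ⟨c, hc, hcm⟩, hmin⟩ : ∃ m, (∃ c, c ∉ D ∧ d c = m) ∧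
            ∀ m' < m, ¬ ∃ c, c ∉ D ∧ d c = m' := by
          have hex : ∃ m, ∃ c, c ∉ D ∧ d c = m := ⟨_, c₀, hc₀, rfl⟩
          exact ⟨Nat.find hex, Nat.find_spec hex, fun m' hm' => Nat.find_min hex hm'⟩
        have hct : c ≠ t := by
          rintro rfl
          exact hc hg.root_mem
        have hp : par c ∈ D := by
          by_contra hp
          exact hmin (d (par c)) (by have := hd c hct; omega) ⟨_, hp, rfl⟩
        have h1 := hmiss _ hp
        have h2 := hbig _ hp
        exact ⟨par c, hp, by omega, c, hct, rfl, Or.inl hc⟩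
    obtain ⟨a₀, ha₀, ha₀e, ha₀c⟩ := hopen
    -- The last open node splits `[lo, e]`: induction covers the positions up to its place `i`, and
    -- the misses in `(i, e]` are charged to leaves placed there.
    obtain ⟨a, ha, hamax⟩ := exists_max_image (D.filter fun a => φ a < e ∧
      ∃ c, c ≠ t ∧ par c = a ∧ (c ∉ D ∨ e < φ c)) φ ⟨a₀, by
        rw [mem_filter]
        exact ⟨ha₀, ha₀e, ha₀c⟩⟩
    rw [mem_filter] at ha
    obtain ⟨haD, hae, c, hct, hca, hce⟩ := ha
    have hra := hg.range a haD
    set i := φ a with hi'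
    set hit := {b ∈ D | i < φ b ∧ φ b < e} with hhit
    set early := {b ∈ hit | b ≠ t ∧ φ (par b) ≤ i} with hearly
    set inner := {b ∈ hit | ∃ c, c ≠ t ∧ par c = b} with hinner
    set lvs := {b ∈ hit | ∀ c, c ≠ t → par c ≠ b} with hlvs
    have hhitsplit : #inner + #lvs = #hit := by
      rw [hinner, hlvs, ← card_filter_add_card_filter_not (s := hit) (fun b => ∃ c, c ≠ t ∧ par c = b)]
      congr 2
      refine filter_congr fun b _ => ?_
      push Not
      rfl
    -- As `a` is open, each out-neighbour of `i` in `(i, e]` was taken by a child of a node at or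
    -- before `i`. So at least half of the interval is hit by such early nodes.
    have hearlyc : e - i ≤ 2 * (#early : ℤ) := by
      have h1 := h.out_half (i := i) (j := e) hra.1 hae.le he2
      have h2 : #{y ∈ Ioc i e | R i y} ≤ #(early.image φ) := by
        refine card_le_card fun y hy => ?_
        simp only [mem_filter, mem_Ioc] at hy
        obtain ⟨b, hb1, hb2, hb3, hb4⟩ := hg.first a haD c hct hca y (Or.inl (by omega)) hy.1.1
          (by omega) hy.2 (hce.imp id fun h => by omega)
        rw [mem_image]
        refine ⟨b, ?_, hb3⟩
        have := hmiss b hb1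
        simp only [hearly, hhit, mem_filter]
        exact ⟨⟨hb1, by omega, by omega⟩, hb2, hb4⟩
      have h3 := card_image_le (s := early) (f := φ)
      omega
    -- By the choice of `a`, the nodes hit between `i` and `e` are not open. Hence each non-leaf
    -- among them has a child placed before `e`, and that child is not early. It follows that there
    -- are at least as many leaves as early nodes, and so at least as many leaves as misses.
    have hinnerc : #inner ≤ #(hit \ early) := by
      have hch : ∀ b ∈ inner, ∃ c ∈ hit \ early, par c = b := by
        intro b hb
        simp only [hinner, hhit, mem_filter] at hb
        obtain ⟨⟨hbD, hb1, hb2⟩, c', hc't, hc'b⟩ := hb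
        have hc' : ¬ (c' ∉ D ∨ e < φ c') := by
          intro hcon
          have := hamax b (by
            rw [mem_filter]
            exact ⟨hbD, hb2, c', hc't, hc'b, hcon⟩)
          omega
        push Not at hc'
        have h1 := hmiss c' hc'.1
        have h2 := (hg.arc c' hc'.1 hc't).2.1
        rw [hc'b] at h2
        refine ⟨c', ?_, hc'b⟩
        simp only [hhit, hearly, mem_sdiff, mem_filter, hc'b]
        exact ⟨⟨hc'.1, by omega, by omega⟩, by omega⟩
      choose! ch hch1 hch2 using hch
      refine card_le_card_of_injOn ch hch1 ?_
      intro x hx y hy hxy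
      rw [← hch2 x hx, ← hch2 y hy, hxy]
    have hsub : early ⊆ hit := filter_subset _ _
    have hcs := card_sdiff_add_card_eq_card hsub
    have hhitc : #{z ∈ Ioc i e | ∀ a ∈ D, φ a ≠ z} + #hit ≤ #(Ioc i e) := by
      have h1 : #(hit.image φ) = #hit := by
        refine card_image_of_injOn fun x hx y hy hxy => hg.injOn ?_ ?_ hxy
        · exact (mem_filter.1 hx).1
        · exact (mem_filter.1 hy).1
      rw [← h1, ← card_union_of_disjoint]
      · refine card_le_card (union_subset (filter_subset _ _) ?_)
        intro z hz
        obtain ⟨b, hb, rfl⟩ := mem_image.1 hz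
        simp only [hhit, mem_filter] at hb
        rw [mem_Ioc]
        omega
      · rw [disjoint_left]
        intro z hz hz'
        obtain ⟨b, hb, rfl⟩ := mem_image.1 hz'
        exact (mem_filter.1 hz).2 b (mem_filter.1 hb).1 rfl
    rw [Int.card_Ioc] at hhitc
    have hprev := ih (i - lo + 1).toNat (by omega) i (by omega) (by omega) (by omega)
    have hL : #{z ∈ Icc lo e | ∀ a ∈ D, φ a ≠ z} ≤
        #{z ∈ Icc lo i | ∀ a ∈ D, φ a ≠ z} + #{z ∈ Ioc i e | ∀ a ∈ D, φ a ≠ z} := by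
      refine le_trans (card_le_card ?_) (card_union_le _ _)
      intro z hz
      simp only [mem_filter, mem_Icc, mem_union, mem_Ioc] at hz ⊢
      by_cases hzi : z ≤ i
      · exact Or.inl ⟨⟨hz.1.1, hzi⟩, hz.2⟩
      · exact Or.inr ⟨⟨by omega, hz.1.2⟩, hz.2⟩
    have hRr : #{a ∈ D | (∀ c, c ≠ t → par c ≠ a) ∧ φ a ≤ i} + #lvs ≤
        #{a ∈ D | (∀ c, c ≠ t → par c ≠ a) ∧ φ a ≤ e} := by
      rw [← card_union_of_disjoint]
      · refine card_le_card fun b hb => ?_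
        simp only [hlvs, hhit, mem_union, mem_filter] at hb ⊢
        rcases hb with hb | hb
        · exact ⟨hb.1, hb.2.1, by omega⟩
        · exact ⟨hb.1.1, hb.2, by omega⟩
      · rw [disjoint_left]
        intro b hb hb'
        simp only [hlvs, hhit, mem_filter] at hb hb'
        omega
    omega

/-- Dross and Havet: along a median order on `n + k - 1` vertices every rooted tree with `n` nodes
and `k` leaves embeds, its root being the first vertex and its edges leading away from the root. -/
theorem IsMedian.exists_arborescence_embedding [Fintype A] (h : IsMedian R lo hi) {d : A → ℕ}
    (hd : ∀ a, a ≠ t → d (par a) < d a)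
    (hcard : hi - lo + 1 = Fintype.card A + #{a : A | ∀ c, c ≠ t → par c ≠ a} - 1) :
    ∃ f : A → ℤ, Function.Injective f ∧ (∀ a, lo ≤ f a ∧ f a ≤ hi) ∧ f t = lo ∧
      ∀ a, a ≠ t → R (f (par a)) (f a) := by
  have hleaf : 0 < #{a : A | ∀ c, c ≠ t → par c ≠ a} := by
    obtain ⟨a, -, hmax⟩ := exists_max_image (univ : Finset A) d ⟨t, mem_univ _⟩
    refine card_pos.2 ⟨a, ?_⟩
    simp only [mem_filter, mem_univ, true_and]
    rintro c hc rfl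
    have h1 := hd c hc
    have h2 := hmax c (mem_univ _)
    omega
  have hA : 0 < Fintype.card A := Fintype.card_pos_iff.2 ⟨t⟩
  obtain ⟨D, φ, hg⟩ := exists_isGreedy (t := t) (par := par) (R := R) (show lo ≤ hi by omega)
  -- An incomplete embedding places at most `|A| - 1` nodes, so at least as many positions are
  -- missed as there are leaves. Therefore all leaves are placed, but a deepest unplaced node would
  -- be a leaf.
  by_cases hD : ∃ a, a ∉ D
  · exfalso
    have h1 : #{z ∈ Icc lo hi | ∀ a ∈ D, φ a ≠ z} ≤
        #{a ∈ D | (∀ c, c ≠ t → par c ≠ a) ∧ φ a ≤ hi} := by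
      convert hg.card_missed_le h hd hD (hi - lo + 1).toNat hi (by omega) le_rfl (by omega)
    have h2 : #(Icc lo hi) ≤ #{z ∈ Icc lo hi | ∀ a ∈ D, φ a ≠ z} + #D := by
      refine le_trans (card_le_card ?_) ((card_union_le _ (D.image φ)).trans
        (Nat.add_le_add_left card_image_le _))
      intro z hz
      rw [mem_union, mem_filter, mem_image]
      by_cases hzD : ∃ a ∈ D, φ a = z
      · exact Or.inr hzD
      · push Not at hzD
        exact Or.inl ⟨hz, hzD⟩
    have h3 : #D < Fintype.card A := by
      obtain ⟨a, ha⟩ := hD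
      exact card_lt_univ_of_notMem ha
    rw [Int.card_Icc] at h2
    have h4 : {a ∈ D | (∀ c, c ≠ t → par c ≠ a) ∧ φ a ≤ hi} ⊆
        ({a : A | ∀ c, c ≠ t → par c ≠ a} : Finset A) := by
      intro b hb
      simp only [mem_filter, mem_univ, true_and] at hb ⊢
      exact hb.2.1
    have h5 := eq_of_subset_of_card_le h4 (by omega)
    obtain ⟨a₀, ha₀⟩ := hD
    obtain ⟨a, ha, hmax⟩ := exists_max_image (univ.filter fun a => a ∉ D) d ⟨a₀, by simp [ha₀]⟩
    simp only [mem_filter, mem_univ, true_and] at ha hmax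
    have h6 : a ∉ ({a : A | ∀ c, c ≠ t → par c ≠ a} : Finset A) := by
      rw [← h5]
      simp [ha]
    simp only [mem_filter, mem_univ, true_and, not_forall, not_not] at h6
    obtain ⟨c, hct, rfl⟩ := h6
    have hcD : c ∉ D := fun hcD => ha (hg.arc c hcD hct).1
    have h7 := hmax c hcD
    have h8 := hd c hct
    omega
  · push Not at hD
    exact ⟨φ, fun a b hab => hg.injOn (hD a) (hD b) hab, fun a => hg.range a (hD a), hg.root_eq,
      fun a ha => (hg.arc a (hD a) ha).2.2.1⟩

end GreedyArborescence

/-! ### Embedding arborescences -/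

section Arborescences

open scoped Classical

variable {V : Type*}

theorem DiPath.head_mem (p : DiPath V) : p.first ∈ p.support := List.head_mem _

theorem DiPath.last_mem (p : DiPath V) : p.last ∈ p.support := List.getLast_mem _

/-- In an out-arborescence every vertex but the root has a parent, nearer to the root, and all edges
lead from a parent to a child. -/
theorem IsOutArborescence.exists_parent [Finite V] {S : SubDigraph V} {t : V}
    (h : IsOutArborescence S t) : ∃ (par : S.verts → S.verts) (d : S.verts → ℕ),
      (∀ a : S.verts, (a : V) ≠ t → S.Adj (par a) a ∧ d (par a) < d a) ∧
      ∀ a b : S.verts, S.Adj a b → (b : V) ≠ t ∧ par b = a := by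
  obtain ⟨⟨hor, htree⟩, ht, hpath⟩ := h
  -- The depth of a vertex is the least number of vertices on a directed path to it from the root;
  -- its parent is the last but one vertex of a shortest such path.
  have hlen : ∀ a : S.verts, ∃ n, ∃ p : DiPath V, p.first = t ∧ p.last = a ∧ p.toSub ⊆ S ∧
      p.support.length = n := by
    intro a
    obtain ⟨p, h1, h2, h3⟩ := hpath a a.2
    exact ⟨_, p, h1, h2, h3, rfl⟩
  have hpar : ∀ a : S.verts, (a : V) ≠ t →
      ∃ b : S.verts, S.Adj b a ∧ Nat.find (hlen b) < Nat.find (hlen a) := by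
    intro a hat
    obtain ⟨p, h1, h2, h3, h4⟩ := Nat.find_spec (hlen a)
    have hsplit := List.dropLast_append_getLast p.ne_nil
    have hne : p.support.dropLast ≠ [] := by
      intro h5
      rw [h5, List.nil_append] at hsplit
      apply hat
      rw [← h1, ← h2]
      simp only [DiPath.first, DiPath.last]
      have : ∀ (l : List V) (hl : l ≠ []) (x : V), [x] = l → l.getLast hl = l.head hl := by
        rintro l hl x rfl
        rfl
      exact this _ p.ne_nil _ hsplit
    set q : DiPath V := ⟨p.support.dropLast, hne, p.nodup.sublist (List.dropLast_sublist _)⟩ with hq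
    have hedge : [q.last, (a : V)] <:+: p.support := by
      refine ⟨p.support.dropLast.dropLast, [], ?_⟩
      have h5 := List.dropLast_append_getLast hne
      rw [List.append_nil, ← h2]
      conv_rhs => rw [← hsplit, ← h5]
      simp [DiPath.last, hq]
    have hS : S.Adj q.last a := h3.2 _ _ hedge
    refine ⟨⟨q.last, S.left_mem hS⟩, hS, ?_⟩
    refine lt_of_le_of_lt (Nat.find_min' _ ⟨q, ?_, rfl, ⟨?_, ?_⟩, rfl⟩) ?_
    · rw [← h1]
      simp [DiPath.first, hq, List.head_dropLast]
    · intro v hv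
      exact h3.1 ((List.dropLast_sublist _).subset hv)
    · intro u v huv
      exact h3.2 u v (List.IsInfix.trans huv (List.dropLast_prefix _).isInfix)
    · rw [← h4]
      have := List.length_pos_of_ne_nil p.ne_nil
      simp only [hq, List.length_dropLast]
      omega
  have hex : ∃ par : S.verts → S.verts, ∀ a : S.verts, (a : V) ≠ t →
      S.Adj (par a) a ∧ Nat.find (hlen (par a)) < Nat.find (hlen a) := by
    refine ⟨fun a => if ha : (a : V) ≠ t then (hpar a ha).choose else a, fun a ha => ?_⟩
    simp only [ha, ne_eq, not_false_eq_true, dite_true]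
    exact (hpar a ha).choose_spec
  obtain ⟨par, hpar'⟩ := hex
  refine ⟨par, fun a => Nat.find (hlen a), hpar', ?_⟩
  have : Fintype S.verts := Fintype.ofFinite _
  set G := S.coe.toSimpleGraphInclusive with hG
  have hadj : ∀ a b : S.verts, G.Adj a b ↔ a ≠ b ∧ (S.Adj a b ∨ S.Adj b a) := fun a b => by
    simp [hG, Digraph.toSimpleGraphInclusive, SimpleGraph.fromRel_adj, SubDigraph.coe]
  have hor' : ∀ a b : S.verts, S.Adj a b → ¬ S.Adj b a := fun a b => hor a b
  set t' : S.verts := ⟨t, ht⟩ with ht'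
  have hcoe : ∀ a : S.verts, a ≠ t' ↔ (a : V) ≠ t := fun a => by
    rw [ne_eq, ne_eq, Subtype.ext_iff]
  -- The edges to parents are distinct and one fewer than the vertices, so they are all the edges of
  -- the tree.
  have himg : (univ.erase t').image (fun a => s(par a, a)) = G.edgeFinset := by
    refine eq_of_subset_of_card_le ?_ ?_
    · intro e he
      obtain ⟨a, ha, rfl⟩ := mem_image.1 he
      have h1 := (hpar' a ((hcoe a).1 (mem_erase.1 ha).1)).1
      rw [SimpleGraph.mem_edgeFinset, SimpleGraph.mem_edgeSet, hadj]
      refine ⟨?_, Or.inl h1⟩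
      intro h2
      rw [h2] at h1
      exact hor' a a h1 h1
    · rw [card_image_of_injOn, card_erase_of_mem (mem_univ _), card_univ]
      · have := htree.card_edgeFinset
        omega
      · intro a ha b hb hab
        simp only [coe_erase, Set.mem_sdiff, Set.mem_singleton_iff] at ha hb
        simp only [Sym2.eq_iff] at hab
        rcases hab with ⟨-, h1⟩ | ⟨h1, h2⟩
        · exact h1
        · have h3 := (hpar' a ((hcoe a).1 ha.2)).1
          have h4 := (hpar' b ((hcoe b).1 hb.2)).1
          rw [h1] at h3
          rw [← h2] at h4
          exact absurd h4 (hor' _ _ h3)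
  intro a b hab
  have hE : s(a, b) ∈ G.edgeFinset := by
    rw [SimpleGraph.mem_edgeFinset, SimpleGraph.mem_edgeSet, hadj]
    refine ⟨?_, Or.inl hab⟩
    rintro rfl
    exact hor' _ _ hab hab
  rw [← himg, mem_image] at hE
  obtain ⟨w, hw, hwe⟩ := hE
  have hwt := (hcoe w).1 (mem_erase.1 hw).1
  simp only [Sym2.eq_iff] at hwe
  rcases hwe with ⟨h1, rfl⟩ | ⟨h1, rfl⟩
  · exact ⟨hwt, h1⟩
  · have h3 := (hpar' w hwt).1
    rw [h1] at h3
    exact absurd h3 (hor' _ _ hab)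

theorem IsOutArborescence.exists_embedding [Finite V] {S : SubDigraph V} {t : V}
    (h : IsOutArborescence S t) (hS : 2 ≤ S.order) {R : ℤ → ℤ → Prop} {lo hi : ℤ}
    (hmed : IsMedian R lo hi) (hcard : hi - lo + 1 = S.order + S.outLeaves.ncard - 1) :
    ∃ f : V → ℤ, Set.InjOn f S.verts ∧ (∀ v ∈ S.verts, lo ≤ f v ∧ f v ≤ hi) ∧ f t = lo ∧
      ∀ u v, S.Adj u v → R (f u) (f v) := by
  have ht : t ∈ S.verts := h.2.1
  obtain ⟨par, d, hpar, hadj⟩ := h.exists_parent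
  have : Fintype S.verts := Fintype.ofFinite _
  set t' : S.verts := ⟨t, ht⟩ with ht'
  have hcoe : ∀ a : S.verts, a ≠ t' ↔ (a : V) ≠ t := fun a => by
    rw [ne_eq, ne_eq, Subtype.ext_iff]
  have horder : S.order = Fintype.card S.verts := by
    rw [SubDigraph.order, ← Nat.card_coe_set_eq, Nat.card_eq_fintype_card]
  -- With at least two vertices the root has a child, so the childless nodes counted by the greedy
  -- embedding are exactly the out-leaves.
  have hchild : ∃ a : S.verts, a ≠ t' ∧ par a = t' := by
    have h1 : 1 < Fintype.card S.verts := by omega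
    obtain ⟨a₀, ha₀⟩ := Fintype.exists_ne_of_one_lt_card h1 t'
    obtain ⟨a, ha, hmin⟩ := exists_min_image (univ.erase t') d ⟨a₀, by simp [ha₀]⟩
    refine ⟨a, (mem_erase.1 ha).1, ?_⟩
    by_contra hcon
    have h2 := hmin (par a) (by simp [hcon])
    have h3 := (hpar a ((hcoe a).1 (mem_erase.1 ha).1)).2
    omega
  have hleaves : S.outLeaves = Subtype.val '' {a : S.verts | ∀ c, c ≠ t' → par c ≠ a} := by
    ext v
    constructor
    · rintro ⟨hv, h1, -⟩
      refine ⟨⟨v, hv⟩, ?_, rfl⟩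
      intro c hc hcv
      have h2 := (hpar c ((hcoe c).1 hc)).1
      rw [hcv] at h2
      have : (c : V) ∈ S.nbrs .plus v := h2
      rw [h1] at this
      exact this
    · rintro ⟨a, ha, rfl⟩
      have hat : a ≠ t' := by
        rintro rfl
        obtain ⟨c, hc, hct⟩ := hchild
        exact ha c hc hct
      refine ⟨a.2, ?_, ?_⟩
      · rw [Set.eq_empty_iff_forall_notMem]
        intro w hw
        have hw' : S.Adj a w := hw
        obtain ⟨h1, h2⟩ := hadj a ⟨w, S.right_mem hw'⟩ hw'
        exact ha _ ((hcoe _).2 h1) h2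
      · rw [Set.ncard_eq_one]
        refine ⟨par a, ?_⟩
        ext w
        simp only [Set.mem_singleton_iff]
        constructor
        · intro hw
          have hw' : S.Adj w a := hw
          have := (hadj ⟨w, S.left_mem hw'⟩ a hw').2
          rw [this]
        · rintro rfl
          exact (hpar a ((hcoe a).1 hat)).1
  have hlcard : S.outLeaves.ncard = #{a : S.verts | ∀ c, c ≠ t' → par c ≠ a} := by
    rw [hleaves, Set.ncard_image_of_injective _ Subtype.val_injective, ← Set.ncard_coe_finset]
    simp
  rw [horder, hlcard] at hcard
  obtain ⟨f, hinj, hran, hft, hf⟩ := hmed.exists_arborescence_embedding (t := t') (par := par)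
    (fun a ha => (hpar a ((hcoe a).1 ha)).2) (by convert hcard)
  set g : V → ℤ := fun v => if hv : v ∈ S.verts then f ⟨v, hv⟩ else 0 with hg
  have hgf : ∀ v (hv : v ∈ S.verts), g v = f ⟨v, hv⟩ := fun v hv => dif_pos hv
  refine ⟨g, ?_, ?_, ?_, ?_⟩
  · intro a ha b hb hab
    rw [hgf a ha, hgf b hb] at hab
    exact congrArg Subtype.val (hinj hab)
  · intro v hv
    rw [hgf v hv]
    exact hran _
  · rw [hgf t ht]
    exact hft
  · intro u v huv
    rw [hgf u (S.left_mem huv), hgf v (S.right_mem huv)]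
    obtain ⟨h1, h2⟩ := hadj ⟨u, S.left_mem huv⟩ ⟨v, S.right_mem huv⟩ huv
    have h3 := hf ⟨v, S.right_mem huv⟩ ((hcoe _).2 h1)
    rwa [h2] at h3

/-- The digraph with all edges reversed. -/
def SubDigraph.flip (S : SubDigraph V) : SubDigraph V where
  verts := S.verts
  Adj u v := S.Adj v u
  left_mem h := S.right_mem h
  right_mem h := S.left_mem h

theorem SubDigraph.toSimpleGraphInclusive_flip (S : SubDigraph V) :
    S.flip.coe.toSimpleGraphInclusive = S.coe.toSimpleGraphInclusive := by
  ext a b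
  simp only [Digraph.toSimpleGraphInclusive, SimpleGraph.fromRel_adj]
  exact and_congr_right fun _ => or_comm

theorem IsInArborescence.flip {S : SubDigraph V} {t : V} (h : IsInArborescence S t) :
    IsOutArborescence S.flip t := by
  obtain ⟨⟨hor, htree⟩, ht, hpath⟩ := h
  refine ⟨⟨fun u v h1 h2 => hor v u h1 h2, ?_⟩, ht, ?_⟩
  · have := S.toSimpleGraphInclusive_flip
    change S.flip.coe.toSimpleGraphInclusive.IsTree
    rw [this]
    exact htree
  · intro v hv
    obtain ⟨p, h1, h2, h3, h4⟩ := hpath v hv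
    refine ⟨⟨p.support.reverse, by simpa using p.ne_nil, by simpa using p.nodup⟩, ?_, ?_, ?_, ?_⟩
    · rw [← h2]
      simp [DiPath.first, DiPath.last]
    · rw [← h1]
      simp [DiPath.first, DiPath.last]
    · intro w hw
      exact h3 (List.mem_reverse.1 hw)
    · intro a b hab
      refine h4 b a ?_
      have hab' : [a, b] <:+: p.support.reverse := hab
      rw [← List.reverse_infix] at hab'
      exact show [b, a] <:+: p.support by simpa using hab'

theorem IsInArborescence.exists_embedding [Finite V] {S : SubDigraph V} {t : V}
    (h : IsInArborescence S t) (hS : 2 ≤ S.order) {R : ℤ → ℤ → Prop} {lo hi : ℤ}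
    (hmed : IsMedian R lo hi) (hcard : hi - lo + 1 = S.order + S.inLeaves.ncard - 1) :
    ∃ f : V → ℤ, Set.InjOn f S.verts ∧ (∀ v ∈ S.verts, lo ≤ f v ∧ f v ≤ hi) ∧ f t = hi ∧
      ∀ u v, S.Adj u v → R (f u) (f v) := by
  obtain ⟨f, h1, h2, h3, h4⟩ := h.flip.exists_embedding hS hmed.rev (by
    have h5 : S.flip.outLeaves = S.inLeaves := rfl
    have h6 : S.flip.order = S.order := rfl
    rw [h5, h6]
    omega)
  refine ⟨fun v => - f v, ?_, ?_, ?_, ?_⟩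
  · intro a ha b hb hab
    exact h1 ha hb (neg_inj.1 hab)
  · intro v hv
    have := h2 v hv
    change lo ≤ - f v ∧ - f v ≤ hi
    omega
  · simp [h3]
  · intro u v huv
    exact h4 v u huv

end Arborescences

/-! ### Forest extensions on subdigraphs, gluing, and disjoint choices -/

section ForestsInDigraphs

open scoped Classical

variable {V : Type*}

theorem SubDigraph.exists_extension_out [Finite V] (F : SubDigraph V) (S : Set V)
    (hF : IsOrientedForest F.coe)
    (hcomp : ∀ c : F.coe.toSimpleGraphInclusive.ConnectedComponent,
      ∃! v : F.verts, v ∈ c.supp ∧ (v : V) ∈ S)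
    (hout : ∀ v ∈ S, F.OnlyNbrs .plus v) {R : ℤ → ℤ → Prop} (zone : Finset ℤ)
    (hR : ∀ i ∈ zone, ∀ j ∈ zone, i ≠ j → (R i j ↔ ¬ R j i)) (f₀ : V → ℤ)
    (hdeg : ∀ s ∈ S, 5 * F.order ≤ #{z ∈ zone | R (f₀ s) z}) :
    ∃ f : V → ℤ, (∀ s ∈ S, f s = f₀ s) ∧ Set.InjOn f (F.verts \ S) ∧
      (∀ v ∈ F.verts \ S, f v ∈ zone) ∧ ∀ u v, F.Adj u v → R (f u) (f v) := by
  have : Fintype F.verts := Fintype.ofFinite _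
  have horder : F.order = Fintype.card F.verts := by
    rw [SubDigraph.order, ← Nat.card_coe_set_eq, Nat.card_eq_fintype_card]
  have hasymm : ∀ u v : F.verts, F.Adj u v → ¬ F.Adj v u := fun u v => hF.1 u v
  have hG : ∀ u v : F.verts, F.coe.toSimpleGraphInclusive.Adj u v ↔ F.Adj u v ∨ F.Adj v u := by
    intro u v
    simp only [Digraph.toSimpleGraphInclusive, SimpleGraph.fromRel_adj, SubDigraph.coe]
    refine ⟨fun h => h.2, fun h => ⟨?_, h⟩⟩
    rintro rfl
    rcases h with h | h <;> exact hasymm _ _ h h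
  obtain ⟨f, h1, h2, h3, h4⟩ := exists_forest_extension (H := fun u v : F.verts => F.Adj u v) hG
    hasymm hF.2 (univ.filter fun v : F.verts => (v : V) ∈ S)
    (by
      intro v
      obtain ⟨s, ⟨hs1, hs2⟩, -⟩ := hcomp (F.coe.toSimpleGraphInclusive.connectedComponentMk v)
      refine ⟨s, by simpa using hs2, ?_⟩
      rw [SimpleGraph.ConnectedComponent.mem_supp_iff] at hs1
      exact (SimpleGraph.ConnectedComponent.exact hs1).symm)
    (by
      intro s hs t ht hst
      simp only [mem_filter, mem_univ, true_and] at hs ht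
      refine (hcomp (F.coe.toSimpleGraphInclusive.connectedComponentMk t)).unique ⟨?_, hs⟩ ⟨?_, ht⟩
      · rw [SimpleGraph.ConnectedComponent.mem_supp_iff]
        exact SimpleGraph.ConnectedComponent.sound hst
      · rw [SimpleGraph.ConnectedComponent.mem_supp_iff])
    (by
      intro s hs v hvs
      simp only [mem_filter, mem_univ, true_and] at hs
      have h1 : F.nbrs .minus s = ∅ := hout s hs
      have h2 : (v : V) ∈ F.nbrs .minus s := hvs
      rw [h1] at h2
      exact h2)
    zone hR (fun v => f₀ v)
    (by
      intro s hs
      simp only [mem_filter, mem_univ, true_and] at hs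
      rw [← horder]
      exact hdeg s hs)
  refine ⟨fun v => if hv : v ∈ F.verts then f ⟨v, hv⟩ else f₀ v, ?_, ?_, ?_, ?_⟩
  · intro s hs
    by_cases hsF : s ∈ F.verts
    · simp only [hsF, dite_true]
      exact h1 ⟨s, hsF⟩ (by simpa using hs)
    · simp only [hsF, dite_false]
  · rintro a ⟨ha, haS⟩ b ⟨hb, hbS⟩ hab
    simp only [ha, hb, dite_true] at hab
    exact congrArg Subtype.val (h2 (by simpa using haS) (by simpa using hbS) hab)
  · rintro v ⟨hv, hvS⟩
    simp only [hv, dite_true]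
    exact h3 _ (by simpa using hvS)
  · intro u v huv
    simp only [F.left_mem huv, F.right_mem huv, dite_true]
    exact h4 _ _ huv

theorem SubDigraph.exists_extension_in [Finite V] (F : SubDigraph V) (S : Set V)
    (hF : IsOrientedForest F.coe)
    (hcomp : ∀ c : F.coe.toSimpleGraphInclusive.ConnectedComponent,
      ∃! v : F.verts, v ∈ c.supp ∧ (v : V) ∈ S)
    (hin : ∀ v ∈ S, F.OnlyNbrs .minus v) {R : ℤ → ℤ → Prop} (zone : Finset ℤ)
    (hR : ∀ i ∈ zone, ∀ j ∈ zone, i ≠ j → (R i j ↔ ¬ R j i)) (f₀ : V → ℤ)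
    (hdeg : ∀ s ∈ S, 5 * F.order ≤ #{z ∈ zone | R z (f₀ s)}) :
    ∃ f : V → ℤ, (∀ s ∈ S, f s = f₀ s) ∧ Set.InjOn f (F.verts \ S) ∧
      (∀ v ∈ F.verts \ S, f v ∈ zone) ∧ ∀ u v, F.Adj u v → R (f u) (f v) := by
  obtain ⟨f, h1, h2, h3, h4⟩ := F.flip.exists_extension_out S (R := fun i j => R j i)
    ⟨fun u v h h' => hF.1 v u h h', by
      have h := F.toSimpleGraphInclusive_flip
      change F.flip.coe.toSimpleGraphInclusive.IsAcyclic
      rw [h]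
      exact hF.2⟩
    (by
      have h := F.toSimpleGraphInclusive_flip
      change ∀ c : F.flip.coe.toSimpleGraphInclusive.ConnectedComponent,
        ∃! v : F.verts, v ∈ c.supp ∧ (v : V) ∈ S
      rw [h]
      exact hcomp)
    hin zone (fun i hi j hj hij => hR j hj i hi hij.symm) f₀ hdeg
  exact ⟨f, h1, h2, h3, fun u v huv => h4 v u huv⟩

theorem exists_glue {ι : Type*} (P : ι → Set V) (hP : Pairwise fun i j => Disjoint (P i) (P j))
    (g : ι → V → ℤ) : ∃ f : V → ℤ, ∀ i, ∀ v ∈ P i, f v = g i v := by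
  refine ⟨fun v => if h : ∃ i, v ∈ P i then g h.choose v else 0, fun i v hv => ?_⟩
  have h : ∃ i, v ∈ P i := ⟨i, hv⟩
  simp only [h, dite_true]
  have : h.choose = i := by
    by_contra hne
    exact Set.disjoint_left.1 (hP hne) h.choose_spec hv
  rw [this]

/-- Greedy choice: the entries of the lists chosen so far form the forbidden set `B`, which never
has more than `l * K` elements. -/
theorem exists_disjoint_lists {l K : ℕ} (Good : Fin l → List ℤ → Prop)
    (hlen : ∀ a c, Good a c → c.length ≤ K)
    (hex : ∀ a (B : Finset ℤ), #B ≤ l * K → ∃ c, Good a c ∧ ∀ z ∈ c, z ∉ B) :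
    ∃ c : Fin l → List ℤ, (∀ a, Good a (c a)) ∧ ∀ a a', a ≠ a' → ∀ z ∈ c a, z ∉ c a' := by
  have key : ∀ n : ℕ, n ≤ l → ∃ c : Fin l → List ℤ, (∀ a : Fin l, (a : ℕ) < n → Good a (c a)) ∧
      ∀ a a' : Fin l, (a : ℕ) < n → (a' : ℕ) < n → a ≠ a' → ∀ z ∈ c a, z ∉ c a' := by
    intro n
    induction n with
    | zero => exact fun _ => ⟨fun _ => [], by simp, by simp⟩
    | succ n ih =>
      intro hn
      obtain ⟨c, h1, h2⟩ := ih (by omega)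
      set B := (univ.filter fun a : Fin l => (a : ℕ) < n).biUnion fun a => (c a).toFinset with hB
      have hBc : #B ≤ l * K := by
        refine (card_biUnion_le_card_mul _ _ K fun a ha => ?_).trans
          (Nat.mul_le_mul_right _ ((card_le_univ _).trans (by simp)))
        exact (List.toFinset_card_le _).trans (hlen a _ (h1 a (by simpa using ha)))
      obtain ⟨c', hc', hc'B⟩ := hex ⟨n, hn⟩ B hBc
      have hold : ∀ a : Fin l, (a : ℕ) < n → Function.update c ⟨n, hn⟩ c' a = c a := by
        intro a ha
        refine Function.update_of_ne ?_ _ _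
        rintro rfl
        exact lt_irrefl _ ha
      have hnew : Function.update c ⟨n, hn⟩ c' ⟨n, hn⟩ = c' := Function.update_self _ _ _
      have hdis : ∀ a : Fin l, (a : ℕ) < n → ∀ z ∈ c', z ∉ c a := by
        intro a ha z hz hza
        refine hc'B z hz ?_
        rw [hB, mem_biUnion]
        exact ⟨a, by simpa using ha, by simpa using hza⟩
      refine ⟨Function.update c ⟨n, hn⟩ c', ?_, ?_⟩
      · intro a ha
        rcases Nat.lt_succ_iff_lt_or_eq.1 ha with h | h
        · rw [hold a h]
          exact h1 a h
        · obtain rfl : a = ⟨n, hn⟩ := Fin.ext h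
          rw [hnew]
          exact hc'
      · intro a a' ha ha' hne z hz
        rcases Nat.lt_succ_iff_lt_or_eq.1 ha with h | h <;>
          rcases Nat.lt_succ_iff_lt_or_eq.1 ha' with h' | h'
        · rw [hold a h] at hz
          rw [hold a' h']
          exact h2 a a' h h' hne z hz
        · obtain rfl : a' = ⟨n, hn⟩ := Fin.ext h'
          rw [hold a h] at hz
          rw [hnew]
          exact fun hz' => hdis a h z hz' hz
        · obtain rfl : a = ⟨n, hn⟩ := Fin.ext h
          rw [hnew] at hz
          rw [hold a' h']
          exact hdis a' h' z hz
        · exact absurd (Fin.ext (h.trans h'.symm)) hne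
  obtain ⟨c, h1, h2⟩ := key l le_rfl
  exact ⟨c, fun a => h1 a a.2, fun a a' => h2 a a' a.2 a'.2⟩

end ForestsInDigraphs

/-! ### Links through the regions between the cores -/

section Links

open scoped Classical

/-- The arrangement of the cores along a median order: the `i`-th core occupies `[a i, b i]`, and
consecutive cores are far apart. -/
structure IsArrangement (lo hi : ℤ) (r : ℕ) (M : ℤ) (a b : ℕ → ℤ) : Prop where
  lo_le : lo ≤ a 0
  le_hi : b r ≤ hi
  core : ∀ i ≤ r, a i ≤ b i ∧ b i ≤ a i + 2 * M
  gap : ∀ i < r, b i + 2000 * M ≤ a (i + 1)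
  large : 100 ≤ M

variable {R : ℤ → ℤ → Prop} {lo hi : ℤ} {r : ℕ} {M : ℤ} {a b : ℕ → ℤ}

theorem IsArrangement.lt (h : IsArrangement lo hi r M a b) {i j : ℕ} (hij : i < j) (hj : j ≤ r) :
    b i + 2000 * M ≤ a j := by
  have := h.large
  induction j with
  | zero => omega
  | succ j ih =>
    rcases Nat.lt_succ_iff_lt_or_eq.1 hij with h1 | rfl
    · have h2 := ih h1 (by omega)
      have h3 := h.gap j (by omega)
      have h4 := h.core j (by omega)
      omega
    · exact h.gap i (by omega)

theorem IsArrangement.lo_le_core (h : IsArrangement lo hi r M a b) {i : ℕ} (hi : i ≤ r) :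
    lo ≤ a i := by
  have := h.large
  have h0 := h.lo_le
  rcases Nat.eq_zero_or_pos i with rfl | hpos
  · exact h0
  · have := h.lt hpos hi
    have := h.core 0 (by omega)
    omega

theorem IsArrangement.core_le_hi (h : IsArrangement lo hi r M a b) {i : ℕ} (hi' : i ≤ r) :
    b i ≤ hi := by
  have := h.large
  have h0 := h.le_hi
  rcases hi'.eq_or_lt with rfl | hlt
  · exact h0
  · have := h.lt hlt le_rfl
    have := h.core r le_rfl
    omega

theorem IsArrangement.core_mono (h : IsArrangement lo hi r M a b) {i j : ℕ} (hij : i ≤ j)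
    (hj : j ≤ r) : a i ≤ a j := by
  have := h.large
  rcases hij.eq_or_lt with rfl | hlt
  · exact le_rfl
  · have := h.lt hlt hj
    have := h.core i (by omega)
    omega

theorem IsArrangement.region_unique (h : IsArrangement lo hi r M a b) {i j : ℕ} (hi' : i < r)
    (hj : j < r) {z : ℤ} (hz1 : b j < z) (hz2 : z < a (j + 1)) :
    (b i < z ∧ z < a (i + 1)) ↔ i = j := by
  constructor
  · rintro ⟨h1, h2⟩
    rcases lt_trichotomy i j with h3 | h3 | h3
    · have := h.core_mono (i := i + 1) (j := j) h3 (by omega)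
      have := h.core j (by omega)
      omega
    · exact h3
    · have := h.core_mono (i := j + 1) (j := i) h3 (by omega)
      have := h.core i (by omega)
      omega
  · rintro rfl
    exact ⟨hz1, hz2⟩

/-- The inner vertices of a link which leads from the `j`-th to the `j'`-th core and starts with `w`,
in the region behind the `j`-th core. -/
theorem IsArrangement.exists_link_from (h : IsArrangement lo hi r M a b) (hR : IsMedian R lo hi)
    (B : Finset ℤ) (hB : ∀ i < r, (#(B ∩ Ioo (b i) (a (i + 1))) : ℤ) ≤ 18 * M) {j' : ℕ}
    (hj' : j' ≤ r) {τ : ℤ} (hτ : τ ≤ hi) (hτ1 : a j' - 500 * M ≤ τ) (hτ2 : τ ≤ b j' + 40 * M)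
    (n : ℕ) : ∀ (j : ℕ) (w : ℤ), j' = j + n + 1 → b j + 8 * M ≤ w → w ≤ b j + 600 * M →
      ∃ c : List ℤ, ((w :: c) ++ [τ]).IsChain R ∧ (w :: c).Nodup ∧ (∀ z ∈ c, z ∉ B) ∧
        (∀ z ∈ w :: c, ∃ i, j ≤ i ∧ i < r ∧ b i + 8 * M ≤ z ∧ z ≤ a (i + 1) - 8 * M) ∧
        (w :: c).length = 3 * (j' - j) ∧
        ∀ i < r, (w :: c).countP (fun z => decide (b i < z ∧ z < a (i + 1))) =
          if j ≤ i ∧ i < j' then 3 else 0 := by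
  have hM := h.large
  induction n with
  | zero =>
    intro j w hj hw1 hw2
    rw [add_zero] at hj
    subst hj
    have hc := h.core (j + 1) hj'
    have hg := h.gap j (by omega)
    have hlo := h.lo_le_core (i := j) (by omega)
    have hcj := h.core j (by omega)
    -- The bound on `e` keeps the inner vertices out of the last `8M` positions of the region. The
    -- target may lie up to about `50M` beyond `e`, namely `8M`, a core of at most `2M`, and the
    -- forest zone up to `40M` behind it. A gap of `2000M` leaves enough room, even with `w` up to
    -- `600M` behind the core.
    obtain ⟨e, he1, he2, he3, he4⟩ : ∃ e, w < e ∧ e ≤ τ ∧ e ≤ a (j + 1) - 8 * M + 1 ∧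
        42 * (18 * M) + 9 * (τ - e) + 60 < e - w := by
      by_cases h1 : τ ≤ a (j + 1) - 8 * M + 1
      · exact ⟨τ, by omega, le_rfl, h1, by omega⟩
      · exact ⟨a (j + 1) - 8 * M + 1, by omega, by omega, le_rfl, by omega⟩
    have hBj := hB j (by omega)
    obtain ⟨p, q, ⟨hp1, hp2, hp3⟩, ⟨hq1, hq2, hq3⟩, hpq, hwp, hpqR, hqτ⟩ :=
      hR.exists_three_path (B ∩ Ioo (b j) (a (j + 1))) (u := w) (e := e) (w := τ) (by omega) he1 he2
        hτ (by omega)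
    have hp3' : p ∉ B := fun h1 => hp3 (mem_inter.2 ⟨h1, mem_Ioo.2 ⟨by omega, by omega⟩⟩)
    have hq3' : q ∉ B := fun h1 => hq3 (mem_inter.2 ⟨h1, mem_Ioo.2 ⟨by omega, by omega⟩⟩)
    refine ⟨[p, q], ?_, ?_, ?_, ?_, ?_, ?_⟩
    · simp [List.isChain_cons_cons, hwp, hpqR, hqτ]
    · simp only [List.nodup_cons, List.mem_cons, List.not_mem_nil, or_false, not_false_eq_true,
        List.nodup_nil, and_true, not_or]
      omega
    · simp only [List.mem_cons, List.not_mem_nil, or_false]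
      rintro z (rfl | rfl) <;> assumption
    · simp only [List.mem_cons, List.not_mem_nil, or_false]
      rintro z (rfl | rfl | rfl) <;> exact ⟨j, le_rfl, by omega, by omega, by omega⟩
    · simp only [List.length_cons, List.length_nil]
      omega
    · intro i hir
      have hcount : ∀ z, b j < z → z < a (j + 1) →
          (decide (b i < z ∧ z < a (i + 1)) = decide (i = j)) := fun z hz1 hz2 =>
        decide_eq_decide.2 (h.region_unique hir (by omega) hz1 hz2)
      simp only [List.countP_cons, List.countP_nil, hcount w (by omega) (by omega),
        hcount p (by omega) (by omega), hcount q (by omega) (by omega), decide_eq_true_eq]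
      by_cases hij : i = j
      · subst hij
        simp
      · rw [if_neg hij, if_neg (by omega)]
  | succ n ih =>
    intro j w hj hw1 hw2
    have hc := h.core (j + 1) (by omega)
    have hg := h.gap j (by omega)
    have hg' := h.gap (j + 1) (by omega)
    have hlo := h.lo_le_core (i := j) (by omega)
    have hhi := h.core_le_hi (i := j + 1 + 1) (by omega)
    have hc2 := h.core (j + 1 + 1) (by omega)
    have hcj := h.core j (by omega)
    have hBj := hB j (by omega)
    have hBj' := hB (j + 1) (by omega)
    -- Any free vertex soon behind the next core will do: there are more than `32M` candidates, of
    -- which at most `18M` are forbidden.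
    obtain ⟨w', hw', hw'B⟩ : ∃ w' ∈ Icc (b (j + 1) + 8 * M) (b (j + 1) + 40 * M),
        w' ∉ B ∩ Ioo (b (j + 1)) (a (j + 1 + 1)) := by
      refine exists_mem_notMem_of_card_lt_card ?_
      rw [Int.card_Icc]
      omega
    rw [mem_Icc] at hw'
    have hw'B' : w' ∉ B := fun h1 => hw'B (mem_inter.2 ⟨h1, mem_Ioo.2 ⟨by omega, by omega⟩⟩)
    obtain ⟨c, hc1, hc2, hc3, hc4, hc5, hc6⟩ := ih (j + 1) w' (by omega) hw'.1 (by omega)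
    obtain ⟨p, q, ⟨hp1, hp2, hp3⟩, ⟨hq1, hq2, hq3⟩, hpq, hwp, hpqR, hqw⟩ :=
      hR.exists_three_path (B ∩ Ioo (b j) (a (j + 1))) (u := w) (e := a (j + 1) - 8 * M + 1)
        (w := w') (by omega) (by omega) (by omega) (by omega) (by omega)
    have hp3' : p ∉ B := fun h1 => hp3 (mem_inter.2 ⟨h1, mem_Ioo.2 ⟨by omega, by omega⟩⟩)
    have hq3' : q ∉ B := fun h1 => hq3 (mem_inter.2 ⟨h1, mem_Ioo.2 ⟨by omega, by omega⟩⟩)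
    have hlarge : ∀ z ∈ w' :: c, a (j + 1) < z := by
      intro z hz
      obtain ⟨i, hi1, hi2, hi3, -⟩ := hc4 z hz
      have := h.core_mono hi1 (by omega)
      have := h.core i (by omega)
      omega
    refine ⟨p :: q :: w' :: c, ?_, ?_, ?_, ?_, ?_, ?_⟩
    · rw [List.cons_append, List.cons_append, List.cons_append, List.isChain_cons_cons,
        List.isChain_cons_cons]
      refine ⟨hwp, hpqR, ?_⟩
      rw [List.cons_append, List.isChain_cons_cons]
      exact ⟨hqw, hc1⟩
    · rw [List.nodup_cons, List.nodup_cons, List.nodup_cons]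
      refine ⟨?_, ?_, ?_, hc2⟩
      · rw [List.mem_cons, List.mem_cons]
        rintro (h1 | h1 | h1)
        · omega
        · omega
        · have := hlarge w h1
          omega
      · rw [List.mem_cons]
        rintro (h1 | h1)
        · exact hpq h1
        · have := hlarge p h1
          omega
      · intro h1
        have := hlarge q h1
        omega
    · intro z hz
      simp only [List.mem_cons] at hz
      rcases hz with rfl | rfl | rfl | hz
      · exact hp3'
      · exact hq3'
      · exact hw'B'
      · exact hc3 z hz
    · intro z hz
      rw [List.mem_cons, List.mem_cons, List.mem_cons] at hz
      rcases hz with rfl | rfl | rfl | hz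
      · exact ⟨j, le_rfl, by omega, by omega, by omega⟩
      · exact ⟨j, le_rfl, by omega, by omega, by omega⟩
      · exact ⟨j, le_rfl, by omega, by omega, by omega⟩
      · obtain ⟨i, h1, h2, h3⟩ := hc4 z hz
        exact ⟨i, by omega, h2, h3⟩
    · rw [List.length_cons, List.length_cons, List.length_cons, hc5]
      omega
    · intro i hir
      have hcount : ∀ z, b j < z → z < a (j + 1) →
          (decide (b i < z ∧ z < a (i + 1)) = decide (i = j)) := fun z hz1 hz2 =>
        decide_eq_decide.2 (h.region_unique hir (by omega) hz1 hz2)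
      rw [List.countP_cons, List.countP_cons, List.countP_cons, hc6 i hir,
        hcount w (by omega) (by omega), hcount p (by omega) (by omega),
        hcount q (by omega) (by omega)]
      by_cases hij : i = j
      · have h1 : ¬ (j + 1 ≤ i ∧ i < j') := by omega
        have h2 : j ≤ i ∧ i < j' := by omega
        simp only [decide_eq_true_eq, if_neg h1, if_pos h2, if_pos hij]
      · have h1 : (j ≤ i ∧ i < j') ↔ (j + 1 ≤ i ∧ i < j') := by omega
        simp only [decide_eq_true_eq, if_neg hij, h1, add_zero]

/-- The inner vertices of a link between two different cores. -/
theorem IsArrangement.exists_link (h : IsArrangement lo hi r M a b) (hR : IsMedian R lo hi)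
    (B : Finset ℤ) (hB : ∀ i < r, (#(B ∩ Ioo (b i) (a (i + 1))) : ℤ) ≤ 18 * M) {j j' : ℕ}
    (hjj' : j < j') (hj' : j' ≤ r) {σ τ : ℤ} (hσ : lo ≤ σ) (hσ1 : a j - 500 * M ≤ σ)
    (hσ2 : σ ≤ b j + 40 * M) (hτ : τ ≤ hi) (hτ1 : a j' - 500 * M ≤ τ)
    (hτ2 : τ ≤ b j' + 40 * M) :
    ∃ c : List ℤ, (σ :: (c ++ [τ])).IsChain R ∧ c.Nodup ∧ (∀ z ∈ c, z ∉ B) ∧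
      (∀ z ∈ c, ∃ i < r, b i + 8 * M ≤ z ∧ z ≤ a (i + 1) - 8 * M) ∧
      c.length = 3 * (j' - j) ∧
      ∀ i < r, c.countP (fun z => decide (b i < z ∧ z < a (i + 1))) =
        if j ≤ i ∧ i < j' then 3 else 0 := by
  have hM := h.large
  have hg := h.gap j (by omega)
  have hcj := h.core j (by omega)
  have hc1 := h.core (j + 1) (by omega)
  have hhi := h.core_le_hi (i := j + 1) (by omega)
  have hBj := hB j (by omega)
  obtain ⟨w, hw1, hw2, hσw, hwB⟩ : ∃ w, b j + 8 * M ≤ w ∧ w ≤ b j + 600 * M ∧ R σ w ∧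
      w ∉ B ∩ Ioo (b j) (a (j + 1)) := by
    -- The start may lie up to `500M` before its core. The window up to `600M` behind the core is
    -- long enough to guarantee an unforbidden out-neighbour even then.
    obtain ⟨s, hs1, hs2, hs3, hs4⟩ : ∃ s, σ < s ∧ b j + 8 * M ≤ s ∧ s ≤ b j + 600 * M + 1 ∧
        2 * (18 * M) + 2 * (s - 1 - σ) < b j + 600 * M - σ := by
      by_cases h1 : σ < b j + 8 * M
      · exact ⟨b j + 8 * M, h1, le_rfl, by omega, by omega⟩
      · exact ⟨σ + 1, by omega, by omega, by omega, by omega⟩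
    have h1 := hR.out_window (i := σ) (s := s) (t := b j + 600 * M) hσ hs1 hs3 (by omega)
    obtain ⟨w, hw, hwB⟩ := exists_mem_notMem_of_card_lt_card
      (s := B ∩ Ioo (b j) (a (j + 1))) (t := {y ∈ Icc s (b j + 600 * M) | R σ y}) (by omega)
    simp only [mem_filter, mem_Icc] at hw
    exact ⟨w, by omega, hw.1.2, hw.2, hwB⟩
  have hwB' : w ∉ B := fun h1 => hwB (mem_inter.2 ⟨h1, mem_Ioo.2 ⟨by omega, by omega⟩⟩)
  obtain ⟨c, h1, h2, h3, h4, h5, h6⟩ := h.exists_link_from hR B hB hj' hτ hτ1 hτ2 (j' - j - 1) j w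
    (by omega) hw1 hw2
  refine ⟨w :: c, ?_, h2, ?_, ?_, h5, h6⟩
  · rw [List.cons_append, List.isChain_cons_cons]
    exact ⟨hσw, h1⟩
  · intro z hz
    rcases List.mem_cons.1 hz with rfl | hz
    · exact hwB'
    · exact h3 z hz
  · intro z hz
    obtain ⟨i, -, h7, h8⟩ := h4 z hz
    exact ⟨i, h7, h8⟩

/-- The inner vertices of a link which leads to the end of a core from the region before it. -/
theorem IsArrangement.exists_short_link (h : IsArrangement lo hi r M a b) (hR : IsMedian R lo hi)
    (B : Finset ℤ) {j : ℕ} (hj : j < r) {σ : ℤ} (hσ1 : a (j + 1) - 500 * M ≤ σ)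
    (hσ2 : σ ≤ a (j + 1) - 220 * M)
    (hB : (#(B ∩ Ioo (a (j + 1) - 500 * M) (a (j + 1))) : ℤ) ≤ 2 * M) :
    ∃ c : List ℤ, (σ :: (c ++ [b (j + 1)])).IsChain R ∧ c.Nodup ∧ (∀ z ∈ c, z ∉ B) ∧
      (∀ z ∈ c, ∃ i < r, b i + 8 * M ≤ z ∧ z ≤ a (i + 1) - 8 * M) ∧ c.length = 2 ∧
      ∀ i < r, c.countP (fun z => decide (b i < z ∧ z < a (i + 1))) = if i = j then 2 else 0 := by
  have hM := h.large
  have hg := h.gap j (by omega)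
  have hcj := h.core j (by omega)
  have hc1 := h.core (j + 1) (by omega)
  have hlo := h.lo_le_core (i := j) (by omega)
  have hhi := h.core_le_hi (i := j + 1) (by omega)
  -- The three edges need about `174M` positions, `84M` for the forbidden set and `90M` for the
  -- distance from `e` to the target. This is why in-forests stay `220M` away from the core behind
  -- them.
  obtain ⟨p, q, ⟨hp1, hp2, hp3⟩, ⟨hq1, hq2, hq3⟩, hpq, hwp, hpqR, hqw⟩ :=
    hR.exists_three_path (B ∩ Ioo (a (j + 1) - 500 * M) (a (j + 1))) (u := σ)
      (e := a (j + 1) - 8 * M + 1) (w := b (j + 1)) (by omega) (by omega) (by omega) hhi (by omega)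
  have hp3' : p ∉ B := fun h1 => hp3 (mem_inter.2 ⟨h1, mem_Ioo.2 ⟨by omega, by omega⟩⟩)
  have hq3' : q ∉ B := fun h1 => hq3 (mem_inter.2 ⟨h1, mem_Ioo.2 ⟨by omega, by omega⟩⟩)
  refine ⟨[p, q], ?_, ?_, ?_, ?_, rfl, ?_⟩
  · simp [List.isChain_cons_cons, hwp, hpqR, hqw]
  · simpa using hpq
  · simp only [List.mem_cons, List.not_mem_nil, or_false]
    rintro z (rfl | rfl) <;> assumption
  · simp only [List.mem_cons, List.not_mem_nil, or_false]
    rintro z (rfl | rfl) <;> exact ⟨j, by omega, by omega, by omega⟩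
  · intro i hir
    have hcount : ∀ z, b j < z → z < a (j + 1) →
        (decide (b i < z ∧ z < a (i + 1)) = decide (i = j)) := fun z hz1 hz2 =>
      decide_eq_decide.2 (h.region_unique hir (by omega) hz1 hz2)
    rw [List.countP_cons, List.countP_cons, List.countP_nil, hcount p (by omega) (by omega),
      hcount q (by omega) (by omega)]
    by_cases hij : i = j
    · simp [hij]
    · simp [hij]

end Links

/-! ### Vertices and edges of directed paths -/

section DirectedPaths

variable {V : Type*}

theorem pair_infix_iff {l : List V} {u v : V} :
    [u, v] <:+: l ↔ ∃ i, ∃ h : i + 1 < l.length, l[i] = u ∧ l[i + 1] = v := by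
  constructor
  · rintro ⟨s, t, rfl⟩
    exact ⟨s.length, by simp, by simp, by simp⟩
  · rintro ⟨i, h, rfl, rfl⟩
    refine ⟨l.take i, l.drop (i + 2), ?_⟩
    have h1 : l.drop i = l[i] :: l.drop (i + 1) := List.drop_eq_getElem_cons (by omega)
    have h2 : l.drop (i + 1) = l[i + 1] :: l.drop (i + 2) := List.drop_eq_getElem_cons h
    conv_rhs => rw [← List.take_append_drop i l, h1, h2]
    simp

namespace DiPath

variable (p : DiPath V)

theorem length_pos : 0 < p.support.length := List.length_pos_of_ne_nil p.ne_nil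

theorem first_eq : p.first = p.support[0]'p.length_pos := List.head_eq_getElem _

theorem last_eq : p.last = p.support[p.support.length - 1]'(by have := p.length_pos; omega) :=
  List.getLast_eq_getElem _

theorem exists_adj_left {v : V} (hv : v ∈ p.support) (hne : v ≠ p.first) :
    ∃ u, p.toSub.Adj u v := by
  obtain ⟨i, hi, rfl⟩ := List.getElem_of_mem hv
  cases i with
  | zero => exact absurd p.first_eq.symm hne
  | succ i => exact ⟨p.support[i], pair_infix_iff.2 ⟨i, hi, rfl, rfl⟩⟩

theorem exists_adj_right {v : V} (hv : v ∈ p.support) (hne : v ≠ p.last) :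
    ∃ u, p.toSub.Adj v u := by
  obtain ⟨i, hi, rfl⟩ := List.getElem_of_mem hv
  by_cases h : i + 1 < p.support.length
  · exact ⟨p.support[i + 1], pair_infix_iff.2 ⟨i, h, rfl, rfl⟩⟩
  · refine absurd ?_ hne
    rw [p.last_eq]
    congr 1
    omega

theorem not_adj_first (u : V) : ¬ p.toSub.Adj u p.first := by
  intro h
  obtain ⟨i, hi, -, h2⟩ := pair_infix_iff.1 h
  rw [p.first_eq] at h2
  have := (p.nodup.getElem_inj_iff).1 h2
  omega

theorem not_adj_last (u : V) : ¬ p.toSub.Adj p.last u := by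
  intro h
  obtain ⟨i, hi, h2, -⟩ := pair_infix_iff.1 h
  rw [p.last_eq] at h2
  have := (p.nodup.getElem_inj_iff).1 h2
  omega

theorem first_ne_last (h : 0 < p.length) : p.first ≠ p.last := by
  intro h2
  rw [p.first_eq, p.last_eq] at h2
  have := (p.nodup.getElem_inj_iff).1 h2
  simp only [length] at h
  omega

/-- The inner vertices of a path. -/
def inner : Set V := p.toSub.verts \ {p.first, p.last}

theorem mem_inner {v : V} : v ∈ p.inner ↔ v ∈ p.support ∧ v ≠ p.first ∧ v ≠ p.last := by
  simp [inner, toSub, not_or]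

theorem ncard_support : ({v | v ∈ p.support} : Set V).ncard = p.length + 1 := by
  classical
  have h1 : ({v | v ∈ p.support} : Set V) = (p.support.toFinset : Set V) := by
    ext v
    simp
  have := p.length_pos
  rw [h1, Set.ncard_coe_finset, List.toFinset_card_of_nodup p.nodup, length]
  omega

theorem ncard_inner (h : 0 < p.length) : p.inner.ncard = p.length - 1 := by
  have h1 : p.inner = {v | v ∈ p.support} \ {p.first, p.last} := rfl
  rw [h1, Set.ncard_sdiff, p.ncard_support, Set.ncard_pair (p.first_ne_last h)]
  · omega
  · rintro v (rfl | rfl)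
    · exact p.head_mem
    · exact p.last_mem

end DiPath

end DirectedPaths

/-! ### The vertex partition and the edges of a good decomposition -/

namespace GoodDecomposition

open scoped Classical

variable {V : Type*} {r : ℕ} {m : ℝ} {D T : Digraph V} (g : GoodDecomposition r m D T)

/-- The `t`-th path in the partition `P₁ S₂ P₂ ⋯ S_r P_r`. -/
def seg (t : ℕ) : DiPath V := if t % 2 = 0 then g.segP (t / 2 + 1) else g.segS (t / 2 + 2)

theorem seg_even (i : ℕ) : g.seg (2 * i) = g.segP (i + 1) := by
  rw [seg, if_pos (by omega)]
  congr 1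
  omega

theorem seg_odd (i : ℕ) : g.seg (2 * i + 1) = g.segS (i + 2) := by
  rw [seg, if_neg (by omega)]
  congr 1
  omega

theorem segs_eq (n : ℕ) :
    g.segP 1 :: (List.range' 2 n).flatMap (fun i => [g.segS i, g.segP i]) =
      (List.range (2 * n + 1)).map g.seg := by
  induction n with
  | zero => simp [seg]
  | succ n ih =>
    have h1 : List.range (2 * (n + 1) + 1) = List.range (2 * n + 1) ++ [2 * n + 1, 2 * (n + 1)] := by
      rw [show 2 * (n + 1) + 1 = (2 * n + 1) + 1 + 1 by ring, List.range_succ,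
        List.range_succ (n := 2 * n + 1), List.append_assoc]
      rfl
    rw [List.range'_concat, List.flatMap_append, ← List.cons_append, ih, h1, List.map_append]
    simp only [List.map_cons, List.map_nil, List.flatMap_cons, List.flatMap_nil,
      List.append_nil, g.seg_odd n, g.seg_even (n + 1)]
    rw [one_mul, add_comm 2 n]

theorem mem_P_iff (v : V) : v ∈ g.P.support ↔ ∃ t ≤ 2 * (r - 1), v ∈ (g.seg t).support := by
  have h := g.partition_P.1
  rw [g.segs_eq] at h
  change v ∈ g.P.toSub.verts ↔ _
  rw [h]
  simp only [SubDigraph.iUnion, Set.mem_iUnion, DiPath.toSub, Set.mem_ofPred_eq]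
  constructor
  · rintro ⟨i, hi⟩
    have := i.2
    simp only [List.length_map, List.length_range] at this
    exact ⟨i, by omega, by simpa using hi⟩
  · rintro ⟨t, ht, hv⟩
    exact ⟨⟨t, by simpa using (by omega)⟩, by simpa using hv⟩

theorem adj_P_iff (u v : V) :
    g.P.toSub.Adj u v ↔ ∃ t ≤ 2 * (r - 1), (g.seg t).toSub.Adj u v := by
  have h := g.partition_P.1
  rw [g.segs_eq] at h
  rw [h]
  simp only [SubDigraph.iUnion]
  constructor
  · rintro ⟨i, hi⟩
    have := i.2
    simp only [List.length_map, List.length_range] at this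
    exact ⟨i, by omega, by simpa using hi⟩
  · rintro ⟨t, ht, hv⟩
    exact ⟨⟨t, by simpa using (by omega)⟩, by simpa using hv⟩

theorem seg_last {t : ℕ} (ht : t + 1 ≤ 2 * (r - 1)) : (g.seg t).last = (g.seg (t + 1)).first := by
  have h := g.partition_P.2.1
  rw [g.segs_eq] at h
  simpa using h ⟨t, by simpa using (by omega)⟩ ⟨t + 1, by simpa using (by omega)⟩ rfl

theorem eq_of_mem_segs {s t : ℕ} (hst : s < t) (ht : t ≤ 2 * (r - 1)) {v : V}
    (hs : v ∈ (g.seg s).support) (hv : v ∈ (g.seg t).support) :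
    v = (g.seg s).last ∧ v = (g.seg t).first := by
  have h := g.partition_P.2.2
  rw [g.segs_eq] at h
  simpa using h ⟨s, by simpa using (by omega)⟩ ⟨t, by simpa using (by omega)⟩ hst v
    (by simpa using hs) (by simpa using hv)

theorem segP_length_pos (hm : 0 < m) {i : ℕ} (hi : i < r) : 0 < (g.seg (2 * i)).length := by
  rw [g.seg_even]
  have := g.length_segP (i + 1) (by omega) (by omega)
  have h : (0 : ℝ) < (g.segP (i + 1)).length := by linarith
  exact_mod_cast h

/-- Otherwise the first vertex of `P₁` has a predecessor on `P`, and the edge between them lies in a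
later segment. That segment meets `P₁` at most in its last vertex, which differs from its first. -/
theorem first_seg_zero (hr : 1 ≤ r) (hm : 0 < m) : (g.seg 0).first = g.x := by
  by_contra hne
  rw [← g.P_first] at hne
  have hlen := g.segP_length_pos hm (i := 0) (by omega)
  obtain ⟨u, hu⟩ := g.P.exists_adj_left ((g.mem_P_iff _).2 ⟨0, by omega, (g.seg 0).head_mem⟩) hne
  obtain ⟨t, ht, hut⟩ := (g.adj_P_iff _ _).1 hu
  rcases Nat.eq_zero_or_pos t with rfl | hpos
  · exact (g.seg 0).not_adj_first u hut
  · exact (g.seg 0).first_ne_last hlen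
      (g.eq_of_mem_segs hpos ht (g.seg 0).head_mem ((g.seg t).toSub.right_mem hut)).1

theorem last_seg_last (hr : 1 ≤ r) (hm : 0 < m) : (g.seg (2 * (r - 1))).last = g.y := by
  by_contra hne
  rw [← g.P_last] at hne
  have hlen := g.segP_length_pos hm (i := r - 1) (by omega)
  obtain ⟨u, hu⟩ := g.P.exists_adj_right
    ((g.mem_P_iff _).2 ⟨_, le_rfl, (g.seg (2 * (r - 1))).last_mem⟩) hne
  obtain ⟨t, ht, hut⟩ := (g.adj_P_iff _ _).1 hu
  rcases ht.eq_or_lt with rfl | hlt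
  · exact (g.seg (2 * (r - 1))).not_adj_last u hut
  · exact (g.seg (2 * (r - 1))).first_ne_last hlen
      (g.eq_of_mem_segs hlt le_rfl ((g.seg t).toSub.left_mem hut)
        (g.seg (2 * (r - 1))).last_mem).2.symm

/-- The vertex set of the `i`-th core `S_{i+1}`, where `i ≤ r`. -/
def core (i : ℕ) : Set V := (g.S (i + 1)).verts

theorem core_zero : g.core 0 = g.inArb.verts := by
  rw [core, g.S_first]

theorem core_r : g.core r = g.outArb.verts := by
  rw [core, g.S_last]

theorem core_mid {i : ℕ} (hi : i + 1 < r) :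
    g.core (i + 1) = {v | v ∈ (g.seg (2 * i + 1)).support} := by
  rw [core, g.S_mid (i + 1 + 1) (by omega) (by omega), g.seg_odd]
  rfl

theorem x_mem_P : g.x ∈ g.P.support := by
  rw [← g.P_first]
  exact g.P.head_mem

theorem y_mem_P : g.y ∈ g.P.support := by
  rw [← g.P_last]
  exact g.P.last_mem

theorem x_mem_core : g.x ∈ g.core 0 := by
  rw [g.core_zero]
  exact g.isIn.2.1

theorem y_mem_core : g.y ∈ g.core r := by
  rw [g.core_r]
  exact g.isOut.2.1

theorem eq_x_of_mem {v : V} (h : v ∈ g.core 0) (hP : v ∈ g.P.support) : v = g.x := by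
  by_contra hne
  have h1 : Disjoint (g.part .inArb) (g.part .path) := g.part_disjoint (by simp)
  rw [g.part_inArb, g.part_path] at h1
  rw [g.core_zero] at h
  exact Set.disjoint_left.1 h1 ⟨h, hne⟩ hP

theorem eq_y_of_mem {v : V} (h : v ∈ g.core r) (hP : v ∈ g.P.support) : v = g.y := by
  by_contra hne
  have h1 : Disjoint (g.part .outArb) (g.part .path) := g.part_disjoint (by simp)
  rw [g.part_outArb, g.part_path] at h1
  rw [g.core_r] at h
  exact Set.disjoint_left.1 h1 ⟨h, hne⟩ hP

theorem first_mem_core (hr : 1 ≤ r) (hm : 0 < m) {i : ℕ} (hi : i < r) :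
    (g.seg (2 * i)).first ∈ g.core i := by
  cases i with
  | zero =>
    rw [Nat.mul_zero, g.first_seg_zero hr hm]
    exact g.x_mem_core
  | succ i =>
    rw [g.core_mid hi]
    have h := g.seg_last (t := 2 * i + 1) (by omega)
    rw [show 2 * (i + 1) = 2 * i + 1 + 1 by ring, ← h]
    exact (g.seg (2 * i + 1)).last_mem

theorem last_mem_core (hr : 1 ≤ r) (hm : 0 < m) {i : ℕ} (hi : i < r) :
    (g.seg (2 * i)).last ∈ g.core (i + 1) := by
  by_cases hi' : i + 1 < r
  · rw [g.core_mid hi']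
    have h := g.seg_last (t := 2 * i) (by omega)
    rw [h]
    exact (g.seg (2 * i + 1)).head_mem
  · obtain rfl : r = i + 1 := by omega
    have h := g.last_seg_last hr hm
    rw [show i + 1 - 1 = i by omega] at h
    rw [h]
    exact g.y_mem_core

theorem core_mid_subset {i : ℕ} (hi : i + 1 < r) : ∀ v ∈ g.core (i + 1), v ∈ g.P.support := by
  intro v hv
  rw [g.core_mid hi] at hv
  exact (g.mem_P_iff v).2 ⟨_, by omega, hv⟩

theorem x_notMem_seg (hr : 1 ≤ r) (hm : 0 < m) {t : ℕ} (ht : 0 < t) (ht' : t ≤ 2 * (r - 1)) :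
    g.x ∉ (g.seg t).support := by
  intro h
  rw [← g.first_seg_zero hr hm] at h
  exact (g.seg 0).first_ne_last (g.segP_length_pos hm (i := 0) (by omega))
    (g.eq_of_mem_segs ht ht' (g.seg 0).head_mem h).1

theorem y_notMem_seg (hr : 1 ≤ r) (hm : 0 < m) {t : ℕ} (ht : t < 2 * (r - 1)) :
    g.y ∉ (g.seg t).support := by
  intro h
  rw [← g.last_seg_last hr hm] at h
  exact (g.seg (2 * (r - 1))).first_ne_last (g.segP_length_pos hm (i := r - 1) (by omega))
    (g.eq_of_mem_segs ht le_rfl h (g.seg (2 * (r - 1))).last_mem).2.symm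

/-- Between two cores on `P` lies a path `P_i` of positive length. A common vertex would be both its
first and its last vertex. The two arborescences meet `P` only in their roots. -/
theorem disjoint_core (hr : 1 ≤ r) (hm : 0 < m) {i j : ℕ} (hij : i < j) (hj : j ≤ r) :
    Disjoint (g.core i) (g.core j) := by
  rw [Set.disjoint_left]
  intro v hvi hvj
  obtain ⟨j, rfl⟩ : ∃ j', j = j' + 1 := ⟨j - 1, by omega⟩
  by_cases hjr : j + 1 < r
  · have hvP := g.core_mid_subset hjr v hvj
    rw [g.core_mid hjr] at hvj
    cases i with
    | zero =>
      rw [g.eq_x_of_mem hvi hvP] at hvj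
      exact g.x_notMem_seg hr hm (by omega) (by omega) hvj
    | succ i =>
      rw [g.core_mid (by omega)] at hvi
      have h1 := g.eq_of_mem_segs (s := 2 * i + 1) (t := 2 * j + 1) (by omega) (by omega) hvi hvj
      have h2 := g.seg_last (t := 2 * i + 1) (by omega)
      rw [show 2 * i + 1 + 1 = 2 * (i + 1) by ring] at h2
      have h3 : v = (g.seg (2 * (i + 1))).first := h1.1.trans h2
      have h4 := g.eq_of_mem_segs (s := 2 * (i + 1)) (t := 2 * j + 1) (by omega) (by omega)
        (v := v) (by rw [h3]; exact (g.seg _).head_mem) hvj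
      exact (g.seg (2 * (i + 1))).first_ne_last (g.segP_length_pos hm (by omega))
        (h3.symm.trans h4.1)
  · obtain rfl : r = j + 1 := by omega
    cases i with
    | zero =>
      have h1 : Disjoint (g.part .inArb) (g.part .outArb) := g.part_disjoint (by simp)
      rw [g.part_inArb, g.part_outArb] at h1
      by_cases hvx : v = g.x
      · have h2 := g.eq_y_of_mem hvj (hvx ▸ g.x_mem_P)
        exact g.x_ne_y (hvx.symm.trans h2)
      · by_cases hvy : v = g.y
        · exact hvx (g.eq_x_of_mem hvi (hvy ▸ g.y_mem_P))
        · rw [g.core_zero] at hvi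
          rw [g.core_r] at hvj
          exact Set.disjoint_left.1 h1 ⟨hvi, hvx⟩ ⟨hvj, hvy⟩
    | succ i =>
      have hvP := g.core_mid_subset (by omega) v hvi
      rw [g.core_mid (by omega)] at hvi
      rw [g.eq_y_of_mem hvj hvP] at hvi
      exact g.y_notMem_seg hr hm (by omega) hvi

theorem disjoint_core_inner (hr : 1 ≤ r) (hm : 0 < m) {i j : ℕ} (hi : i ≤ r) (hj : j < r) :
    Disjoint (g.core i) (g.seg (2 * j)).inner := by
  rw [Set.disjoint_left]
  intro v hvi hvj
  rw [DiPath.mem_inner] at hvj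
  obtain ⟨hv, hv1, hv2⟩ := hvj
  have hvP : v ∈ g.P.support := (g.mem_P_iff v).2 ⟨2 * j, by omega, hv⟩
  cases i with
  | zero =>
    have hvx := g.eq_x_of_mem hvi hvP
    rcases Nat.eq_zero_or_pos j with rfl | hpos
    · exact hv1 (hvx.trans (g.first_seg_zero hr hm).symm)
    · rw [hvx] at hv
      exact g.x_notMem_seg hr hm (by omega) (by omega) hv
  | succ i =>
    by_cases hir : i + 1 < r
    · rw [g.core_mid hir] at hvi
      rcases lt_or_gt_of_ne (show 2 * i + 1 ≠ 2 * j by omega) with h | h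
      · exact hv1 (g.eq_of_mem_segs h (by omega) hvi hv).2
      · exact hv2 (g.eq_of_mem_segs h (by omega) hv hvi).1
    · obtain rfl : r = i + 1 := by omega
      have hvy := g.eq_y_of_mem hvi hvP
      rcases Nat.lt_or_ge j i with h | h
      · rw [hvy] at hv
        exact g.y_notMem_seg hr hm (by omega) hv
      · obtain rfl : j = i := by omega
        exact hv2 (hvy.trans (g.last_seg_last hr hm).symm)

theorem disjoint_inner {i j : ℕ} (hij : i < j) (hj : j < r) :
    Disjoint (g.seg (2 * i)).inner (g.seg (2 * j)).inner := by
  rw [Set.disjoint_left]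
  intro v hvi hvj
  rw [DiPath.mem_inner] at hvi hvj
  exact hvi.2.2 (g.eq_of_mem_segs (by omega) (by omega) hvi.1 hvj.1).1

/-- Without edges the components are single vertices, and each component contains a vertex of the
core. Hence `F₁⁻` and `F_{r+1}⁺` contribute no vertices of their own. -/
theorem subset_of_no_edges (d : Sign) {i : ℕ} (hi : 1 ≤ i) (hi' : i ≤ r + 1)
    (h : ∀ u v, ¬ (g.F d i).Adj u v) : (g.F d i).verts ⊆ (g.S i).verts := by
  intro v hv
  obtain ⟨s, ⟨hs1, hs2⟩, -⟩ := g.component_F d i hi hi'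
    ((g.F d i).coe.toSimpleGraphInclusive.connectedComponentMk ⟨v, hv⟩)
  rw [SimpleGraph.ConnectedComponent.mem_supp_iff] at hs1
  have h1 : (g.F d i).coe.toSimpleGraphInclusive = ⊥ := by
    ext a b
    simp only [Digraph.toSimpleGraphInclusive, SimpleGraph.fromRel_adj, SimpleGraph.bot_adj,
      iff_false]
    rintro ⟨-, h2 | h2⟩ <;> exact h _ _ h2
  have h2 := SimpleGraph.ConnectedComponent.exact hs1
  rw [h1, SimpleGraph.reachable_bot] at h2
  rw [h2] at hs2
  exact hs2

/-- Indices of the pieces of the vertex set: the cores and the inner parts of the paths `P_i`; the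
out-forests behind and the in-forests before the cores, and the links. -/
abbrev PieceIndex (r l : ℕ) : Type := (Fin (r + 1) ⊕ Fin r) ⊕ (Fin r ⊕ Fin r ⊕ Fin l)

/-- The part of the out-forest at the `i`-th core outside the core. -/
def outPart (i : ℕ) : Set V := (g.F .plus (i + 1)).verts \ (g.S (i + 1)).verts

/-- The part of the in-forest at the `(i + 1)`-st core outside the core. -/
def inPart (i : ℕ) : Set V := (g.F .minus (i + 2)).verts \ (g.S (i + 2)).verts

/-- The pieces of the vertex set. -/
def piece : PieceIndex r g.l → Set V :=
  Sum.elim (Sum.elim (fun i => g.core i) (fun i => (g.seg (2 * i)).inner))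
    (Sum.elim (fun i => g.outPart i) (Sum.elim (fun i => g.inPart i) (fun j => (g.Q j).inner)))

/-- The index in the vertex partition of a piece off the spine. -/
def partIndex : Fin r ⊕ Fin r ⊕ Fin g.l → PartIndex r g.l :=
  Sum.elim (fun i => .forest .plus (i + 1) ⟨by omega, by omega⟩)
    (Sum.elim (fun i => .forest .minus (i + 2) ⟨by omega, by omega⟩) (fun j => .link j))

theorem partIndex_injective : Function.Injective g.partIndex := by
  rintro (i | i | i) (j | j | j) h <;> simp [partIndex] at h <;> simp [Fin.ext_iff, h]

theorem piece_inr (s : Fin r ⊕ Fin r ⊕ Fin g.l) : g.piece (.inr s) = g.part (g.partIndex s) := by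
  rcases s with i | i | i
  · exact (g.part_forest _ _ _).symm
  · exact (g.part_forest _ _ _).symm
  · exact (g.part_link i).symm

theorem piece_inl_subset (s : Fin (r + 1) ⊕ Fin r) :
    g.piece (.inl s) ⊆ g.part .path ∪ g.part .inArb ∪ g.part .outArb := by
  rw [g.part_path, g.part_inArb, g.part_outArb]
  intro v hv
  rcases s with ⟨i, hi⟩ | ⟨i, hi⟩
  · change v ∈ g.core i at hv
    by_cases hP : v ∈ g.P.support
    · exact Or.inl (Or.inl hP)
    · rcases Nat.eq_zero_or_pos i with rfl | hpos
      · rw [g.core_zero] at hv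
        refine Or.inl (Or.inr ⟨hv, ?_⟩)
        rintro rfl
        exact hP g.x_mem_P
      · by_cases hir : i < r
        · obtain ⟨i, rfl⟩ : ∃ i', i = i' + 1 := ⟨i - 1, by omega⟩
          exact absurd (g.core_mid_subset hir v hv) hP
        · obtain rfl : i = r := by omega
          rw [g.core_r] at hv
          refine Or.inr ⟨hv, ?_⟩
          rintro rfl
          exact hP g.y_mem_P
  · change v ∈ (g.seg (2 * i)).inner at hv
    rw [DiPath.mem_inner] at hv
    exact Or.inl (Or.inl ((g.mem_P_iff v).2 ⟨2 * i, by omega, hv.1⟩))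

theorem piece_disjoint (hr : 1 ≤ r) (hm : 0 < m) :
    Pairwise fun a b => Disjoint (g.piece a) (g.piece b) := by
  have hmixed : ∀ s t, Disjoint (g.piece (.inl s)) (g.piece (.inr t)) := by
    intro s t
    rw [g.piece_inr]
    refine Set.disjoint_of_subset_left (g.piece_inl_subset s) ?_
    rw [Set.disjoint_union_left, Set.disjoint_union_left]
    refine ⟨⟨?_, ?_⟩, ?_⟩ <;> apply g.part_disjoint <;> rcases t with t | t | t <;>
      simp [partIndex]
  rintro ((⟨i, hi⟩ | ⟨i, hi⟩) | s) ((⟨j, hj⟩ | ⟨j, hj⟩) | t) hst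
  · have hne : i ≠ j := fun h => hst (by subst h; rfl)
    rcases lt_or_gt_of_ne hne with h | h
    · exact g.disjoint_core hr hm h (by omega)
    · exact (g.disjoint_core hr hm h (by omega)).symm
  · exact g.disjoint_core_inner hr hm (by omega) hj
  · exact hmixed _ _
  · exact (g.disjoint_core_inner hr hm (by omega) hi).symm
  · have hne : i ≠ j := fun h => hst (by subst h; rfl)
    rcases lt_or_gt_of_ne hne with h | h
    · exact g.disjoint_inner h (by omega)
    · exact (g.disjoint_inner h (by omega)).symm
  · exact hmixed _ _
  · exact (hmixed _ _).symm
  · exact (hmixed _ _).symm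
  · rw [g.piece_inr, g.piece_inr]
    exact g.part_disjoint fun h => hst (by rw [g.partIndex_injective h])

theorem piece_cover (hr : 1 ≤ r) (hm : 0 < m) (v : V) : ∃ s, v ∈ g.piece s := by
  have hv : v ∈ ⋃ a, g.part a := by
    rw [g.part_cover]
    trivial
  obtain ⟨a, ha⟩ := Set.mem_iUnion.1 hv
  rcases a with _ | ⟨d, i, hi⟩ | _ | _ | j
  · rw [g.part_path] at ha
    obtain ⟨t, ht, hvt⟩ := (g.mem_P_iff v).1 ha
    obtain ⟨i, rfl | rfl⟩ : ∃ i, t = 2 * i ∨ t = 2 * i + 1 := ⟨t / 2, by omega⟩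
    · by_cases h1 : v = (g.seg (2 * i)).first
      · exact ⟨.inl (.inl ⟨i, by omega⟩), h1 ▸ g.first_mem_core hr hm (by omega)⟩
      · by_cases h2 : v = (g.seg (2 * i)).last
        · exact ⟨.inl (.inl ⟨i + 1, by omega⟩), h2 ▸ g.last_mem_core hr hm (by omega)⟩
        · exact ⟨.inl (.inr ⟨i, by omega⟩), (DiPath.mem_inner _).2 ⟨hvt, h1, h2⟩⟩
    · refine ⟨.inl (.inl ⟨i + 1, by omega⟩), ?_⟩
      change v ∈ g.core (i + 1)
      rw [g.core_mid (by omega)]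
      exact hvt
  · rw [g.part_forest] at ha
    cases d with
    | plus =>
      by_cases hir : i ≤ r
      · obtain ⟨i, rfl⟩ : ∃ i', i = i' + 1 := ⟨i - 1, by omega⟩
        exact ⟨.inr (.inl ⟨i, by omega⟩), ha⟩
      · obtain rfl : i = r + 1 := by omega
        exact absurd (g.subset_of_no_edges .plus (by omega) le_rfl g.F_last ha.1) ha.2
    | minus =>
      by_cases hi1 : i = 1
      · subst hi1
        exact absurd (g.subset_of_no_edges .minus le_rfl (by omega) g.F_first ha.1) ha.2
      · obtain ⟨i, rfl⟩ : ∃ i', i = i' + 2 := ⟨i - 2, by omega⟩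
        exact ⟨.inr (.inr (.inl ⟨i, by omega⟩)), ha⟩
  · rw [g.part_inArb] at ha
    refine ⟨.inl (.inl ⟨0, by omega⟩), ?_⟩
    change v ∈ g.core 0
    rw [g.core_zero]
    exact ha.1
  · rw [g.part_outArb] at ha
    refine ⟨.inl (.inl ⟨r, by omega⟩), ?_⟩
    change v ∈ g.core r
    rw [g.core_r]
    exact ha.1
  · rw [g.part_link] at ha
    exact ⟨.inr (.inr (.inr j)), ha⟩

/-- The pieces partition the vertex set. The lengths of the intervals and gaps are tuned to this
exact count. -/
theorem card_eq_sum [Fintype V] (hr : 1 ≤ r) (hm : 0 < m) :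
    Fintype.card V = ∑ i ∈ range (r + 1), (g.core i).ncard +
      ∑ i ∈ range r, ((g.seg (2 * i)).inner.ncard + (g.outPart i).ncard + (g.inPart i).ncard) +
      ∑ j, (g.Q j).inner.ncard := by
  have h1 : Fintype.card V = ∑ s, (g.piece s).ncard := by
    rw [← card_univ]
    have h2 : (univ : Finset V) = univ.biUnion fun s => (g.piece s).toFinset := by
      ext v
      simpa using g.piece_cover hr hm v
    rw [h2, card_biUnion]
    · refine sum_congr rfl fun s _ => ?_
      rw [Set.ncard_eq_toFinset_card']
    · intro s _ t _ hst
      exact Set.disjoint_toFinset.2 (g.piece_disjoint hr hm hst)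
  rw [h1, Fintype.sum_sum_type, Fintype.sum_sum_type, Fintype.sum_sum_type, Fintype.sum_sum_type,
    sum_add_distrib, sum_add_distrib, ← Fin.sum_univ_eq_sum_range, ← Fin.sum_univ_eq_sum_range,
    ← Fin.sum_univ_eq_sum_range, ← Fin.sum_univ_eq_sum_range]
  simp only [piece, Sum.elim_inl, Sum.elim_inr]
  ring

theorem adj_cases (hr : 1 ≤ r) {u v : V} (h : T.Adj u v) :
    (g.inArb.Adj u v ∨ g.outArb.Adj u v ∨ ∃ i, i + 1 < r ∧ (g.seg (2 * i + 1)).toSub.Adj u v) ∨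
    (∃ i < r, (g.seg (2 * i)).toSub.Adj u v) ∨ (∃ i < r, (g.F .plus (i + 1)).Adj u v) ∨
    (∃ i < r, (g.F .minus (i + 2)).Adj u v) ∨ ∃ j, (g.Q j).toSub.Adj u v := by
  have h1 : (SubDigraph.ofDigraph D).Adj u v := g.T_sub.2 u v h
  rw [g.D_eq] at h1
  rcases h1 with (((h1 | h1) | h1) | ⟨⟨i, hi1, hi2⟩, h1⟩) | ⟨j, h1⟩
  · exact Or.inl (Or.inl h1)
  · obtain ⟨t, ht, h2⟩ := (g.adj_P_iff u v).1 h1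
    obtain ⟨i, rfl | rfl⟩ : ∃ i, t = 2 * i ∨ t = 2 * i + 1 := ⟨t / 2, by omega⟩
    · exact Or.inr (Or.inl ⟨i, by omega, h2⟩)
    · exact Or.inl (Or.inr (Or.inr ⟨i, by omega, h2⟩))
  · exact Or.inl (Or.inr (Or.inl h1))
  · rcases h1 with h1 | h1
    · by_cases h3 : i = 1
      · subst h3
        exact absurd h1 (g.F_first u v)
      · obtain ⟨i, rfl⟩ : ∃ i', i = i' + 2 := ⟨i - 2, by omega⟩
        exact Or.inr (Or.inr (Or.inr (Or.inl ⟨i, by omega, h1⟩)))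
    · by_cases h3 : i = r + 1
      · subst h3
        exact absurd h1 (g.F_last u v)
      · obtain ⟨i, rfl⟩ : ∃ i', i = i' + 1 := ⟨i - 1, by omega⟩
        exact Or.inr (Or.inr (Or.inl ⟨i, by omega, h1⟩))
  · exact Or.inr (Or.inr (Or.inr (Or.inr ⟨j, h1⟩)))

end GoodDecomposition

/-! ### Mapping a directed path onto a list of positions -/

section Transport

open scoped Classical

variable {V : Type*} {R : ℤ → ℤ → Prop}

theorem DiPath.exists_map (p : DiPath V) {h : List ℤ} (hlen : h.length = p.support.length)
    (hc : h.IsChain R) (hn : h.Nodup) :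
    ∃ f : V → ℤ, Set.InjOn f {v | v ∈ p.support} ∧ (∀ v ∈ p.support, f v ∈ h) ∧
      (∀ u v, p.toSub.Adj u v → R (f u) (f v)) ∧ h.head? = some (f p.first) ∧
      h.getLast? = some (f p.last) := by
  have hidx : ∀ v ∈ p.support, p.support.idxOf v < h.length := fun v hv => by
    rw [hlen]
    exact List.idxOf_lt_length_of_mem hv
  have hf : ∀ v ∈ p.support, ∀ hv' : p.support.idxOf v < h.length,
      h.getD (p.support.idxOf v) 0 = h[p.support.idxOf v] := fun v _ hv' =>
    List.getD_eq_getElem _ _ hv'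
  have hget : ∀ i (hi : i < p.support.length), h.getD (p.support.idxOf p.support[i]) 0 =
      h[i]'(by omega) := by
    intro i hi
    rw [hf _ (List.getElem_mem hi) (hidx _ (List.getElem_mem hi))]
    congr 1
    exact p.nodup.idxOf_getElem i hi
  have hpos := p.length_pos
  -- The default `0` is taken only off the path.
  refine ⟨fun v => h.getD (p.support.idxOf v) 0, ?_, ?_, ?_, ?_, ?_⟩
  · intro u hu v hv huv
    simp only [hf u hu (hidx u hu), hf v hv (hidx v hv)] at huv
    have := (hn.getElem_inj_iff).1 huv
    exact (List.idxOf_inj hu).1 this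
  · intro v hv
    simp only [hf v hv (hidx v hv)]
    exact List.getElem_mem _
  · intro u v huv
    obtain ⟨i, hi, rfl, rfl⟩ := pair_infix_iff.1 huv
    simp only [hget]
    exact List.isChain_iff_getElem.1 hc i (by omega)
  · rw [p.first_eq]
    beta_reduce
    rw [hget, List.head?_eq_getElem?, List.getElem?_eq_getElem]
  · rw [p.last_eq]
    beta_reduce
    rw [hget, List.getLast?_eq_getElem?,
      show h.length - 1 = p.support.length - 1 by omega, List.getElem?_eq_getElem]

end Transport

/-! ### Placing the cores and the forests -/

namespace GoodDecomposition

open scoped Classical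

variable {V : Type*} {r : ℕ} {m : ℝ} {D T : Digraph V} (g : GoodDecomposition r m D T)

/-- The number of inner vertices of the links to be placed in each region, for a link between two
different cores or a short link to the end of a core. -/
def IsProfile (prof : Fin g.l → ℕ → ℕ) : Prop :=
  ∀ a, ((∃ j j', j < j' ∧ j' ≤ r ∧
      (g.Q a).first ∈ (g.F .minus (j + 1)).verts ∪ (g.F .plus (j + 1)).verts ∧
      (g.Q a).last ∈ (g.F .minus (j' + 1)).verts ∪ (g.F .plus (j' + 1)).verts ∧
      (g.Q a).length = 3 * (j' - j) + 1 ∧ ∀ i, prof a i = if j ≤ i ∧ i < j' then 3 else 0) ∨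
    (∃ j, j + 1 < r ∧ (g.Q a).first ∈ g.inPart j ∧ (g.Q a).last = (g.seg (2 * j + 1)).last ∧
      (g.Q a).length = 3 ∧ ∀ i, prof a i = if i = j then 2 else 0))

theorem exists_isProfile : ∃ prof, g.IsProfile prof := by
  have h : ∀ a, ∃ pr : ℕ → ℕ, ((∃ j j', j < j' ∧ j' ≤ r ∧
      (g.Q a).first ∈ (g.F .minus (j + 1)).verts ∪ (g.F .plus (j + 1)).verts ∧
      (g.Q a).last ∈ (g.F .minus (j' + 1)).verts ∪ (g.F .plus (j' + 1)).verts ∧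
      (g.Q a).length = 3 * (j' - j) + 1 ∧ ∀ i, pr i = if j ≤ i ∧ i < j' then 3 else 0) ∨
    (∃ j, j + 1 < r ∧ (g.Q a).first ∈ g.inPart j ∧ (g.Q a).last = (g.seg (2 * j + 1)).last ∧
      (g.Q a).length = 3 ∧ ∀ i, pr i = if i = j then 2 else 0)) := by
    intro a
    rcases g.link_Q a with ⟨j, j', h1, h2, h3, h4, h5, h6⟩ | ⟨j, h1, h2, h3, h4, h5⟩
    · obtain ⟨j, rfl⟩ : ∃ i, j = i + 1 := ⟨j - 1, by omega⟩
      obtain ⟨j', rfl⟩ : ∃ i, j' = i + 1 := ⟨j' - 1, by omega⟩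
      exact ⟨_, Or.inl ⟨j, j', by omega, by omega, h4, h5, by omega, fun _ => rfl⟩⟩
    · obtain ⟨j, rfl⟩ : ∃ i, j = i + 2 := ⟨j - 2, by omega⟩
      refine ⟨_, Or.inr ⟨j, by omega, h3, ?_, h5, fun _ => rfl⟩⟩
      rw [g.seg_odd]
      exact h4
  choose prof hprof using h
  exact ⟨prof, hprof⟩

variable {g} in
theorem IsProfile.length_eq {prof : Fin g.l → ℕ → ℕ} (h : g.IsProfile prof) (a : Fin g.l) :
    0 < (g.Q a).length ∧ (g.Q a).length ≤ 3 * r + 1 ∧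
      ∑ i ∈ range r, prof a i = (g.Q a).inner.ncard := by
  rcases h a with ⟨j, j', h1, h2, -, -, h5, h6⟩ | ⟨j, h1, -, -, h4, h5⟩
  · refine ⟨by omega, by omega, ?_⟩
    rw [(g.Q a).ncard_inner (by omega), h5, sum_congr rfl fun i _ => h6 i, ← sum_filter, sum_const]
    have : {i ∈ range r | j ≤ i ∧ i < j'} = Ico j j' := by
      ext i
      simp only [mem_filter, mem_range, mem_Ico]
      omega
    rw [this, Nat.card_Ico]
    simp [mul_comm]
  · refine ⟨by omega, by omega, ?_⟩
    rw [(g.Q a).ncard_inner (by omega), h4, sum_congr rfl fun i _ => h5 i, sum_ite_eq',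
      if_pos (by simp; omega)]

/-- The edges inside the `i`-th core. -/
def CoreAdj (i : ℕ) (u v : V) : Prop :=
  (i = 0 ∧ g.inArb.Adj u v) ∨ (i = r ∧ g.outArb.Adj u v) ∨
    ∃ j, i = j + 1 ∧ j + 1 < r ∧ (g.seg (2 * j + 1)).toSub.Adj u v

theorem CoreAdj.mem {i : ℕ} {u v : V} (h : g.CoreAdj i u v) : u ∈ g.core i ∧ v ∈ g.core i := by
  rcases h with ⟨rfl, h⟩ | ⟨rfl, h⟩ | ⟨j, rfl, hj, h⟩
  · rw [g.core_zero]
    exact ⟨g.inArb.left_mem h, g.inArb.right_mem h⟩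
  · rw [g.core_r]
    exact ⟨g.outArb.left_mem h, g.outArb.right_mem h⟩
  · rw [g.core_mid hj]
    exact ⟨(g.seg _).toSub.left_mem h, (g.seg _).toSub.right_mem h⟩

/-- The intervals `[a i, b i]` have the right lengths for the cores and the gaps between them. -/
structure Fits (lo hi : ℤ) (M : ℕ) (a b : ℕ → ℤ) (prof : Fin g.l → ℕ → ℕ) : Prop where
  arr : IsArrangement lo hi r M a b
  order_le : ∀ d i, 1 ≤ i → i ≤ r + 1 → (g.F d i).order ≤ M
  sq_le : 6 * r * r ≤ M
  profile : g.IsProfile prof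
  first : b 0 - a 0 + 1 = g.inArb.order + g.inArb.inLeaves.ncard - 1
  last : b r - a r + 1 = g.outArb.order + g.outArb.outLeaves.ncard - 1
  mid : ∀ i, i + 1 < r → b (i + 1) - a (i + 1) + 1 = (g.core (i + 1)).ncard
  gap : ∀ i < r, a (i + 1) - b i - 1 = (g.seg (2 * i)).inner.ncard + (g.outPart i).ncard +
    (g.inPart i).ncard + ∑ j, prof j i

variable {g} {R : ℤ → ℤ → Prop} {lo hi : ℤ} {M : ℕ} {a b : ℕ → ℤ} {prof : Fin g.l → ℕ → ℕ}

/-- A middle core is mapped to a spanning path of its interval, with nothing deleted; the two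
arborescences are embedded greedily with the root at the inner end. So each `P_i` has to run from `b
i` to `a (i + 1)`. -/
theorem Fits.exists_core [Finite V] (h : g.Fits lo hi M a b prof) (hR : IsMedian R lo hi)
    (hr : 1 ≤ r) (hm : 0 < m) {i : ℕ} (hi : i ≤ r) :
    ∃ f : V → ℤ, Set.InjOn f (g.core i) ∧ (∀ v ∈ g.core i, a i ≤ f v ∧ f v ≤ b i) ∧
      (∀ u v, g.CoreAdj i u v → R (f u) (f v)) ∧ (i < r → f (g.seg (2 * i)).first = b i) ∧
      ∀ j, i = j + 1 → f (g.seg (2 * j)).last = a i := by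
  have hlo := h.arr.lo_le_core hi
  have hhi := h.arr.core_le_hi hi
  have hmed : IsMedian R (a i) (b i) := hR.mono hlo hhi
  rcases Nat.eq_zero_or_pos i with rfl | hpos
  · obtain ⟨f, h1, h2, h3, h4⟩ := g.isIn.exists_embedding g.two_le_inArb hmed h.first
    rw [← g.core_zero] at h1 h2
    refine ⟨f, h1, h2, ?_, ?_, ?_⟩
    · rintro u v (⟨-, huv⟩ | ⟨h5, -⟩ | ⟨j, h5, -⟩)
      · exact h4 u v huv
      · omega
      · omega
    · intro _
      rw [Nat.mul_zero, g.first_seg_zero hr hm, h3]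
    · intro j hj
      omega
  obtain ⟨j, rfl⟩ : ∃ j, i = j + 1 := ⟨i - 1, by omega⟩
  by_cases hir : j + 1 < r
  · obtain ⟨l, hl⟩ := hmed.exists_spanning_to_free (p := a (j + 1)) (e := b (j + 1)) (c := 1) le_rfl
      (h.arr.core _ hi).1 le_rfl ∅ (by simp) (by simp) (by simp)
    have hlen := hl.length_eq
    rw [sdiff_empty, Int.card_Icc] at hlen
    have hmid := h.mid j hir
    rw [g.core_mid hir, DiPath.ncard_support] at hmid
    have hpos := (g.seg (2 * j + 1)).length_pos
    obtain ⟨f, h1, h2, h3, h4, h5⟩ := (g.seg (2 * j + 1)).exists_map (h := l) (by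
      simp only [DiPath.length] at hmid
      omega) hl.chain hl.nodup
    rw [← g.core_mid hir] at h1
    refine ⟨f, h1, ?_, ?_, ?_, ?_⟩
    · intro v hv
      rw [g.core_mid hir] at hv
      have := (hl.mem_iff _).1 (h2 v hv)
      simpa using this
    · rintro u v (⟨h6, -⟩ | ⟨h6, -⟩ | ⟨j', h6, -, huv⟩)
      · omega
      · omega
      · obtain rfl : j' = j := by omega
        exact h3 u v huv
    · intro _
      rw [show 2 * (j + 1) = 2 * j + 1 + 1 by ring, ← g.seg_last (by omega)]
      rw [hl.last, Option.some.injEq] at h5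
      exact h5.symm
    · intro j' hj'
      obtain rfl : j' = j := by omega
      rw [g.seg_last (by omega)]
      rw [hl.head, Option.some.injEq] at h4
      exact h4.symm
  · obtain rfl : r = j + 1 := by omega
    obtain ⟨f, h1, h2, h3, h4⟩ := g.isOut.exists_embedding g.two_le_outArb hmed h.last
    rw [← g.core_r] at h1 h2
    refine ⟨f, h1, h2, ?_, ?_, ?_⟩
    · rintro u v (⟨h5, -⟩ | ⟨-, huv⟩ | ⟨j', h5, h6, -⟩)
      · omega
      · exact h4 u v huv
      · omega
    · exact fun h5 => absurd h5 (lt_irrefl _)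
    · intro j' hj'
      obtain rfl : j' = j := by omega
      have h5 := g.last_seg_last hr hm
      rw [show j' + 1 - 1 = j' by omega] at h5
      rw [h5, h3]

theorem Fits.ncard_le [Finite V] (h : g.Fits lo hi M a b prof) {i : ℕ} (hi : i < r) :
    (g.outPart i).ncard ≤ M ∧ (g.inPart i).ncard ≤ M :=
  ⟨(Set.ncard_le_ncard Set.sdiff_subset).trans (h.order_le .plus (i + 1) (by omega) (by omega)),
    (Set.ncard_le_ncard Set.sdiff_subset).trans (h.order_le .minus (i + 2) (by omega) (by omega))⟩

/-- The placement of the cores and of the forests attached to them. -/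
structure IsBase (g : GoodDecomposition r m D T) (R : ℤ → ℤ → Prop) (M : ℕ) (a b : ℕ → ℤ)
    (f : V → ℤ) : Prop where
  core_range : ∀ i ≤ r, ∀ v ∈ g.core i, a i ≤ f v ∧ f v ≤ b i
  out_range : ∀ i < r, ∀ v ∈ g.outPart i, b i + 8 * M ≤ f v ∧ f v ≤ b i + 40 * M
  in_range : ∀ i < r, ∀ v ∈ g.inPart i, a (i + 1) - 500 * M ≤ f v ∧ f v ≤ a (i + 1) - 220 * M
  core_inj : ∀ i ≤ r, Set.InjOn f (g.core i)
  out_inj : ∀ i < r, Set.InjOn f (g.outPart i)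
  in_inj : ∀ i < r, Set.InjOn f (g.inPart i)
  core_adj : ∀ i ≤ r, ∀ u v, g.CoreAdj i u v → R (f u) (f v)
  out_adj : ∀ i < r, ∀ u v, (g.F .plus (i + 1)).Adj u v → R (f u) (f v)
  in_adj : ∀ i < r, ∀ u v, (g.F .minus (i + 2)).Adj u v → R (f u) (f v)
  first : ∀ i < r, f (g.seg (2 * i)).first = b i
  last : ∀ i < r, f (g.seg (2 * i)).last = a (i + 1)

/-- A core spans at most `2M` positions, so each of its vertices has at least `11M` out-neighbours
in the zone from `8M` to `40M` behind it, and more than `5M` in-neighbours in the zone from `500M`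
to `220M` before it. The forests have at most `M` vertices. -/
theorem Fits.exists_base [Finite V] (h : g.Fits lo hi M a b prof) (hR : IsMedian R lo hi)
    (hr : 1 ≤ r) (hm : 0 < m) : ∃ f, IsBase g R M a b f := by
  have hM := h.arr.large
  have hcore : ∀ i : Fin (r + 1), ∃ f : V → ℤ, Set.InjOn f (g.core i) ∧
      (∀ v ∈ g.core i, a i ≤ f v ∧ f v ≤ b i) ∧
      (∀ u v, g.CoreAdj i u v → R (f u) (f v)) ∧
      ((i : ℕ) < r → f (g.seg (2 * i)).first = b i) ∧
      ∀ j, (i : ℕ) = j + 1 → f (g.seg (2 * j)).last = a i := fun i =>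
    h.exists_core hR hr hm (by omega)
  choose fc hc1 hc2 hc3 hc4 hc5 using hcore
  have hout : ∀ i : Fin r, ∃ f : V → ℤ, (∀ s ∈ g.core i, f s = fc i.castSucc s) ∧
      Set.InjOn f (g.outPart i) ∧
      (∀ v ∈ g.outPart i, f v ∈ Icc (b i + 8 * M) (b i + 40 * M)) ∧
      ∀ u v, (g.F .plus (i + 1)).Adj u v → R (f u) (f v) := by
    intro i
    have hlo := h.arr.lo_le_core (i := i) (by omega)
    have hhi := h.arr.core_le_hi (i := i + 1) (by omega)
    have hc := h.arr.core i (by omega)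
    have hc' := h.arr.core (i + 1) (by omega)
    have hg := h.arr.gap i i.2
    refine (g.F .plus (i + 1)).exists_extension_out (g.core i)
      (g.forest_F .plus (i + 1) (by omega) (by omega))
      (g.component_F .plus (i + 1) (by omega) (by omega))
      (g.nbrs_F .plus (i + 1) (by omega) (by omega)) _ ?_ _ ?_
    · intro s hs t ht hst
      rw [mem_Icc] at hs ht
      exact hR.tour s t (by omega) (by omega) (by omega) (by omega) hst
    · intro s hs
      have h1 := hc2 i.castSucc s hs
      simp only [Fin.val_castSucc] at h1
      have h2 := hR.out_window (i := fc i.castSucc s) (s := b i + 8 * M) (t := b i + 40 * M)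
        (by omega) (by omega) (by omega) (by omega)
      have h3 := h.order_le .plus (i + 1) (by omega) (by omega)
      omega
  choose fo ho1 ho2 ho3 ho4 using hout
  have hin : ∀ i : Fin r, ∃ f : V → ℤ, (∀ s ∈ g.core (i + 1), f s = fc i.succ s) ∧
      Set.InjOn f (g.inPart i) ∧
      (∀ v ∈ g.inPart i, f v ∈ Icc (a (i + 1) - 500 * M) (a (i + 1) - 220 * M)) ∧
      ∀ u v, (g.F .minus (i + 2)).Adj u v → R (f u) (f v) := by
    intro i
    have hlo := h.arr.lo_le_core (i := i) (by omega)
    have hhi := h.arr.core_le_hi (i := i + 1) (by omega)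
    have hc := h.arr.core i (by omega)
    have hc' := h.arr.core (i + 1) (by omega)
    have hg := h.arr.gap i i.2
    refine (g.F .minus (i + 2)).exists_extension_in (g.core (i + 1))
      (g.forest_F .minus (i + 2) (by omega) (by omega))
      (g.component_F .minus (i + 2) (by omega) (by omega))
      (g.nbrs_F .minus (i + 2) (by omega) (by omega)) _ ?_ _ ?_
    · intro s hs t ht hst
      rw [mem_Icc] at hs ht
      exact hR.tour s t (by omega) (by omega) (by omega) (by omega) hst
    · intro s hs
      have h1 := hc2 i.succ s hs
      simp only [Fin.val_succ] at h1
      have h2 := hR.in_window (j := fc i.succ s) (s := a (i + 1) - 500 * M)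
        (t := a (i + 1) - 220 * M) (by omega) (by omega) (by omega) (by omega)
      have h3 := h.order_le .minus (i + 2) (by omega) (by omega)
      omega
  choose fi hi1 hi2 hi3 hi4 using hin
  -- The values `0` are placeholders for the inner vertices of the paths `P_i` and of the links,
  -- which are placed later.
  obtain ⟨f, hf⟩ := exists_glue g.piece (g.piece_disjoint hr hm)
    (Sum.elim (Sum.elim fc (fun _ _ => 0)) (Sum.elim fo (Sum.elim fi (fun _ _ => 0))))
  have hfc : ∀ i (hi : i < r + 1), ∀ v ∈ g.core i, f v = fc ⟨i, hi⟩ v := fun i hi v hv =>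
    hf (.inl (.inl ⟨i, hi⟩)) v hv
  have hfo : ∀ i (hi : i < r), ∀ v ∈ (g.F .plus (i + 1)).verts, f v = fo ⟨i, hi⟩ v := by
    intro i hi v hv
    by_cases hvS : v ∈ g.core i
    · rw [hfc i (by omega) v hvS, ho1 ⟨i, hi⟩ v hvS]
      rfl
    · exact hf (.inr (.inl ⟨i, hi⟩)) v ⟨hv, hvS⟩
  have hfi : ∀ i (hi : i < r), ∀ v ∈ (g.F .minus (i + 2)).verts, f v = fi ⟨i, hi⟩ v := by
    intro i hi v hv
    by_cases hvS : v ∈ g.core (i + 1)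
    · rw [hfc (i + 1) (by omega) v hvS, hi1 ⟨i, hi⟩ v hvS]
      rfl
    · exact hf (.inr (.inr (.inl ⟨i, hi⟩))) v ⟨hv, hvS⟩
  refine ⟨f, ?_, ?_, ?_, ?_, ?_, ?_, ?_, ?_, ?_, ?_, ?_⟩
  · intro i hi v hv
    rw [hfc i (by omega) v hv]
    exact hc2 ⟨i, by omega⟩ v hv
  · intro i hi v hv
    rw [hfo i hi v hv.1]
    exact mem_Icc.1 (ho3 ⟨i, hi⟩ v hv)
  · intro i hi v hv
    rw [hfi i hi v hv.1]
    exact mem_Icc.1 (hi3 ⟨i, hi⟩ v hv)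
  · intro i hi u hu v hv huv
    rw [hfc i (by omega) u hu, hfc i (by omega) v hv] at huv
    exact hc1 ⟨i, by omega⟩ hu hv huv
  · intro i hi u hu v hv huv
    rw [hfo i hi u hu.1, hfo i hi v hv.1] at huv
    exact ho2 ⟨i, by omega⟩ hu hv huv
  · intro i hi u hu v hv huv
    rw [hfi i hi u hu.1, hfi i hi v hv.1] at huv
    exact hi2 ⟨i, by omega⟩ hu hv huv
  · intro i hi u v huv
    have := huv.mem
    rw [hfc i (by omega) u this.1, hfc i (by omega) v this.2]
    exact hc3 ⟨i, by omega⟩ u v huv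
  · intro i hi u v huv
    rw [hfo i hi u ((g.F _ _).left_mem huv), hfo i hi v ((g.F _ _).right_mem huv)]
    exact ho4 ⟨i, hi⟩ u v huv
  · intro i hi u v huv
    rw [hfi i hi u ((g.F _ _).left_mem huv), hfi i hi v ((g.F _ _).right_mem huv)]
    exact hi4 ⟨i, hi⟩ u v huv
  · intro i hi
    rw [hfc i (by omega) _ (g.first_mem_core hr hm hi)]
    exact hc4 ⟨i, by omega⟩ hi
  · intro i hi
    rw [hfc (i + 1) (by omega) _ (g.last_mem_core hr hm hi)]
    exact hc5 ⟨i + 1, by omega⟩ i rfl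

end GoodDecomposition

/-! ### Placing the links -/

namespace GoodDecomposition

open scoped Classical

variable {V : Type*} {r : ℕ} {m : ℝ} {D T : Digraph V} {g : GoodDecomposition r m D T}
  {R : ℤ → ℤ → Prop} {lo hi : ℤ} {M : ℕ} {a b : ℕ → ℤ} {prof : Fin g.l → ℕ → ℕ} {f : V → ℤ}

theorem _root_.TreesInTournaments.IsArrangement.core_outside {N : ℤ}
    (h : IsArrangement lo hi r N a b) {i j : ℕ} (hi' : i ≤ r) (hj : j < r) {z : ℤ} (h1 : a i ≤ z)
    (h2 : z ≤ b i) (h3 : b j < z) : a (j + 1) ≤ z := by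
  have hM := h.large
  rcases Nat.lt_or_ge j i with hij | hij
  · have h4 := h.lt (i := j) (j := i) hij hi'
    by_cases h5 : j + 1 = i
    · subst h5
      exact h1
    · have h6 := h.lt (i := j + 1) (j := i) (by omega) hi'
      have h7 := h.core (j + 1) (by omega)
      omega
  · rcases hij.eq_or_lt with rfl | hlt
    · omega
    · have h4 := h.lt hlt hj.le
      have h5 := h.core j hj.le
      omega

/-- The vertices which lie in a core or in a forest attached to it. -/
def base (g : GoodDecomposition r m D T) : Set V :=
  {v | (∃ i ≤ r, v ∈ g.core i) ∨ (∃ i < r, v ∈ g.outPart i) ∨ ∃ i < r, v ∈ g.inPart i}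

theorem mem_base_of_mem_forests {j : ℕ} (hj : j ≤ r) {v : V}
    (hv : v ∈ (g.F .minus (j + 1)).verts ∪ (g.F .plus (j + 1)).verts) :
    v ∈ g.core j ∨ (∃ i, j = i + 1 ∧ v ∈ g.inPart i) ∨ (j < r ∧ v ∈ g.outPart j) := by
  by_cases hc : v ∈ g.core j
  · exact Or.inl hc
  rcases hv with hv | hv
  · cases j with
    | zero => exact absurd (g.subset_of_no_edges .minus le_rfl (by omega) g.F_first hv) hc
    | succ j => exact Or.inr (Or.inl ⟨j, rfl, hv, hc⟩)
  · rcases hj.eq_or_lt with rfl | hlt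
    · exact absurd (g.subset_of_no_edges .plus (by omega) le_rfl g.F_last hv) hc
    · exact Or.inr (Or.inr ⟨hlt, hv, hc⟩)

theorem IsBase.position (hb : IsBase g R M a b f) (h : IsArrangement lo hi r M a b) {j : ℕ}
    (hj : j ≤ r) {v : V} (hv : v ∈ (g.F .minus (j + 1)).verts ∪ (g.F .plus (j + 1)).verts) :
    v ∈ g.base ∧ lo ≤ f v ∧ f v ≤ hi ∧ a j - 500 * M ≤ f v ∧ f v ≤ b j + 40 * M := by
  have hM := h.large
  have hc := h.core j hj
  have hlo := h.lo_le_core hj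
  have hhi := h.core_le_hi hj
  obtain hv' := mem_base_of_mem_forests hj hv
  clear hv
  rcases hv' with hv | ⟨i, rfl, hv⟩ | ⟨hjr, hv⟩
  · have := hb.core_range j hj v hv
    exact ⟨Or.inl ⟨j, hj, hv⟩, by omega, by omega, by omega, by omega⟩
  · have := hb.in_range i (by omega) v hv
    have hg := h.gap i (by omega)
    have hlo := h.lo_le_core (i := i) (by omega)
    have hc := h.core i (by omega)
    exact ⟨Or.inr (Or.inr ⟨i, by omega, hv⟩), by omega, by omega, by omega, by omega⟩
  · have := hb.out_range j hjr v hv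
    have hg := h.gap j hjr
    have hhi := h.core_le_hi (i := j + 1) (by omega)
    have hc := h.core (j + 1) (by omega)
    exact ⟨Or.inr (Or.inl ⟨j, hjr, hv⟩), by omega, by omega, by omega, by omega⟩

theorem IsBase.injOn (hb : IsBase g R M a b f) (h : IsArrangement lo hi r M a b) :
    Set.InjOn f g.base := by
  have hM := h.large
  have core_region : ∀ i ≤ r, ∀ j < r, ∀ u ∈ g.core i, ∀ v, b j < f v → f v < a (j + 1) →
      f u ≠ f v := by
    intro i hi j hj u hu v h1 h2 huv
    have h3 := hb.core_range i hi u hu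
    have := h.core_outside hi hj h3.1 h3.2 (huv ▸ h1)
    omega
  have out_region : ∀ i < r, ∀ v ∈ g.outPart i, b i < f v ∧ f v < a (i + 1) := by
    intro i hi v hv
    have := hb.out_range i hi v hv
    have := h.gap i hi
    omega
  have in_region : ∀ i < r, ∀ v ∈ g.inPart i, b i < f v ∧ f v < a (i + 1) := by
    intro i hi v hv
    have := hb.in_range i hi v hv
    have := h.gap i hi
    omega
  have out_in : ∀ i < r, ∀ j < r, ∀ u ∈ g.outPart i, ∀ v ∈ g.inPart j, f u ≠ f v := by
    intro i hi j hj u hu v hv huv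
    have h1 := out_region i hi u hu
    have h2 := in_region j hj v hv
    obtain rfl := (h.region_unique hi hj h2.1 h2.2).1 (huv ▸ h1)
    have := hb.out_range i hi u hu
    have := hb.in_range i hi v hv
    have := h.gap i hi
    omega
  rintro u (⟨i, hi, hu⟩ | ⟨i, hi, hu⟩ | ⟨i, hi, hu⟩) v
    (⟨j, hj, hv⟩ | ⟨j, hj, hv⟩ | ⟨j, hj, hv⟩) huv
  · have h1 := hb.core_range i hi u hu
    have h2 := hb.core_range j hj v hv
    rcases lt_trichotomy i j with hij | rfl | hij
    · have := h.lt hij hj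
      omega
    · exact hb.core_inj i hi hu hv huv
    · have := h.lt hij hi
      omega
  · have h2 := out_region j hj v hv
    exact absurd huv (core_region i hi j hj u hu v h2.1 h2.2)
  · have h2 := in_region j hj v hv
    exact absurd huv (core_region i hi j hj u hu v h2.1 h2.2)
  · have h2 := out_region i hi u hu
    exact absurd huv.symm (core_region j hj i hi v hv u h2.1 h2.2)
  · have h1 := out_region i hi u hu
    have h2 := out_region j hj v hv
    obtain rfl := (h.region_unique hi hj h2.1 h2.2).1 (huv ▸ h1)
    exact hb.out_inj i hi hu hv huv
  · exact absurd huv (out_in i hi j hj u hu v hv)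
  · have h2 := in_region i hi u hu
    exact absurd huv.symm (core_region j hj i hi v hv u h2.1 h2.2)
  · exact absurd huv.symm (out_in j hj i hi v hv u hu)
  · have h1 := in_region i hi u hu
    have h2 := in_region j hj v hv
    obtain rfl := (h.region_unique hi hj h2.1 h2.2).1 (huv ▸ h1)
    exact hb.in_inj i hi hu hv huv

theorem Fits.link_ends (h : g.Fits lo hi M a b prof) (hb : IsBase g R M a b f) (hr : 1 ≤ r)
    (hm : 0 < m) (e : Fin g.l) : (g.Q e).first ∈ g.base ∧ (g.Q e).last ∈ g.base := by
  rcases h.profile e with ⟨j, j', h1, h2, h3, h4, -, -⟩ | ⟨j, h1, h2, h3, -, -⟩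
  · exact ⟨(hb.position h.arr (by omega) h3).1, (hb.position h.arr h2 h4).1⟩
  · refine ⟨Or.inr (Or.inr ⟨j, by omega, h2⟩), Or.inl ⟨j + 1, by omega, ?_⟩⟩
    rw [h3, g.seg_last (by omega)]
    exact g.first_mem_core hr hm (i := j + 1) h1

/-- The lists `c e` of the positions of the inner vertices of the links. -/
structure IsLinking (g : GoodDecomposition r m D T) (R : ℤ → ℤ → Prop) (M : ℕ) (a b : ℕ → ℤ)
    (prof : Fin g.l → ℕ → ℕ) (f : V → ℤ) (c : Fin g.l → List ℤ) : Prop where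
  chain : ∀ e, (f (g.Q e).first :: (c e ++ [f (g.Q e).last])).IsChain R
  nodup : ∀ e, (c e).Nodup
  notMem_out : ∀ e, ∀ z ∈ c e, ∀ i < r, z ∉ f '' g.outPart i
  notMem_in : ∀ e, ∀ z ∈ c e, ∀ i < r, z ∉ f '' g.inPart i
  middle : ∀ e, ∀ z ∈ c e, ∀ i < r, b i + 993 * M ≤ z → b i + 1007 * M < z
  region : ∀ e, ∀ z ∈ c e, ∃ i < r, b i + 8 * M ≤ z ∧ z ≤ a (i + 1) - 8 * M
  length : ∀ e, (c e).length = (g.Q e).inner.ncard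
  count : ∀ e, ∀ i < r, (c e).countP (fun z => decide (b i < z ∧ z < a (i + 1))) = prof e i
  disjoint : ∀ e e', e ≠ e' → ∀ z ∈ c e, z ∉ c e'

theorem Fits.exists_linking [Finite V] (h : g.Fits lo hi M a b prof) (hR : IsMedian R lo hi)
    (hb : IsBase g R M a b f) : ∃ c, IsLinking g R M a b prof f c := by
  have hM := h.arr.large
  set O : ℕ → Finset ℤ := fun i => (Set.toFinite (f '' g.outPart i)).toFinset with hO
  set I : ℕ → Finset ℤ := fun i => (Set.toFinite (f '' g.inPart i)).toFinset with hI
  -- Besides the forest vertices, a stretch of `14M + 1` positions around `b i + 1000M` is kept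
  -- clear of links; the spanning path for `P_i` needs it free of deletions.
  set B₀ : Finset ℤ := (range r).biUnion fun i =>
    O i ∪ I i ∪ Icc (b i + 993 * M) (b i + 1007 * M) with hB₀
  have hOc : ∀ i < r, #(O i) ≤ M := fun i hi => by
    rw [hO, ← Set.ncard_eq_toFinset_card _ (Set.toFinite _)]
    exact (Set.ncard_image_le (Set.toFinite _)).trans (h.ncard_le hi).1
  have hIc : ∀ i < r, #(I i) ≤ M := fun i hi => by
    rw [hI, ← Set.ncard_eq_toFinset_card _ (Set.toFinite _)]
    exact (Set.ncard_image_le (Set.toFinite _)).trans (h.ncard_le hi).2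
  have hOr : ∀ i < r, ∀ z ∈ O i, b i + 8 * M ≤ z ∧ z ≤ b i + 40 * M := by
    intro i hi z hz
    obtain ⟨v, hv, rfl⟩ := (Set.Finite.mem_toFinset _).1 hz
    exact hb.out_range i hi v hv
  have hIr : ∀ i < r, ∀ z ∈ I i, a (i + 1) - 500 * M ≤ z ∧ z ≤ a (i + 1) - 220 * M := by
    intro i hi z hz
    obtain ⟨v, hv, rfl⟩ := (Set.Finite.mem_toFinset _).1 hz
    exact hb.in_range i hi v hv
  have hB₀mem : ∀ z, z ∈ B₀ → ∀ i < r, b i < z → z < a (i + 1) →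
      z ∈ O i ∨ z ∈ I i ∨ z ∈ Icc (b i + 993 * (M : ℤ)) (b i + 1007 * M) := by
    intro z hz i hi h1 h2
    obtain ⟨j, hj, hz⟩ := mem_biUnion.1 hz
    rw [mem_range] at hj
    have hg := h.arr.gap j hj
    rw [mem_union, mem_union, or_assoc] at hz
    have h3 : b j < z ∧ z < a (j + 1) := by
      rcases hz with hz | hz | hz
      · have := hOr j hj z hz
        omega
      · have := hIr j hj z hz
        omega
      · rw [mem_Icc] at hz
        omega
    obtain rfl := (h.arr.region_unique hj hi h1 h2).1 h3
    exact hz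
  -- At most `2r` links with at most `3r` inner vertices each occupy at most `6r² ≤ M` positions.
  -- With two forest parts of size at most `M` and the reserved stretch, this stays below `18M` in
  -- every region.
  have key := exists_disjoint_lists (l := g.l) (K := 3 * r)
    (fun e c => (f (g.Q e).first :: (c ++ [f (g.Q e).last])).IsChain R ∧ c.Nodup ∧
      (∀ z ∈ c, z ∉ B₀) ∧ (∀ z ∈ c, ∃ i < r, b i + 8 * M ≤ z ∧ z ≤ a (i + 1) - 8 * M) ∧
      c.length = (g.Q e).inner.ncard ∧
      ∀ i < r, c.countP (fun z => decide (b i < z ∧ z < a (i + 1))) = prof e i) ?_ ?_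
  · obtain ⟨c, hc, hdisj⟩ := key
    have hnot : ∀ e, ∀ z ∈ c e, ∀ i < r, z ∉ O i ∧ z ∉ I i ∧
        z ∉ Icc (b i + 993 * (M : ℤ)) (b i + 1007 * M) := by
      intro e z hz i hi
      have h1 := (hc e).2.2.1 z hz
      simp only [hB₀, mem_biUnion, mem_range, not_exists, not_and, mem_union, not_or] at h1
      exact and_assoc.1 (h1 i hi)
    refine ⟨c, fun e => (hc e).1, fun e => (hc e).2.1, ?_, ?_, ?_, fun e => (hc e).2.2.2.1,
      fun e => (hc e).2.2.2.2.1, fun e => (hc e).2.2.2.2.2, hdisj⟩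
    · intro e z hz i hi hzO
      exact (hnot e z hz i hi).1 ((Set.Finite.mem_toFinset _).2 hzO)
    · intro e z hz i hi hzI
      exact (hnot e z hz i hi).2.1 ((Set.Finite.mem_toFinset _).2 hzI)
    · intro e z hz i hi h1
      by_contra h2
      exact (hnot e z hz i hi).2.2 (mem_Icc.2 ⟨h1, by omega⟩)
  · rintro e c ⟨-, -, -, -, h1, -⟩
    obtain ⟨h2, h3, -⟩ := h.profile.length_eq e
    rw [h1, (g.Q e).ncard_inner h2]
    omega
  · intro e B hB
    have hBM : #B ≤ M := by
      have h1 := Nat.mul_le_mul_right (3 * r) g.l_le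
      have h2 := h.sq_le
      have h3 : 2 * r * (3 * r) = 6 * r * r := by ring
      omega
    obtain ⟨hpos, -, -⟩ := h.profile.length_eq e
    rcases h.profile e with ⟨j, j', h1, h2, h3, h4, h5, h6⟩ | ⟨j, h1, h2, h3, h4, h5⟩
    · obtain ⟨-, p1, -, p2, p3⟩ := hb.position h.arr (by omega) h3
      obtain ⟨-, -, q1, q2, q3⟩ := hb.position h.arr h2 h4
      obtain ⟨c, c1, c2, c3, c4, c5, c6⟩ := h.arr.exists_link hR (B₀ ∪ B) (by
        intro i hi
        have hsub : (B₀ ∪ B) ∩ Ioo (b i) (a (i + 1)) ⊆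
            (O i ∪ I i) ∪ (Icc (b i + 993 * (M : ℤ)) (b i + 1007 * M) ∪ B) := by
          intro z hz
          simp only [mem_inter, mem_union, mem_Ioo] at hz ⊢
          rcases hz with ⟨hz | hz, hz1, hz2⟩
          · rcases hB₀mem z hz i hi hz1 hz2 with h7 | h7 | h7 <;> tauto
          · tauto
        have h7 := card_le_card hsub
        have h8 := card_union_le (O i ∪ I i) (Icc (b i + 993 * (M : ℤ)) (b i + 1007 * M) ∪ B)
        have h9 := card_union_le (O i) (I i)
        have h10 := card_union_le (Icc (b i + 993 * (M : ℤ)) (b i + 1007 * M)) B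
        have h11 := hOc i hi
        have h12 := hIc i hi
        rw [Int.card_Icc] at h10
        omega) h1 h2 p1 p2 p3 q1 q2 q3
      refine ⟨c, ⟨c1, c2, fun z hz h7 => c3 z hz (mem_union_left _ h7), c4, ?_, ?_⟩,
        fun z hz h7 => c3 z hz (mem_union_right _ h7)⟩
      · rw [c5, (g.Q e).ncard_inner hpos, h5]
        omega
      · intro i hi
        rw [c6 i hi, h6]
    · have hj := hb.in_range j (by omega) _ h2
      have hg := h.arr.gap j (by omega)
      obtain ⟨c, c1, c2, c3, c4, c5, c6⟩ := h.arr.exists_short_link hR (B₀ ∪ B) (j := j) (by omega)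
        hj.1 hj.2 (by
        have hsub : (B₀ ∪ B) ∩ Ioo (a (j + 1) - 500 * M) (a (j + 1)) ⊆ I j ∪ B := by
          intro z hz
          simp only [mem_inter, mem_union, mem_Ioo] at hz ⊢
          rcases hz with ⟨hz | hz, hz1, hz2⟩
          · rcases hB₀mem z hz j (by omega) (by omega) hz2 with h7 | h7 | h7
            · have := hOr j (by omega) z h7
              omega
            · exact Or.inl h7
            · rw [mem_Icc] at h7
              omega
          · exact Or.inr hz
        have h7 := card_le_card hsub
        have h8 := card_union_le (I j) B
        have h9 := hIc j (by omega)
        omega)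
      have hlast : f (g.Q e).last = b (j + 1) := by
        rw [h3, g.seg_last (by omega)]
        exact hb.first (j + 1) h1
      rw [← hlast] at c1
      refine ⟨c, ⟨c1, c2, fun z hz h7 => c3 z hz (mem_union_left _ h7), c4, ?_, ?_⟩,
        fun z hz h7 => c3 z hz (mem_union_right _ h7)⟩
      · rw [c5, (g.Q e).ncard_inner hpos, h4]
      · intro i hi
        rw [c6 i hi, h5]

end GoodDecomposition

/-! ### Placing the paths between the cores and assembling the embedding -/

namespace GoodDecomposition

open scoped Classical

variable {V : Type*} {r : ℕ} {m : ℝ} {D T : Digraph V} {g : GoodDecomposition r m D T}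
  {R : ℤ → ℤ → Prop} {lo hi : ℤ} {M : ℕ} {a b : ℕ → ℤ} {prof : Fin g.l → ℕ → ℕ} {f : V → ℤ}
  {c : Fin g.l → List ℤ}

theorem IsLinking.ne_base (hc : IsLinking g R M a b prof f c) (hb : IsBase g R M a b f)
    (h : IsArrangement lo hi r M a b) {e : Fin g.l} {z : ℤ} (hz : z ∈ c e) {v : V}
    (hv : v ∈ g.base) : f v ≠ z := by
  have hM := h.large
  rcases hv with ⟨i, hi, hv⟩ | ⟨i, hi, hv⟩ | ⟨i, hi, hv⟩
  · rintro rfl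
    obtain ⟨j, hj, h1, h2⟩ := hc.region e _ hz
    have h3 := hb.core_range i hi v hv
    have := h.core_outside hi hj h3.1 h3.2 (by omega)
    omega
  · rintro rfl
    exact hc.notMem_out e _ hz i hi ⟨v, hv, rfl⟩
  · rintro rfl
    exact hc.notMem_in e _ hz i hi ⟨v, hv, rfl⟩

theorem IsLinking.exists_map (hc : IsLinking g R M a b prof f c) (h : g.Fits lo hi M a b prof)
    (hb : IsBase g R M a b f) (hr : 1 ≤ r) (hm : 0 < m) (e : Fin g.l) :
    ∃ F : V → ℤ, Set.InjOn F {v | v ∈ (g.Q e).support} ∧ (∀ v ∈ (g.Q e).inner, F v ∈ c e) ∧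
      (∀ u v, (g.Q e).toSub.Adj u v → R (F u) (F v)) ∧ F (g.Q e).first = f (g.Q e).first ∧
      F (g.Q e).last = f (g.Q e).last := by
  obtain ⟨hpos, -, -⟩ := h.profile.length_eq e
  obtain ⟨hs, ht⟩ := h.link_ends hb hr hm e
  have hne := (hb.injOn h.arr).ne hs ht ((g.Q e).first_ne_last hpos)
  have hn : (f (g.Q e).first :: (c e ++ [f (g.Q e).last])).Nodup := by
    rw [List.nodup_cons, List.nodup_append]
    refine ⟨?_, hc.nodup e, List.nodup_singleton _, ?_⟩
    · intro h1
      rcases List.mem_append.1 h1 with h1 | h1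
      · exact hc.ne_base hb h.arr h1 hs rfl
      · exact hne (List.mem_singleton.1 h1)
    · rintro z hz w hw rfl
      exact hc.ne_base hb h.arr hz ht (List.mem_singleton.1 hw).symm
  have hlen : (f (g.Q e).first :: (c e ++ [f (g.Q e).last])).length = (g.Q e).support.length := by
    have h1 := hc.length e
    rw [(g.Q e).ncard_inner hpos] at h1
    have h2 := (g.Q e).length_pos
    simp only [DiPath.length] at h1 hpos
    simp only [List.length_cons, List.length_append, List.length_nil, h1]
    omega
  obtain ⟨F, h1, h2, h3, h4, h5⟩ := (g.Q e).exists_map hlen (hc.chain e) hn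
  have h4' : F (g.Q e).first = f (g.Q e).first := by simpa using h4.symm
  have h5' : F (g.Q e).last = f (g.Q e).last := by
    rw [← List.cons_append, List.getLast?_concat, Option.some.injEq] at h5
    exact h5.symm
  refine ⟨F, h1, ?_, h3, h4', h5'⟩
  intro v hv
  rw [DiPath.mem_inner] at hv
  have h6 := h2 v hv.1
  rw [← h4', ← h5', List.mem_cons, List.mem_append, List.mem_singleton] at h6
  rcases h6 with h6 | h6 | h6
  · exact absurd (h1 hv.1 (g.Q e).head_mem h6) hv.2.1
  · exact h6
  · exact absurd (h1 hv.1 (g.Q e).last_mem h6) hv.2.2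

/-- After deleting the forest and link positions, the rest of the closed interval from `b i` to `a
(i + 1)` has exactly as many vertices as `P_i`, so a spanning path is an image of `P_i`. -/
theorem IsLinking.exists_seg_map [Finite V] (hc : IsLinking g R M a b prof f c)
    (h : g.Fits lo hi M a b prof) (hR : IsMedian R lo hi) (hb : IsBase g R M a b f)
    (hm : 0 < m) {i : ℕ} (hi : i < r) :
    ∃ F : V → ℤ, Set.InjOn F {v | v ∈ (g.seg (2 * i)).support} ∧
      (∀ v ∈ (g.seg (2 * i)).inner, b i < F v ∧ F v < a (i + 1) ∧ F v ∉ f '' g.outPart i ∧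
        F v ∉ f '' g.inPart i ∧ ∀ e, F v ∉ c e) ∧
      (∀ u v, (g.seg (2 * i)).toSub.Adj u v → R (F u) (F v)) ∧ F (g.seg (2 * i)).first = b i ∧
      F (g.seg (2 * i)).last = a (i + 1) := by
  have hM := h.arr.large
  have hg := h.arr.gap i hi
  set O : Finset ℤ := (Set.toFinite (f '' g.outPart i)).toFinset with hO
  set I : Finset ℤ := (Set.toFinite (f '' g.inPart i)).toFinset with hI
  set C : Fin g.l → Finset ℤ := fun e => {z ∈ (c e).toFinset | b i < z ∧ z < a (i + 1)} with hC
  have hOc : #O = (g.outPart i).ncard := by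
    rw [hO, ← Set.ncard_eq_toFinset_card _ (Set.toFinite _),
      (hb.out_inj i hi).ncard_image]
  have hIc : #I = (g.inPart i).ncard := by
    rw [hI, ← Set.ncard_eq_toFinset_card _ (Set.toFinite _),
      (hb.in_inj i hi).ncard_image]
  have hCc : ∀ e, #(C e) = prof e i := by
    intro e
    rw [← hc.count e i hi, List.countP_eq_length_filter, hC,
      ← List.toFinset_card_of_nodup ((hc.nodup e).filter _), List.toFinset_filter]
    congr 1
    ext z
    simp
  have hOr : ∀ z ∈ O, b i + 8 * M ≤ z ∧ z ≤ b i + 40 * M := by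
    intro z hz
    obtain ⟨v, hv, rfl⟩ := (Set.Finite.mem_toFinset _).1 hz
    exact hb.out_range i hi v hv
  have hIr : ∀ z ∈ I, a (i + 1) - 500 * M ≤ z ∧ z ≤ a (i + 1) - 220 * M := by
    intro z hz
    obtain ⟨v, hv, rfl⟩ := (Set.Finite.mem_toFinset _).1 hz
    exact hb.in_range i hi v hv
  have hOI : Disjoint O I := by
    rw [disjoint_left]
    intro z h1 h2
    have := hOr z h1
    have := hIr z h2
    omega
  have hOIC : Disjoint (O ∪ I) (univ.biUnion C) := by
    rw [disjoint_left]
    intro z h1 h2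
    obtain ⟨e, -, h2⟩ := mem_biUnion.1 h2
    have h2' : z ∈ c e := by simpa using (mem_filter.1 h2).1
    rcases mem_union.1 h1 with h1 | h1
    · exact hc.notMem_out e z h2' i hi ((Set.Finite.mem_toFinset _).1 h1)
    · exact hc.notMem_in e z h2' i hi ((Set.Finite.mem_toFinset _).1 h1)
  have hCd : #(univ.biUnion C) = ∑ e, prof e i := by
    rw [card_biUnion, sum_congr rfl fun e _ => hCc e]
    refine fun e _ e' _ hne => disjoint_left.2 ?_
    intro z h1 h2
    exact hc.disjoint e e' hne z (by simpa using (mem_filter.1 h1).1)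
      (by simpa using (mem_filter.1 h2).1)
  have hCr : ∀ z ∈ univ.biUnion C, b i + 8 * M ≤ z ∧ z ≤ a (i + 1) - 8 * M ∧
      (b i + 993 * M ≤ z → b i + 1007 * M < z) := by
    intro z hz
    obtain ⟨e, -, hz⟩ := mem_biUnion.1 hz
    obtain ⟨hz', hz1⟩ := mem_filter.1 hz
    have hzc := List.mem_toFinset.1 hz'
    obtain ⟨j, hj, h1, h2⟩ := hc.region e z hzc
    obtain rfl := (h.arr.region_unique hj hi hz1.1 hz1.2).1 ⟨by omega, by omega⟩
    exact ⟨h1, h2, hc.middle e z hzc j hi⟩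
  set A := O ∪ I ∪ univ.biUnion C with hA
  have hAc : #A = (g.outPart i).ncard + (g.inPart i).ncard + ∑ e, prof e i := by
    rw [hA, card_union_of_disjoint hOIC, card_union_of_disjoint hOI, hOc, hIc, hCd]
  have hsum : ∑ e, prof e i ≤ M := by
    have h1 : ∑ e, prof e i ≤ ∑ _e : Fin g.l, 3 := by
      refine sum_le_sum fun e _ => ?_
      rcases h.profile e with ⟨j, j', -, -, -, -, -, h6⟩ | ⟨j, -, -, -, -, h6⟩ <;> rw [h6] <;>
        split_ifs <;> omega
    rw [sum_const, card_univ, Fintype.card_fin, smul_eq_mul] at h1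
    have h2 := g.l_le
    have h3 := h.sq_le
    have h4 : r ≤ r * r := Nat.le_mul_self r
    have h5 : 6 * r * r = 6 * (r * r) := by ring
    omega
  have hn := h.ncard_le hi
  have hlo := h.arr.lo_le_core (i := i) hi.le
  have hci := h.arr.core i hi.le
  have hhi := h.arr.core_le_hi (i := i + 1) hi
  have hci' := h.arr.core (i + 1) hi
  have hArange : ∀ z ∈ A, b i + 8 * M ≤ z ∧ z ≤ a (i + 1) - 8 * M ∧
      (b i + 993 * M ≤ z → b i + 1007 * M < z) := by
    intro z hz
    rcases mem_union.1 hz with hz | hz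
    · rcases mem_union.1 hz with hz | hz
      · have := hOr z hz
        omega
      · have := hIr z hz
        omega
    · exact hCr z hz
  -- At most `3M` vertices are deleted, so a margin of `8M` at the ends and a free stretch of `7M`
  -- on either side of `e` exceed the required `2 * #A`.
  obtain ⟨l, hl⟩ := hR.exists_spanning_path (p := b i) (q := a (i + 1)) (e := b i + 1000 * M)
    (c := 8 * M) (by omega) (by omega) (by omega) (by omega) A (by omega)
    (fun z hz => ⟨(hArange z hz).1, (hArange z hz).2.1⟩) (by
      intro z h1 h2 hz
      have := hArange z hz
      omega)
  have hlen : l.length = (g.seg (2 * i)).support.length := by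
    rw [hl.length_eq, card_sdiff_of_subset, Int.card_Icc, hAc]
    · have h1 := h.gap i hi
      have h2 := g.segP_length_pos hm hi
      rw [(g.seg (2 * i)).ncard_inner h2] at h1
      simp only [DiPath.length] at h1 h2
      omega
    · intro z hz
      have := hArange z hz
      rw [mem_Icc]
      omega
  obtain ⟨F, h1, h2, h3, h4, h5⟩ := (g.seg (2 * i)).exists_map hlen hl.chain hl.nodup
  rw [hl.head, Option.some.injEq] at h4
  rw [hl.last, Option.some.injEq] at h5
  refine ⟨F, h1, ?_, h3, h4.symm, h5.symm⟩
  intro v hv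
  rw [DiPath.mem_inner] at hv
  obtain ⟨h6, h7⟩ := mem_sdiff.1 ((hl.mem_iff _).1 (h2 v hv.1))
  rw [mem_Icc] at h6
  have h8 : F v ≠ b i := fun h9 => hv.2.1 (h1 hv.1 (g.seg _).head_mem (h9.trans h4))
  have h9 : F v ≠ a (i + 1) := fun h9 => hv.2.2 (h1 hv.1 (g.seg _).last_mem (h9.trans h5))
  rw [hA, mem_union, mem_union, not_or, not_or] at h7
  refine ⟨by omega, by omega, fun h10 => h7.1.1 ((Set.Finite.mem_toFinset _).2 h10),
    fun h10 => h7.1.2 ((Set.Finite.mem_toFinset _).2 h10), fun e h10 => h7.2 ?_⟩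
  exact mem_biUnion.2 ⟨e, mem_univ _, mem_filter.2 ⟨List.mem_toFinset.2 h10, by omega, by omega⟩⟩

theorem Fits.exists_embedding [Finite V] (h : g.Fits lo hi M a b prof) (hR : IsMedian R lo hi)
    (hr : 1 ≤ r) (hm : 0 < m) :
    ∃ F : V → ℤ, Function.Injective F ∧ (∀ v, lo ≤ F v ∧ F v ≤ hi) ∧
      ∀ u v, T.Adj u v → R (F u) (F v) := by
  have hM := h.arr.large
  obtain ⟨f, hb⟩ := h.exists_base hR hr hm
  obtain ⟨c, hc⟩ := h.exists_linking hR hb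
  have hp := fun i : Fin r => hc.exists_seg_map h hR hb hm i.2
  choose fp hp1 hp2 hp3 hp4 hp5 using hp
  choose fq hq1 hq2 hq3 hq4 hq5 using hc.exists_map h hb hr hm
  obtain ⟨F, hF⟩ := exists_glue g.piece (g.piece_disjoint hr hm)
    (Sum.elim (Sum.elim (fun _ => f) fp) (Sum.elim (fun _ => f) (Sum.elim (fun _ => f) fq)))
  have hFbase : ∀ v ∈ g.base, F v = f v := by
    rintro v (⟨i, hi, hv⟩ | ⟨i, hi, hv⟩ | ⟨i, hi, hv⟩)
    · exact hF (.inl (.inl ⟨i, by omega⟩)) v hv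
    · exact hF (.inr (.inl ⟨i, hi⟩)) v hv
    · exact hF (.inr (.inr (.inl ⟨i, hi⟩))) v hv
  -- The gluing defines the map on inner vertices only. It agrees with `fp` at the ends too, where
  -- both equal the core placement.
  have hFp : ∀ i : Fin r, ∀ v ∈ (g.seg (2 * i)).support, F v = fp i v := by
    intro i v hv
    by_cases h1 : v = (g.seg (2 * i)).first
    · subst h1
      rw [hp4, hFbase _ (Or.inl ⟨i, i.2.le, g.first_mem_core hr hm i.2⟩), hb.first i i.2]
    by_cases h2 : v = (g.seg (2 * i)).last
    · subst h2
      rw [hp5, hFbase _ (Or.inl ⟨i + 1, i.2, g.last_mem_core hr hm i.2⟩), hb.last i i.2]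
    exact hF (.inl (.inr i)) v ((DiPath.mem_inner _).2 ⟨hv, h1, h2⟩)
  have hFq : ∀ e, ∀ v ∈ (g.Q e).support, F v = fq e v := by
    intro e v hv
    obtain ⟨hs, ht⟩ := h.link_ends hb hr hm e
    by_cases h1 : v = (g.Q e).first
    · subst h1
      rw [hq4, hFbase _ hs]
    by_cases h2 : v = (g.Q e).last
    · subst h2
      rw [hq5, hFbase _ ht]
    exact hF (.inr (.inr (.inr e))) v ((DiPath.mem_inner _).2 ⟨hv, h1, h2⟩)
  have hcases : ∀ v, v ∈ g.base ∨ (∃ i : Fin r, v ∈ (g.seg (2 * i)).inner) ∨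
      ∃ e, v ∈ (g.Q e).inner := by
    intro v
    obtain ⟨(i | i) | i | i | e, hv⟩ := g.piece_cover hr hm v
    · exact Or.inl (Or.inl ⟨i, by omega, hv⟩)
    · exact Or.inr (Or.inl ⟨i, hv⟩)
    · exact Or.inl (Or.inr (Or.inl ⟨i, i.2, hv⟩))
    · exact Or.inl (Or.inr (Or.inr ⟨i, i.2, hv⟩))
    · exact Or.inr (Or.inr ⟨e, hv⟩)
  have hinner : ∀ i : Fin r, ∀ v ∈ (g.seg (2 * i)).inner, b i < F v ∧ F v < a (i + 1) ∧
      (∀ u ∈ g.base, F u ≠ F v) ∧ ∀ e, F v ∉ c e := by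
    intro i v hv
    obtain ⟨h1, h2, h3, h4, h5⟩ := hp2 i v hv
    rw [← hFp i v ((DiPath.mem_inner _).1 hv).1] at h1 h2 h3 h4 h5
    refine ⟨h1, h2, ?_, h5⟩
    intro u hu huv
    rw [hFbase u hu] at huv
    rcases hu with ⟨j, hj, hu⟩ | ⟨j, hj, hu⟩ | ⟨j, hj, hu⟩
    · have h6 := hb.core_range j hj u hu
      have := h.arr.core_outside hj i.2 h6.1 h6.2 (by omega)
      omega
    · have h6 := hb.out_range j hj u hu
      have h7 := h.arr.gap j hj
      obtain rfl := (h.arr.region_unique hj i.2 h1 h2).1 ⟨by omega, by omega⟩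
      exact h3 ⟨u, hu, huv⟩
    · have h6 := hb.in_range j hj u hu
      have h7 := h.arr.gap j hj
      obtain rfl := (h.arr.region_unique hj i.2 h1 h2).1 ⟨by omega, by omega⟩
      exact h4 ⟨u, hu, huv⟩
  have hlink : ∀ e, ∀ v ∈ (g.Q e).inner, F v ∈ c e := by
    intro e v hv
    rw [hFq e v ((DiPath.mem_inner _).1 hv).1]
    exact hq2 e v hv
  have base_link : ∀ u ∈ g.base, ∀ e, ∀ v ∈ (g.Q e).inner, F u ≠ F v := by
    intro u hu e v hv
    rw [hFbase u hu]
    exact hc.ne_base hb h.arr (hlink e v hv) hu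
  refine ⟨F, ?_, ?_, ?_⟩
  · intro u v huv
    rcases hcases u with hu | ⟨i, hu⟩ | ⟨e, hu⟩ <;> rcases hcases v with hv | ⟨j, hv⟩ | ⟨e', hv⟩
    · rw [hFbase u hu, hFbase v hv] at huv
      exact hb.injOn h.arr hu hv huv
    · exact absurd huv ((hinner j v hv).2.2.1 u hu)
    · exact absurd huv (base_link u hu e' v hv)
    · exact absurd huv.symm ((hinner i u hu).2.2.1 v hv)
    · have h1 := hinner i u hu
      have h2 := hinner j v hv
      obtain rfl : i = j := Fin.ext ((h.arr.region_unique i.2 j.2 h2.1 h2.2.1).1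
        ⟨huv ▸ h1.1, huv ▸ h1.2.1⟩)
      have h3 := ((DiPath.mem_inner _).1 hu).1
      have h4 := ((DiPath.mem_inner _).1 hv).1
      rw [hFp i u h3, hFp i v h4] at huv
      exact hp1 i h3 h4 huv
    · exact absurd (huv ▸ hlink e' v hv) ((hinner i u hu).2.2.2 e')
    · exact absurd huv.symm (base_link v hv e u hu)
    · exact absurd (huv ▸ hlink e u hu) ((hinner j v hv).2.2.2 e)
    · by_cases hee : e = e'
      · subst hee
        have h3 := ((DiPath.mem_inner _).1 hu).1
        have h4 := ((DiPath.mem_inner _).1 hv).1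
        rw [hFq e u h3, hFq e v h4] at huv
        exact hq1 e h3 h4 huv
      · exact absurd (huv ▸ hlink e' v hv) (hc.disjoint e e' hee _ (hlink e u hu))
  · have region_le : ∀ i < r, ∀ z, b i ≤ z → z ≤ a (i + 1) → lo ≤ z ∧ z ≤ hi := by
      intro i hi z h1 h2
      have := h.arr.lo_le_core (i := i) hi.le
      have := h.arr.core i hi.le
      have := h.arr.core_le_hi (i := i + 1) hi
      have := h.arr.core (i + 1) hi
      omega
    intro v
    rcases hcases v with hv | ⟨i, hv⟩ | ⟨e, hv⟩
    · rw [hFbase v hv]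
      rcases hv with ⟨i, hi, hv⟩ | ⟨i, hi, hv⟩ | ⟨i, hi, hv⟩
      · have := hb.core_range i hi v hv
        have := h.arr.lo_le_core (i := i) hi
        have := h.arr.core_le_hi (i := i) hi
        omega
      · have := hb.out_range i hi v hv
        have := h.arr.gap i hi
        exact region_le i hi _ (by omega) (by omega)
      · have := hb.in_range i hi v hv
        have := h.arr.gap i hi
        exact region_le i hi _ (by omega) (by omega)
    · have := hinner i v hv
      exact region_le i i.2 _ (by omega) (by omega)
    · obtain ⟨i, hi, h1, h2⟩ := hc.region e _ (hlink e v hv)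
      exact region_le i hi _ (by omega) (by omega)
  · have core_adj : ∀ i ≤ r, ∀ u v, g.CoreAdj i u v → R (F u) (F v) := by
      intro i hi u v huv
      rw [hFbase u (Or.inl ⟨i, hi, huv.mem.1⟩), hFbase v (Or.inl ⟨i, hi, huv.mem.2⟩)]
      exact hb.core_adj i hi u v huv
    intro u v huv
    rcases g.adj_cases hr huv with (h1 | h1 | ⟨i, hi, h1⟩) | ⟨i, hi, h1⟩ | ⟨i, hi, h1⟩ |
      ⟨i, hi, h1⟩ | ⟨e, h1⟩
    · exact core_adj 0 (by omega) u v (Or.inl ⟨rfl, h1⟩)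
    · exact core_adj r le_rfl u v (Or.inr (Or.inl ⟨rfl, h1⟩))
    · exact core_adj (i + 1) (by omega) u v (Or.inr (Or.inr ⟨i, rfl, hi, h1⟩))
    · have h2 := hFp ⟨i, hi⟩ u ((g.seg _).toSub.left_mem h1)
      have h3 := hFp ⟨i, hi⟩ v ((g.seg _).toSub.right_mem h1)
      rw [h2, h3]
      exact hp3 ⟨i, hi⟩ u v h1
    · rw [hFbase u (hb.position h.arr (j := i) (by omega) (Or.inr ((g.F _ _).left_mem h1))).1,
        hFbase v (hb.position h.arr (j := i) (by omega) (Or.inr ((g.F _ _).right_mem h1))).1]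
      exact hb.out_adj i hi u v h1
    · rw [hFbase u (hb.position h.arr (j := i + 1) hi (Or.inl ((g.F _ _).left_mem h1))).1,
        hFbase v (hb.position h.arr (j := i + 1) hi (Or.inl ((g.F _ _).right_mem h1))).1]
      exact hb.in_adj i hi u v h1
    · rw [hFq e u ((g.Q e).toSub.left_mem h1), hFq e v ((g.Q e).toSub.right_mem h1)]
      exact hq3 e u v h1

end GoodDecomposition

/-! ### Choice of the intervals and conclusion -/

namespace GoodDecomposition

open scoped Classical

variable {V : Type*} {r : ℕ} {m : ℝ} {D T : Digraph V} (g : GoodDecomposition r m D T)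

theorem core_nonempty (hr : 1 ≤ r) (hm : 0 < m) {i : ℕ} (hi : i ≤ r) : (g.core i).Nonempty := by
  rcases hi.eq_or_lt with rfl | hlt
  · exact ⟨g.y, g.y_mem_core⟩
  · exact ⟨_, g.first_mem_core hr hm hlt⟩

/-- Cores and gaps are laid out consecutively from position `0`. Their lengths add up to `|V| + p +
q - 2`, so the last core ends exactly at the upper bound. -/
theorem exists_fits [Fintype V] (hr : 1 ≤ r) (hm : 0 < m) {M : ℕ} (hM : 100 ≤ M)
    (hF : ∀ d i, 1 ≤ i → i ≤ r + 1 → (g.F d i).order ≤ M)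
    (hP : ∀ i < r, 2000 * M ≤ (g.seg (2 * i)).length) (hrM : 6 * r * r ≤ M) :
    ∃ a b prof, g.Fits 0 (Fintype.card V + g.inArb.inLeaves.ncard + g.outArb.outLeaves.ncard - 3)
      M a b prof := by
  obtain ⟨prof, hprof⟩ := g.exists_isProfile
  set p : ℤ := (g.inArb.inLeaves.ncard : ℤ) with hp
  set q : ℤ := (g.outArb.outLeaves.ncard : ℤ) with hq
  -- The surplus `p - 1` and `q - 1` is what the greedy embedding needs at the two arborescences; no
  -- other piece gets spare positions.
  set s : ℕ → ℤ := fun i => (g.core i).ncard + (if i = 0 then p - 1 else 0) +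
    (if i = r then q - 1 else 0) with hs
  set t : ℕ → ℤ := fun i => (g.seg (2 * i)).inner.ncard + (g.outPart i).ncard +
    (g.inPart i).ncard + ∑ j, prof j i with ht
  have hcore : ∀ i ≤ r, 1 ≤ (g.core i).ncard ∧ (g.core i).ncard ≤ M := by
    intro i hi
    refine ⟨?_, (Set.ncard_le_ncard (g.S_sub_F .plus (i + 1) (by omega) (by omega))).trans
      (hF .plus (i + 1) (by omega) (by omega))⟩
    rw [Nat.one_le_iff_ne_zero, ← Nat.pos_iff_ne_zero, Set.ncard_pos]
    exact g.core_nonempty hr hm hi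
  have h0 : (g.core 0).ncard = g.inArb.order := by
    rw [g.core_zero]
    rfl
  have hr' : (g.core r).ncard = g.outArb.order := by
    rw [g.core_r]
    rfl
  have hp' : g.inArb.inLeaves.ncard ≤ g.inArb.order := Set.ncard_le_ncard fun v hv => hv.1
  have hq' : g.outArb.outLeaves.ncard ≤ g.outArb.order := Set.ncard_le_ncard fun v hv => hv.1
  have h2 := g.two_le_inArb
  have h2' := g.two_le_outArb
  have hs0 : s 0 = g.inArb.order + p - 1 := by
    simp only [hs, if_pos, if_neg (show 0 ≠ r by omega), h0]
    ring
  have hsr : s r = g.outArb.order + q - 1 := by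
    simp only [hs, if_pos, if_neg (show r ≠ 0 by omega), hr']
    ring
  have hsm : ∀ i, i ≠ 0 → i ≠ r → s i = (g.core i).ncard := by
    intro i h3 h4
    simp only [hs, if_neg h3, if_neg h4, add_zero]
  have hsb : ∀ i ≤ r, 1 ≤ s i ∧ s i ≤ 2 * M := by
    intro i hi
    have h3 := hcore i hi
    by_cases h4 : i = 0
    · subst h4
      omega
    by_cases h5 : i = r
    · subst h5
      omega
    rw [hsm i h4 h5]
    omega
  have htb : ∀ i < r, 2000 * (M : ℤ) - 1 ≤ t i := by
    intro i hi
    have h3 := hP i hi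
    have h4 : 0 ≤ ∑ j, (prof j i : ℤ) := sum_nonneg fun _ _ => Int.natCast_nonneg _
    simp only [ht]
    rw [(g.seg (2 * i)).ncard_inner (by omega)]
    push_cast
    omega
  have hsum : ∑ i ∈ range (r + 1), s i + ∑ i ∈ range r, t i = Fintype.card V + p + q - 2 := by
    have h3 : ∑ i ∈ range (r + 1), s i = ∑ i ∈ range (r + 1), ((g.core i).ncard : ℤ) +
        (p - 1) + (q - 1) := by
      simp only [hs, sum_add_distrib, sum_ite_eq', mem_range]
      rw [if_pos (by omega), if_pos (by omega)]
    have h4 : ∑ i ∈ range r, ((∑ j, prof j i : ℕ) : ℤ) = ∑ j, ((g.Q j).inner.ncard : ℤ) := by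
      rw [← Nat.cast_sum, sum_comm, ← Nat.cast_sum]
      exact congrArg _ (sum_congr rfl fun j _ => (hprof.length_eq j).2.2)
    have h5 : (Fintype.card V : ℤ) = _ := congrArg Nat.cast (g.card_eq_sum hr hm)
    push_cast at h5
    simp only [ht]
    rw [h3, sum_add_distrib, h4, h5]
    ring
  refine ⟨fun i => ∑ j ∈ range i, (s j + t j), fun i => ∑ j ∈ range i, (s j + t j) + s i - 1, prof,
    ⟨⟨?_, ?_, ?_, ?_, by omega⟩, hF, hrM, hprof, ?_, ?_, ?_, ?_⟩⟩
  · simp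
  · rw [sum_range_succ] at hsum
    rw [sum_add_distrib]
    omega
  · intro i hi
    have := hsb i hi
    omega
  · intro i hi
    have := htb i hi
    rw [sum_range_succ]
    omega
  · rw [hs0]
    ring
  · rw [hsr]
    ring
  · intro i hi
    rw [hsm (i + 1) (by omega) (by omega)]
    ring
  · intro i hi
    rw [sum_range_succ]
    simp only [ht]
    push_cast
    ring

theorem exists_copy (g : GoodDecomposition r m D T) [Fintype V] {W : Type*} [Fintype W] {G : Digraph W} (hr : 1 ≤ r)
    (hm : (6 * r * r + 101 : ℝ) ≤ m) (hG : IsTournament G)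
    (hW : Fintype.card V + (leaves T).ncard ≤ Fintype.card W + 2) : ContainsCopy G T := by
  have hm0 : 0 < m := by
    have : (0 : ℝ) ≤ 6 * r * r := by positivity
    linarith
  set M := ⌊m⌋₊ with hMdef
  have hfloor : (M : ℝ) ≤ m := Nat.floor_le hm0.le
  have hM : 6 * r * r + 101 ≤ M := by
    apply Nat.le_floor
    push_cast
    exact hm
  obtain ⟨a, b, prof, hfits⟩ := g.exists_fits hr hm0 (M := M) (by omega)
    (fun d i h1 h2 => Nat.le_floor (g.order_F d i h1 h2)) (by
      intro i hi
      have h1 := g.length_segP (i + 1) (by omega) (by omega)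
      rw [g.seg_even]
      have h2 : (2000 * M : ℝ) ≤ (g.segP (i + 1)).length := by linarith
      exact_mod_cast h2) (by omega)
  have hl := g.leaves_le
  -- The length of `P₁` forces this, and with it the tournament is nonempty, as a median order
  -- requires.
  have hV : 3 ≤ Fintype.card V := by
    have h1 : (g.seg 0).support.toFinset.card ≤ Fintype.card V := card_le_univ _
    rw [List.toFinset_card_of_nodup (g.seg 0).nodup] at h1
    have h2 := g.length_segP 1 le_rfl hr
    rw [← g.seg_even 0] at h2
    have h3 : (2000 * M : ℝ) ≤ (g.seg 0).length := by
      rw [Nat.mul_zero] at h2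
      linarith
    have h4 : 2000 * M ≤ (g.seg 0).length := by exact_mod_cast h3
    simp only [DiPath.length] at h4
    omega
  have : Nonempty W := Fintype.card_pos_iff.1 (by omega)
  obtain ⟨e, he, hmed⟩ := exists_median_order G.Adj fun u v huv => by
    have := hG.2 u v huv
    rw [xor_iff_iff_not] at this
    exact this
  obtain ⟨F, hF1, hF2, hF3⟩ := hfits.exists_embedding
    (R := fun i j => G.Adj (e i) (e j)) (hmed.mono le_rfl (by omega)) hr hm0
  refine ⟨⟨fun v => e (F v), fun u v huv => hF1 (he ?_ ?_ huv)⟩, hF3⟩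
  · have := hF2 u
    exact ⟨this.1, by omega⟩
  · have := hF2 v
    exact ⟨this.1, by omega⟩

end GoodDecomposition

end TreesInTournaments

theorem lemma4p4 (μ : ℝ) (hμ : 0 < μ) (r k : ℕ) (hr : 1 ≤ r) (hk : 1 ≤ k) :
    ∃ n₀ : ℕ, ∀ n : ℕ, n₀ ≤ n → ∀ m : ℝ, μ * n ≤ m →
      ∀ (V : Type*) [Fintype V] (W : Type*) [Fintype W] (T : Digraph V) (G : Digraph W),
        Fintype.card V = n → TreesInTournaments.IsOrientedTree T →
        (TreesInTournaments.leaves T).ncard = k →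
        TreesInTournaments.HasGoodDecomposition r m T →
        Fintype.card W = n + k - 2 → TreesInTournaments.IsTournament G →
        TreesInTournaments.ContainsCopy G T := by
  -- Largeness of `n` serves only to make `m` at least `6r² + 101`, so that its integer part exceeds
  -- both 100 and the number of link vertices.
  refine ⟨⌈(6 * r * r + 101) / μ⌉₊, ?_⟩
  rintro n hn m hm V _ W _ T G hV - hT ⟨D, ⟨g⟩⟩ hW hG
  refine g.exists_copy hr ?_ hG (by omega)
  have h1 : (6 * r * r + 101) / μ ≤ n := Nat.ceil_le.1 hn
  rw [div_le_iff₀ hμ] at h1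
  linarith
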